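/- Let $L>0$, $\sigma>0$, and let $g\in C[0,\infty)\cap C^2(0,\infty)$ satisfy $g(0)=0$, $(\sigma-u)g(u)>0$ for all $u>0$ with $u\neq\sigma$, and $g''<0$ on $(0,\sigma)$. For $\lambda,\mu>0$ consider $$-\left(\frac{u'}{\sqrt{1-u'^2}}\right)'=\lambda g(u)-\mu\ \text{ in }(-L,L),\qquad u(-L)=u(L)=0. \tag{1}$$ A positive solution is a function $u\in C^2(-L,L)\cap C[-L,L]$ with $|u'|<1$ and $u>0$ on $(-L,L)$ satisfying (1). For $\lambda>0$ let $$\Sigma_\lambda=\{(\mu,\|u\|_\infty):\mu>0,\ u\text{ is a positive solution of (1)}\}.$$ Let $g'(0^+)=\lim_{u\to0^+}g'(u)\in(0,\infty]$, and let $\kappa=\pi^2/(4g'(0^+)L^2)$ if $g'(0^+)<\infty$ and $\kappa=0$ if $g'(0^+)=\infty$. Put $G(u)=\int_0^u g(t)\,dt$. Let $c^*$ be the unique number in $(0,\sigma)$ such that $(G(u)/u)'$ is positive on $(0,c^*)$, zero at $c^*$ and negative on $(c^*,\sigma)$; then $G(c^*)/c^*=g(c^*)$. Let $\mu_\lambda=g(c^*)\lambda$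 and $c_L^*=\min\{c^*,L\}$. For $0<\mu<\mu_\lambda$ the function $\lambda g(u)-\mu$ has exactly two zeros $\varsigma<\beta$ in $(0,\sigma)$, being negative on $(0,\varsigma)\cup(\beta,\sigma)$ and positive on $(\varsigma,\beta)$; let $\theta_{\mu,\lambda}$ be the unique number in $(\varsigma,\beta)$ with $\lambda G(\theta_{\mu,\lambda})=\mu\,\theta_{\mu,\lambda}$. For $\lambda>\kappa$ let $\gamma_\lambda$ be the unique number in $(0,\sigma)$ such that $$\int_0^{\gamma_\lambda}\frac{\lambda[G(\gamma_\lambda)-G(u)]+1}{\sqrt{\lambda^2[G(\gamma_\lambda)-G(u)]^2+2\lambda[G(\gamma_\lambda)-G(u)]}}\,du=L .$$ For an interval $I$, say that a set $S$ in the $(\mu,\|u\|_\infty)$-plane is a continuous, reversed $\subset$-shaped curve over $I$ if $S=\{(m(\alpha),\alpha):\alpha\in I\}$ for a continuous function $m:I\to\mathbb R$ for which there is an interior point $a$ of $I$ such that $m$ is strictly increasing on $I\cap(-\infty,a]$ and strictly decreasing on $I\cap[a,\infty)$. The numbers $c^*$ and $\gamma_\lambda$ ($\lambda>\kappa$) are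 well defined, and the following hold. (i) Assume that $g'(0^+)<\infty$. (a) If $0<\lambda\le\kappa$, then $\Sigma_\lambda=\emptyset$. (b) If $\kappa<\lambda\le4\kappa$, then $\Sigma_\lambda$ is a continuous, reversed $\subset$-shaped curve over $(0,\gamma_\lambda)$ that starts from $(0,0)$ and goes to $(0,\gamma_\lambda)$; that is, $(m(\alpha),\alpha)\to(0,0)$ as $\alpha\to0^+$ and $(m(\alpha),\alpha)\to(0,\gamma_\lambda)$ as $\alpha\to\gamma_\lambda^-$. (ii) Let $g'(0^+)\in(0,\infty]$. For every $\lambda>4\kappa$ there exists $\bar\mu=\bar\mu(\lambda)\in(0,\mu_\lambda)$ such that, with $\theta=\theta_{\bar\mu,\lambda}$ (which is well defined), $\Sigma_\lambda$ is a continuous, reversed $\subset$-shaped curve over $[\theta,\gamma_\lambda)$ that starts from $(\bar\mu,\theta)$ and goes to $(0,\gamma_\lambda)$; that is, $m(\theta)=\bar\mu$ and $(m(\alpha),\alpha)\to(0,\gamma_\lambda)$ as $\alpha\to\gamma_\lambda^-$. In particular, the starting point is $(\bar\mu,\|u_{\bar\mu}\|_\infty)$ for a positive solution $u_{\bar\mu}$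 of (1) with $\mu=\bar\mu$ and $\|u_{\bar\mu}\|_\infty=\theta_{\bar\mu,\lambda}$. Moreover $\bar\mu$ and $\|u_{\bar\mu}\|_\infty=\theta_{\bar\mu,\lambda}$ are strictly increasing and continuous functions of $\lambda\in(4\kappa,\infty)$, and $$\lim_{\lambda\to(4\kappa)^+}(\bar\mu,\|u_{\bar\mu}\|_\infty)=(0,0),\qquad \lim_{\lambda\to\infty}(\bar\mu,\|u_{\bar\mu}\|_\infty)=(\infty,c_L^*).$$ -/

import Mathlib

open Set Filter Topology

namespace MinkowskiLogistic

noncomputable section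

/-- The standing assumptions on the growth function: `g ∈ C[0,∞) ∩ C²(0,∞)`, `g 0 = 0`,
`(σ - u) g(u) > 0` for `u > 0`, `u ≠ σ`, and `g'' < 0` on `(0, σ)`. -/
structure IsGeneralizedLogistic (g : ℝ → ℝ) (σ : ℝ) : Prop where
  sigma_pos : 0 < σ
  continuousOn : ContinuousOn g (Ici 0)
  contDiffOn : ContDiffOn ℝ 2 g (Ioi 0)
  map_zero : g 0 = 0
  sign : ∀ u : ℝ, 0 < u → u ≠ σ → 0 < (σ - u) * g u
  concave : ∀ u ∈ Ioo 0 σ, deriv (deriv g) u < 0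

/-- A positive solution `u ∈ C²(-L,L) ∩ C[-L,L]` of
`-(u' / √(1 - u'²))' = lam * g(u) - mu` in `(-L,L)`, `u(-L) = u(L) = 0`. -/
structure IsPositiveSolution (g : ℝ → ℝ) (L lam mu : ℝ) (u : ℝ → ℝ) : Prop where
  continuousOn : ContinuousOn u (Icc (-L) L)
  contDiffOn : ContDiffOn ℝ 2 u (Ioo (-L) L)
  abs_deriv_lt_one : ∀ x ∈ Ioo (-L) L, |deriv u x| < 1
  equation : ∀ x ∈ Ioo (-L) L,
    -deriv (fun y => deriv u y / √(1 - deriv u y ^ 2)) x = lam * g (u x) - mu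
  left_eq_zero : u (-L) = 0
  right_eq_zero : u L = 0
  pos : ∀ x ∈ Ioo (-L) L, 0 < u x

/-- The sup norm `‖u‖_∞` on `[-L, L]`. -/
def supNorm (L : ℝ) (u : ℝ → ℝ) : ℝ := sSup ((fun x => |u x|) '' Icc (-L) L)

/-- The bifurcation curve `Σ_lam` in the `(mu, ‖u‖_∞)`-plane. -/
def bifurcationCurve (g : ℝ → ℝ) (L lam : ℝ) : Set (ℝ × ℝ) :=
  {p | 0 < p.1 ∧ ∃ u : ℝ → ℝ, IsPositiveSolution g L lam p.1 u ∧ p.2 = supNorm L u}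

/-- The one-sided limit `g'(0⁺)`, in the extended reals. -/
def derivZeroPlus (g : ℝ → ℝ) : EReal :=
  limUnder (𝓝[>] (0 : ℝ)) (fun u => ((deriv g u : ℝ) : EReal))

/-- `κ = π² / (4 g'(0⁺) L²)` if `g'(0⁺)` is finite, and `κ = 0` if `g'(0⁺) = ∞`. -/
def kappa (g : ℝ → ℝ) (L : ℝ) : ℝ :=
  open Classical in
  if derivZeroPlus g = ⊤ then 0 else Real.pi ^ 2 / (4 * (derivZeroPlus g).toReal * L ^ 2)

/-- `G(u) = ∫₀ᵘ g`. -/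
def primitive (g : ℝ → ℝ) (u : ℝ) : ℝ := ∫ t in (0 : ℝ)..u, g t

/-- `c` is the number `c* ∈ (0, σ)` at which `G(u)/u` passes from increasing to decreasing. -/
structure IsCStar (g : ℝ → ℝ) (σ c : ℝ) : Prop where
  mem : c ∈ Ioo 0 σ
  deriv_pos : ∀ u ∈ Ioo 0 c, 0 < deriv (fun v => primitive g v / v) u
  deriv_eq_zero : deriv (fun v => primitive g v / v) c = 0
  deriv_neg : ∀ u ∈ Ioo c σ, deriv (fun v => primitive g v / v) u < 0
  value : primitive g c / c = g c

/-- `z` and `b` are the two zeros of `f(u) = lam * g(u) - mu` in `(0, σ)`, with `f < 0` on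
`(0, z) ∪ (b, σ)` and `f > 0` on `(z, b)`. -/
structure IsZeroPair (g : ℝ → ℝ) (σ mu lam z b : ℝ) : Prop where
  left_mem : z ∈ Ioo 0 σ
  right_mem : b ∈ Ioo 0 σ
  lt : z < b
  left_zero : lam * g z - mu = 0
  right_zero : lam * g b - mu = 0
  neg_left : ∀ u ∈ Ioo 0 z, lam * g u - mu < 0
  pos_mid : ∀ u ∈ Ioo z b, 0 < lam * g u - mu
  neg_right : ∀ u ∈ Ioo b σ, lam * g u - mu < 0

/-- `t` is the number `θ_{mu,lam}`: the zero of `F(u) = lam * G(u) - mu * u` strictly between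
the two zeros of `f(u) = lam * g(u) - mu` in `(0, σ)`. -/
def IsTheta (g : ℝ → ℝ) (σ mu lam t : ℝ) : Prop :=
  ∃ z b : ℝ, IsZeroPair g σ mu lam z b ∧ t ∈ Ioo z b ∧ lam * primitive g t - mu * t = 0

/-- The time map `T_{0,lam}` of the problem with `mu = 0`. -/
def timeMapZero (g : ℝ → ℝ) (lam α : ℝ) : ℝ :=
  ∫ u in (0 : ℝ)..α,
    (lam * (primitive g α - primitive g u) + 1) /
      √(lam ^ 2 * (primitive g α - primitive g u) ^ 2
        + 2 * lam * (primitive g α - primitive g u))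

/-- `c` is the number `γ_lam ∈ (0, σ)` with `T_{0,lam}(γ_lam) = L`. -/
def IsGamma (g : ℝ → ℝ) (σ L lam c : ℝ) : Prop :=
  c ∈ Ioo 0 σ ∧ timeMapZero g lam c = L

/-- The plane set `S` is the continuous curve `α ↦ (m α, α)`, `α ∈ I`, traversed upwards, and is
reversed `⊂`-shaped: it has exactly one turning point `(m a, a)`, with `a` interior to `I`;
its abscissa strictly increases up to that point and strictly decreases after it. -/
structure IsReversedSubsetShaped (S : Set (ℝ × ℝ)) (I : Set ℝ) (m : ℝ → ℝ) : Prop where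
  eq_image : S = (fun α => (m α, α)) '' I
  continuousOn : ContinuousOn m I
  turning : ∃ a ∈ interior I, StrictMonoOn m (I ∩ Iic a) ∧ StrictAntiOn m (I ∩ Ici a)

end

end MinkowskiLogistic

/-! A solution with maximum α conserves energy: 1/√(1-u'²) - 1 equals the deficit D = F(α) - F(u),
where F(u) = λG(u) - μu. Hence 1/u' = `slowness D` on the rising branch, the solution is symmetric
about 0, and solving (1) amounts to T(λ,μ,α) = ∫₀^α `slowness D` du = L. So Σ_λ is a level set of
`timeMap` (`mem_bifurcationCurve_iff`) over the parameters `IsAdmissible`: μ < λg(α) makes T finite,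
and μα ≤ λG(α) says D ≥ 0 at u = 0, with equality when the boundary slope vanishes.

T strictly increases with μ, so each height α carries at most one μ = m(α). Which heights occur
(`exists_onCurve_iff`) is decided by T at the two ends of the μ-range. At μ = 0, T strictly
increases in α. At the upper end, either α < c* and the range stops at the edge value λG(α)/α, where
T is `edgeTimeMap` and again increases in α, or α ≥ c* and T blows up as μ → λg(α). As α → 0 these
two time maps tend to (π/2)/√(λg'(0⁺)) and π/√(λg'(0⁺)), which equal L at λ = κ and λ = 4κ when
g'(0⁺) is finite; this is the source of the thresholds.

The shape comes from convexity. With u = αs the kernel is α·`slowness (α²Q)`, Q = λ·`scaledGap` -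
(μ/α)(1-s). It is jointly convex in (1/α, Q) and decreasing in Q (`mul_slowness_convex`), while Q is
concave in (1/α, μ/α), because perspectives of the concave g are concave. So T is convex in (1/α,
μ/α), strictly so between different heights (`timeMap_convex`). In these coordinates μ is constant
along rays from the origin, and m is therefore strictly quasiconcave (`onCurve_min_lt`). An interior
value exceeding those near both ends then yields exactly one turning point (`exists_unimodal`).

At γ_λ, and at 0 when λ ≤ 4κ, m tends to 0. For λ > 4κ the curve starts at the root θ of
`edgeTimeMap` = L, and m first increases there: the edge kernel is singular like s^(-1/2), so
raising the height by e gains order √e in T against a loss of order e (`exists_timeMap_lt_edge`).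
The dependence of θ and μ̄ on λ follows from monotonicity of `edgeTimeMap` in α and λ. -/

namespace MinkowskiLogistic

/-! ### The kernel: bounds and monotonicity -/

/-- The reciprocal speed `1 / u'` of a solution in terms of its energy deficit `D`. -/
noncomputable def slowness (D : ℝ) : ℝ := (D + 1) / √(D ^ 2 + 2 * D)

theorem slowness_eq_sqrt {D : ℝ} (hD : 0 < D) : slowness D = √(1 + 1 / (D ^ 2 + 2 * D)) := by
  have h : 0 < D ^ 2 + 2 * D := by positivity
  rw [slowness, eq_comm, Real.sqrt_eq_iff_mul_self_eq (by positivity) (by positivity),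
    div_mul_div_comm, Real.mul_self_sqrt h.le]
  field_simp
  ring

theorem slowness_pos {D : ℝ} (hD : 0 < D) : 0 < slowness D := by
  unfold slowness; positivity

theorem one_le_slowness {D : ℝ} (hD : 0 < D) : 1 ≤ slowness D := by
  rw [slowness_eq_sqrt hD, Real.one_le_sqrt]
  have : 0 < 1 / (D ^ 2 + 2 * D) := by positivity
  linarith

theorem slowness_strictAntiOn : StrictAntiOn slowness (Ioi 0) := by
  intro a ha b hb hab
  have ha' : (0 : ℝ) < a := ha
  rw [slowness_eq_sqrt ha, slowness_eq_sqrt hb]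
  apply Real.sqrt_lt_sqrt
  · have : (0 : ℝ) < b := hb
    positivity
  · have : 1 / (b ^ 2 + 2 * b) < 1 / (a ^ 2 + 2 * a) := by
      apply one_div_lt_one_div_of_lt (by positivity)
      nlinarith
    linarith

theorem slowness_anti {a b : ℝ} (ha : 0 < a) (hab : a ≤ b) : slowness b ≤ slowness a :=
  slowness_strictAntiOn.antitoneOn ha (ha.trans_le hab) hab

theorem continuousOn_slowness : ContinuousOn slowness (Ioi 0) := by
  unfold slowness
  apply ContinuousOn.div (by fun_prop) (by fun_prop)
  intro x hx
  have : (0 : ℝ) < x := hx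
  positivity

theorem measurable_slowness : Measurable slowness := by
  unfold slowness; fun_prop

/-- Together with `slowness_le` this compares the kernel with the classical one 1/√(2D), up to an
additive 1. Integrability at zeros of the deficit and the small-amplitude limits are thus those of
the semilinear problem. -/
theorem inv_sqrt_le_slowness {D : ℝ} (hD : 0 < D) : 1 / √(2 * D) ≤ slowness D := by
  rw [slowness_eq_sqrt hD, ← Real.sqrt_one, ← Real.sqrt_div zero_le_one, Real.sqrt_one]
  apply Real.sqrt_le_sqrt
  have h : 1 / (2 * D) = 1 / (D ^ 2 + 2 * D) + 1 / (2 * (D + 2)) := by field_simp; ring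
  have : 1 / (2 * (D + 2)) ≤ 1 := by rw [div_le_one (by positivity)]; linarith
  linarith

theorem slowness_le {D : ℝ} (hD : 0 < D) : slowness D ≤ 1 + 1 / √(2 * D) := by
  rw [slowness_eq_sqrt hD]
  apply Real.sqrt_le_iff.2 ⟨by positivity, ?_⟩
  have h1 : (1 / √(2 * D)) ^ 2 = 1 / (2 * D) := by
    rw [div_pow, Real.sq_sqrt (by positivity)]; norm_num
  have h2 : 1 / (D ^ 2 + 2 * D) ≤ 1 / (2 * D) := by
    apply one_div_le_one_div_of_le (by positivity); nlinarith
  have h3 : 0 < 1 / √(2 * D) := by positivity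
  nlinarith

/-- If `4 D ≤ E` then passing from `D` to `E` halves the bound on the slowness in excess of `1`. -/
theorem slowness_le_of_four_mul_le {D E : ℝ} (hD : 0 < D) (hE : 4 * D ≤ E) :
    slowness E ≤ 1 + 1 / 2 * (1 / √(2 * D)) := by
  have h4 : √(2 * (4 * D)) = 2 * √(2 * D) := by
    rw [show 2 * (4 * D) = 2 ^ 2 * (2 * D) by ring, Real.sqrt_mul (by positivity),
      Real.sqrt_sq (by norm_num)]
  calc slowness E ≤ slowness (4 * D) := slowness_anti (by positivity) hE
    _ ≤ 1 + 1 / √(2 * (4 * D)) := slowness_le (by positivity)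
    _ = _ := by rw [h4]; field_simp

theorem mul_slowness_eq_sqrt {α Q : ℝ} (hα : 0 < α) (hQ : 0 < Q) :
    α * slowness (α ^ 2 * Q) = √(α ^ 2 + 1 / (Q ^ 2 * α ^ 2 + 2 * Q)) := by
  rw [slowness_eq_sqrt (by positivity)]
  nth_rw 1 [← Real.sqrt_sq hα.le]
  rw [← Real.sqrt_mul (by positivity)]
  congr 1
  field_simp

/-- The kernel decreases in Q. For fixed Q its square is a + 1/(Q²a + 2Q) with a = α², whose
derivative 1 - 1/(Qa + 2)² is positive. This gives monotonicity in the height both at μ = 0 and on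
the edge. -/
theorem mul_slowness_lt {α₁ α₂ Q₁ Q₂ : ℝ} (h1 : 0 < α₁) (h12 : α₁ < α₂) (hQ : 0 < Q₂)
    (hQ12 : Q₂ ≤ Q₁) : α₁ * slowness (α₁ ^ 2 * Q₁) < α₂ * slowness (α₂ ^ 2 * Q₂) := by
  have h2 : 0 < α₂ := h1.trans h12
  have hstep : α₁ * slowness (α₁ ^ 2 * Q₁) ≤ α₁ * slowness (α₁ ^ 2 * Q₂) := by
    apply mul_le_mul_of_nonneg_left _ h1.le
    exact slowness_anti (by positivity) (by gcongr)
  refine hstep.trans_lt ?_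
  rw [mul_slowness_eq_sqrt h1 hQ, mul_slowness_eq_sqrt h2 hQ]
  apply Real.sqrt_lt_sqrt (by positivity)
  set a := α₁ ^ 2
  set b := α₂ ^ 2
  have ha : 0 < a := by positivity
  have hab : a < b := by simp only [a, b]; gcongr
  have hb : 0 < b := ha.trans hab
  have hd : 1 / (Q₂ ^ 2 * a + 2 * Q₂) - 1 / (Q₂ ^ 2 * b + 2 * Q₂)
      = (b - a) / ((Q₂ * a + 2) * (Q₂ * b + 2)) := by
    field_simp; ring
  have : (b - a) / ((Q₂ * a + 2) * (Q₂ * b + 2)) < b - a := by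
    rw [div_lt_iff₀ (by positivity)]
    have : 1 < (Q₂ * a + 2) * (Q₂ * b + 2) := by nlinarith [mul_pos hQ ha, mul_pos hQ hb]
    nlinarith
  linarith

/-! ### Joint convexity of the kernel by an envelope representation -/

/-- The convex function of `x` whose shifts by multiples of `Q` envelop the time-map kernel. -/
noncomputable def envelope (S x : ℝ) : ℝ := √(x ^ 2 + S ^ 2) ^ 3 / x - x ^ 2

theorem hasDerivAt_sqrt_sq_add {S x : ℝ} (hS : 0 < S) :
    HasDerivAt (fun x : ℝ => √(x ^ 2 + S ^ 2)) (x / √(x ^ 2 + S ^ 2)) x := by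
  have h : HasDerivAt (fun x : ℝ => x ^ 2 + S ^ 2) (2 * x) x := by
    simpa using (hasDerivAt_pow 2 x).add_const (S ^ 2)
  convert h.sqrt (by positivity) using 1
  field_simp

theorem hasDerivAt_envelope {S x : ℝ} (hS : 0 < S) (hx : 0 < x) :
    HasDerivAt (envelope S)
      (3 * √(x ^ 2 + S ^ 2) - √(x ^ 2 + S ^ 2) ^ 3 / x ^ 2 - 2 * x) x := by
  have hw : 0 < √(x ^ 2 + S ^ 2) := by positivity
  have h := (((hasDerivAt_sqrt_sq_add (x := x) hS).pow 3).div (hasDerivAt_id x) hx.ne').sub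
    (hasDerivAt_pow 2 x)
  refine HasDerivAt.congr_deriv (f := envelope S) h ?_
  simp only [Pi.pow_apply, id, Nat.cast_ofNat, Nat.reduceSub, mul_one, pow_one]
  field_simp

theorem hasDerivAt_deriv_envelope {S x : ℝ} (hS : 0 < S) (hx : 0 < x) :
    HasDerivAt (fun x => 3 * √(x ^ 2 + S ^ 2) - √(x ^ 2 + S ^ 2) ^ 3 / x ^ 2 - 2 * x)
      ((√(x ^ 2 + S ^ 2) / x - 1) ^ 2 *
        (2 * (√(x ^ 2 + S ^ 2) / x) ^ 2 + 4 * (√(x ^ 2 + S ^ 2) / x) + 3) /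
          (√(x ^ 2 + S ^ 2) / x)) x := by
  have hw : 0 < √(x ^ 2 + S ^ 2) := by positivity
  have h0 := hasDerivAt_sqrt_sq_add (x := x) hS
  have h := ((h0.const_mul 3).sub ((h0.pow 3).div (hasDerivAt_pow 2 x) (by positivity))).sub
    ((hasDerivAt_id x).const_mul 2)
  refine HasDerivAt.congr_deriv h ?_
  simp only [Pi.pow_apply, Nat.cast_ofNat, Nat.reduceSub, mul_one, pow_one]
  field_simp
  ring

theorem strictConvexOn_envelope {S : ℝ} (hS : 0 < S) :
    StrictConvexOn ℝ (Ioi 0) (envelope S) := by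
  apply StrictMonoOn.strictConvexOn_of_deriv (convex_Ioi 0)
  · exact fun x hx => (hasDerivAt_envelope hS hx).continuousAt.continuousWithinAt
  · rw [interior_Ioi]
    have h1 : StrictMonoOn
        (fun x => 3 * √(x ^ 2 + S ^ 2) - √(x ^ 2 + S ^ 2) ^ 3 / x ^ 2 - 2 * x) (Ioi 0) := by
      apply strictMonoOn_of_deriv_pos (convex_Ioi 0)
      · exact fun x hx => (hasDerivAt_deriv_envelope hS hx).continuousAt.continuousWithinAt
      · rw [interior_Ioi]
        intro x hx
        have hx' : (0 : ℝ) < x := hx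
        rw [(hasDerivAt_deriv_envelope hS hx).deriv]
        -- The ratio √(x²+S²)/x exceeds 1, so the squared factor of the second derivative does not
        -- vanish.
        have h1 : x < √(x ^ 2 + S ^ 2) := Real.lt_sqrt_of_sq_lt (by nlinarith)
        have h2 : 1 < √(x ^ 2 + S ^ 2) / x := by rwa [one_lt_div hx']
        have h3 : 0 < √(x ^ 2 + S ^ 2) / x - 1 := by linarith
        positivity
    intro a ha b hb hab
    rw [(hasDerivAt_envelope hS ha).deriv, (hasDerivAt_envelope hS hb).deriv]
    exact h1 ha hb hab

/-- Hölder's inequality with exponents 3 and 3/2 applied to 1·x² + v^(2/3)·(S²/v^(2/3)), with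
equality at S = xv. After S = wv it reduces to w³ - 3wx² + 2x³ = (w - x)²(w + 2x) ≥ 0 and its mirror
image. -/
theorem cube_le_of_weights {S x v : ℝ} (hS : 0 < S) (hx : 0 < x) (hv : 0 < v) :
    (x ^ 2 + S ^ 2) ^ 3 ≤ (1 + v ^ 2) * (S ^ 3 / v + x ^ 3) ^ 2 := by
  obtain ⟨w, hw, rfl⟩ : ∃ w, 0 < w ∧ S = w * v := ⟨S / v, by positivity, by field_simp⟩
  have h1 : (w * v) ^ 3 / v = w ^ 3 * v ^ 2 := by field_simp
  rw [h1]
  have key : (1 + v ^ 2) * (w ^ 3 * v ^ 2 + x ^ 3) ^ 2 - (x ^ 2 + (w * v) ^ 2) ^ 3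
      = (w - x) ^ 2 * (w + 2 * x) * (w ^ 3 * v ^ 4)
        + x ^ 3 * v ^ 2 * ((x - w) ^ 2 * (x + 2 * w)) := by ring
  have : 0 ≤ (w - x) ^ 2 * (w + 2 * x) * (w ^ 3 * v ^ 4)
        + x ^ 3 * v ^ 2 * ((x - w) ^ 2 * (x + 2 * w)) := by positivity
  linarith

/-- The kernel `(1/x) * slowness (Q / x²)` in terms of `v = √(D² + 2D)`. -/
theorem slowness_eq_of_momentum {D v : ℝ} (hD : 0 < D) (hv : v = √(D ^ 2 + 2 * D)) :
    slowness D = √(1 + v ^ 2) / v ∧ D = √(1 + v ^ 2) - 1 := by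
  have h1 : v ^ 2 = D ^ 2 + 2 * D := by rw [hv, Real.sq_sqrt (by positivity)]
  have h2 : √(1 + v ^ 2) = D + 1 := by
    rw [h1, show 1 + (D ^ 2 + 2 * D) = (D + 1) ^ 2 by ring, Real.sqrt_sq (by positivity)]
  rw [h2, hv, slowness]
  constructor <;> ring

/-- With `exists_envelope_sub_eq`, the kernel is the maximum over S > 0 of functions strictly convex
in 1/α and affine in Q. This gives joint convexity without computing a Hessian. -/
theorem envelope_sub_le {S α Q : ℝ} (hS : 0 < S) (hα : 0 < α) (hQ : 0 < Q) :
    (envelope S (1 / α) - Q) / S ^ 3 ≤ α * slowness (α ^ 2 * Q) := by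
  set D := α ^ 2 * Q with hD
  have hDpos : 0 < D := by positivity
  set v := √(D ^ 2 + 2 * D) with hv
  have hvpos : 0 < v := by positivity
  obtain ⟨h1, h2⟩ := slowness_eq_of_momentum hDpos hv
  obtain ⟨x, hx, rfl⟩ : ∃ x, 0 < x ∧ α = 1 / x := ⟨1 / α, by positivity, by simp⟩
  have hQ' : Q = x ^ 2 * D := by rw [hD]; field_simp
  rw [h1, hQ', h2, one_div_one_div, envelope]
  set c := √(1 + v ^ 2) with hc
  have hcpos : 0 < c := by positivity
  have hmain : √(x ^ 2 + S ^ 2) ^ 3 ≤ c * (S ^ 3 / v + x ^ 3) := by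
    apply le_of_sq_le_sq _ (by positivity)
    rw [← pow_mul, mul_comm 3 2, pow_mul, Real.sq_sqrt (by positivity), mul_pow,
      Real.sq_sqrt (by positivity)]
    exact cube_le_of_weights hS hx hvpos
  rw [div_le_iff₀ (by positivity)]
  have : √(x ^ 2 + S ^ 2) ^ 3 / x ≤ c * (S ^ 3 / v + x ^ 3) / x := by gcongr
  have e : 1 / x * (c / v) * S ^ 3 = c * (S ^ 3 / v + x ^ 3) / x - x ^ 2 * c := by
    field_simp; ring
  rw [e]
  linarith

theorem exists_envelope_sub_eq {α Q : ℝ} (hα : 0 < α) (hQ : 0 < Q) :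
    ∃ S, 0 < S ∧ (envelope S (1 / α) - Q) / S ^ 3 = α * slowness (α ^ 2 * Q) := by
  set D := α ^ 2 * Q with hD
  have hDpos : 0 < D := by positivity
  set v := √(D ^ 2 + 2 * D) with hv
  have hvpos : 0 < v := by positivity
  obtain ⟨h1, h2⟩ := slowness_eq_of_momentum hDpos hv
  obtain ⟨x, hx, rfl⟩ : ∃ x, 0 < x ∧ α = 1 / x := ⟨1 / α, by positivity, by simp⟩
  have hQ' : Q = x ^ 2 * D := by rw [hD]; field_simp
  -- The equality case S = xv of `cube_le_of_weights`.
  refine ⟨x * v, by positivity, ?_⟩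
  have hs : √(x ^ 2 + (x * v) ^ 2) = x * √(1 + v ^ 2) := by
    rw [show x ^ 2 + (x * v) ^ 2 = x ^ 2 * (1 + v ^ 2) by ring, Real.sqrt_mul (by positivity),
      Real.sqrt_sq hx.le]
  rw [h1, hQ', h2, one_div_one_div, envelope, hs]
  have hc : √(1 + v ^ 2) ^ 2 = 1 + v ^ 2 := Real.sq_sqrt (by positivity)
  set c := √(1 + v ^ 2)
  field_simp
  have : c ^ 3 = c * (1 + v ^ 2) := by rw [← hc]; ring
  rw [this]; ring

/-- Joint convexity of the time-map kernel in `(1/α, Q)`, strict in `1/α`. -/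
theorem mul_slowness_convex {α₁ α₂ α Q₁ Q₂ Q t₁ t₂ : ℝ} (h1 : 0 < α₁) (h2 : 0 < α₂)
    (hne : α₁ ≠ α₂) (hQ1 : 0 < Q₁) (hQ2 : 0 < Q₂) (ht1 : 0 < t₁) (ht2 : 0 < t₂)
    (ht : t₁ + t₂ = 1) (hα : 1 / α = t₁ * (1 / α₁) + t₂ * (1 / α₂))
    (hQ : t₁ * Q₁ + t₂ * Q₂ ≤ Q) :
    α * slowness (α ^ 2 * Q) <
      t₁ * (α₁ * slowness (α₁ ^ 2 * Q₁)) + t₂ * (α₂ * slowness (α₂ ^ 2 * Q₂)) := by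
  have hα0 : 0 < α := by
    have : 0 < 1 / α := by rw [hα]; positivity
    simpa using this
  have hQ0 : 0 < Q := lt_of_lt_of_le (by positivity) hQ
  -- Choose the member of the family touching the kernel at the intermediate point; the same member
  -- lies below the kernel at both end points.
  obtain ⟨S, hS, heq⟩ := exists_envelope_sub_eq hα0 hQ0
  have e1 := envelope_sub_le hS h1 hQ1
  have e2 := envelope_sub_le hS h2 hQ2
  have hx1 : (0 : ℝ) < 1 / α₁ := by positivity
  have hx2 : (0 : ℝ) < 1 / α₂ := by positivity
  have hc := (strictConvexOn_envelope hS).2 hx1 hx2 (by simpa using hne) ht1 ht2 ht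
  simp only [smul_eq_mul] at hc
  rw [← hα] at hc
  rw [← heq]
  calc (envelope S (1 / α) - Q) / S ^ 3
      < (t₁ * envelope S (1 / α₁) + t₂ * envelope S (1 / α₂) - (t₁ * Q₁ + t₂ * Q₂)) / S ^ 3 := by
        apply div_lt_div_of_pos_right _ (by positivity)
        linarith
    _ = t₁ * ((envelope S (1 / α₁) - Q₁) / S ^ 3) + t₂ * ((envelope S (1 / α₂) - Q₂) / S ^ 3) := by
        ring
    _ ≤ _ := by gcongr

/-! ### Secants and perspectives of concave functions -/

/-- Secant slopes of a concave function decrease as the interval moves right. -/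
theorem secant_anti {s : Set ℝ} {f : ℝ → ℝ} (hf : ConcaveOn ℝ s f) {a b c d : ℝ}
    (ha : a ∈ s) (hb : b ∈ s) (hc : c ∈ s) (hd : d ∈ s) (hab : a < b) (hcd : c < d)
    (hac : a ≤ c) (hbd : b ≤ d) : (f d - f c) / (d - c) ≤ (f b - f a) / (b - a) := by
  -- Pass through the slope over [a, d], moving one end point at a time.
  have h1 := hf.neg.secant_mono ha hb hd hab.ne' (by linarith) hbd
  have h2 := hf.neg.secant_mono hd ha hc (by linarith) hcd.ne hac
  simp only [Pi.neg_apply] at h1 h2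
  have e1 : (-f b - -f a) / (b - a) = -((f b - f a) / (b - a)) := by ring
  have e2 : (-f d - -f a) / (d - a) = -((f d - f a) / (d - a)) := by ring
  have e3 : (-f a - -f d) / (a - d) = -((f d - f a) / (d - a)) := by
    rw [← neg_sub d a, div_neg]; ring
  have e4 : (-f c - -f d) / (c - d) = -((f d - f c) / (d - c)) := by
    rw [← neg_sub d c, div_neg]; ring
  rw [e1, e2] at h1
  rw [e3, e4] at h2
  linarith

/-- Perspectives `x f(τ/x)` of a concave function are concave in `x`; here `x = 1/α`. -/
theorem perspective_concave {s : Set ℝ} {f : ℝ → ℝ} (hf : ConcaveOn ℝ s f)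
    {α₁ α₂ α τ t₁ t₂ : ℝ} (h1 : 0 < α₁) (h2 : 0 < α₂) (ht1 : 0 < t₁) (ht2 : 0 < t₂)
    (ht : t₁ + t₂ = 1)
    (hα : 1 / α = t₁ * (1 / α₁) + t₂ * (1 / α₂)) (hs1 : α₁ * τ ∈ s) (hs2 : α₂ * τ ∈ s) :
    t₁ * (f (α₁ * τ) / α₁) + t₂ * (f (α₂ * τ) / α₂) ≤ f (α * τ) / α := by
  have hα0 : 0 < α := by
    have : 0 < 1 / α := by rw [hα]; positivity
    simpa using this
  have hsum : α * (t₁ / α₁) + α * (t₂ / α₂) = 1 := by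
    have : α * (1 / α) = 1 := by field_simp
    rw [← this, hα]; ring
  have hc := hf.2 hs1 hs2 (show 0 ≤ α * (t₁ / α₁) by positivity)
    (show 0 ≤ α * (t₂ / α₂) by positivity) hsum
  have hpt : α * (t₁ / α₁) * (α₁ * τ) + α * (t₂ / α₂) * (α₂ * τ) = (t₁ + t₂) * (α * τ) := by
    field_simp
  simp only [smul_eq_mul] at hc
  rw [le_div_iff₀ hα0]
  rw [hpt, ht, one_mul] at hc
  refine le_trans (le_of_eq ?_) hc
  ring

/-! ### The growth function, its mean G(u)/u and the number c* -/

namespace IsGeneralizedLogistic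

variable {g : ℝ → ℝ} {σ : ℝ}

theorem pos_of_mem (hg : IsGeneralizedLogistic g σ) {u : ℝ} (hu : u ∈ Ioo 0 σ) : 0 < g u :=
  (pos_iff_pos_of_mul_pos (hg.sign u hu.1 hu.2.ne)).1 (by linarith [hu.2])

theorem neg_of_lt (hg : IsGeneralizedLogistic g σ) {u : ℝ} (hu : σ < u) : g u < 0 := by
  have := hg.sign u (hg.sigma_pos.trans hu) hu.ne'
  nlinarith

theorem continuousAt (hg : IsGeneralizedLogistic g σ) {u : ℝ} (hu : 0 < u) : ContinuousAt g u :=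
  hg.continuousOn.continuousAt (Ici_mem_nhds hu)

theorem map_sigma (hg : IsGeneralizedLogistic g σ) : g σ = 0 := by
  have hc := hg.continuousAt hg.sigma_pos
  apply le_antisymm
  · refine le_of_tendsto (hc.tendsto.mono_left nhdsWithin_le_nhds : Tendsto g (𝓝[>] σ) _) ?_
    filter_upwards [self_mem_nhdsWithin] with u hu using (hg.neg_of_lt hu).le
  · refine ge_of_tendsto (hc.tendsto.mono_left nhdsWithin_le_nhds : Tendsto g (𝓝[<] σ) _) ?_
    filter_upwards [Ioo_mem_nhdsLT hg.sigma_pos] with u hu using (hg.pos_of_mem hu).le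

theorem nonpos_of_le (hg : IsGeneralizedLogistic g σ) {u : ℝ} (hu : σ ≤ u) : g u ≤ 0 := by
  rcases hu.eq_or_lt with h | h
  · rw [← h, hg.map_sigma]
  exact (hg.neg_of_lt h).le

theorem continuousOn_Icc (hg : IsGeneralizedLogistic g σ) : ContinuousOn g (Icc 0 σ) :=
  hg.continuousOn.mono Icc_subset_Ici_self

theorem differentiableAt (hg : IsGeneralizedLogistic g σ) {u : ℝ} (hu : 0 < u) :
    DifferentiableAt ℝ g u :=
  (hg.contDiffOn.contDiffAt (Ioi_mem_nhds hu)).differentiableAt (by norm_num)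

theorem strictConcaveOn (hg : IsGeneralizedLogistic g σ) : StrictConcaveOn ℝ (Icc 0 σ) g :=
  strictConcaveOn_of_deriv2_neg (convex_Icc 0 σ) hg.continuousOn_Icc (by
    rw [interior_Icc]; exact hg.concave)

theorem concaveOn (hg : IsGeneralizedLogistic g σ) : ConcaveOn ℝ (Icc 0 σ) g :=
  hg.strictConcaveOn.concaveOn

theorem intervalIntegrable (hg : IsGeneralizedLogistic g σ) {a b : ℝ} (ha : 0 ≤ a) (hb : 0 ≤ b) :
    IntervalIntegrable g MeasureTheory.volume a b := by
  apply ContinuousOn.intervalIntegrable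
  exact hg.continuousOn.mono fun x hx => (le_inf ha hb).trans hx.1

theorem continuousOn_scaled (hg : IsGeneralizedLogistic g σ) {α : ℝ} (hα : 0 ≤ α) :
    ContinuousOn (fun τ => g (α * τ)) (Ici 0) :=
  hg.continuousOn.comp (by fun_prop) fun _ hx => mul_nonneg hα hx

theorem intervalIntegrable_scaled (hg : IsGeneralizedLogistic g σ) {α a b : ℝ} (hα : 0 ≤ α)
    (ha : 0 ≤ a) (hb : 0 ≤ b) :
    IntervalIntegrable (fun τ => g (α * τ)) MeasureTheory.volume a b := by
  apply ContinuousOn.intervalIntegrable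
  exact (hg.continuousOn_scaled hα).mono fun x hx => (le_inf ha hb).trans hx.1

theorem primitive_sub (hg : IsGeneralizedLogistic g σ) {a b : ℝ} (ha : 0 ≤ a) (hb : 0 ≤ b) :
    primitive g b - primitive g a = ∫ t in a..b, g t :=
  intervalIntegral.integral_interval_sub_left (hg.intervalIntegrable le_rfl hb)
    (hg.intervalIntegrable le_rfl ha)

theorem primitive_sub_scaled (hg : IsGeneralizedLogistic g σ) {α a b : ℝ} (hα : 0 ≤ α)
    (ha : 0 ≤ a) (hb : 0 ≤ b) :
    primitive g (α * b) - primitive g (α * a) = α * ∫ τ in a..b, g (α * τ) := by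
  rw [hg.primitive_sub (by positivity) (by positivity),
    intervalIntegral.mul_integral_comp_mul_left]

theorem hasDerivAt_primitive (hg : IsGeneralizedLogistic g σ) {u : ℝ} (hu : 0 < u) :
    HasDerivAt (primitive g) (g u) u := by
  apply intervalIntegral.integral_hasDerivAt_right (hg.intervalIntegrable le_rfl hu.le) _
    (hg.continuousAt hu)
  exact (hg.continuousOn.mono Ioi_subset_Ici_self).stronglyMeasurableAtFilter isOpen_Ioi u hu

theorem continuousOn_primitive (hg : IsGeneralizedLogistic g σ) :
    ContinuousOn (primitive g) (Ici 0) := by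
  intro u hu
  have hu' : (0 : ℝ) ≤ u := hu
  have h := intervalIntegral.continuousOn_primitive_interval
    (MeasureTheory.IntegrableOn.mono_set
      ((intervalIntegrable_iff_integrableOn_Icc_of_le (by linarith : (0 : ℝ) ≤ u + 1)).1
        (hg.intervalIntegrable le_rfl (by linarith : (0 : ℝ) ≤ u + 1)))
      (uIcc_of_le (by linarith : (0 : ℝ) ≤ u + 1)).subset)
  rw [uIcc_of_le (by linarith)] at h
  refine (h u ⟨hu', by linarith⟩).mono_of_mem_nhdsWithin ?_
  rw [mem_nhdsWithin_iff_exists_mem_nhds_inter]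
  exact ⟨Iio (u + 1), Iio_mem_nhds (by linarith), fun x hx => ⟨hx.2, hx.1.le⟩⟩

end IsGeneralizedLogistic

theorem primitive_zero (g : ℝ → ℝ) : primitive g 0 = 0 := by simp [primitive]

namespace IsGeneralizedLogistic

variable {g : ℝ → ℝ} {σ : ℝ}

/-- As an average of dilates of g, the mean inherits strict concavity from g. At α = 0 both sides
are 0, since division by zero gives 0 and g(0) = 0, so the concavity holds on the closed interval.
-/
theorem mean_eq (hg : IsGeneralizedLogistic g σ) {α : ℝ} (hα : 0 ≤ α) :
    primitive g α / α = ∫ τ in (0 : ℝ)..1, g (α * τ) := by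
  rcases hα.eq_or_lt with h | h
  · simp [← h, hg.map_zero]
  · have := hg.primitive_sub_scaled hα le_rfl zero_le_one
    rw [mul_one, mul_zero, primitive_zero, sub_zero] at this
    rw [this]; field_simp

theorem strictConcaveOn_mean (hg : IsGeneralizedLogistic g σ) :
    StrictConcaveOn ℝ (Icc 0 σ) (fun v => primitive g v / v) := by
  refine ⟨convex_Icc 0 σ, fun x hx y hy hne a b ha hb hab => ?_⟩
  have hz := convex_Icc 0 σ hx hy ha.le hb.le hab
  simp only [smul_eq_mul] at hz ⊢
  rw [hg.mean_eq hx.1, hg.mean_eq hy.1, hg.mean_eq hz.1, ← intervalIntegral.integral_const_mul,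
    ← intervalIntegral.integral_const_mul, ← intervalIntegral.integral_add, ← sub_pos,
    ← intervalIntegral.integral_sub]
  · have hmem : ∀ {z τ : ℝ}, z ∈ Icc 0 σ → τ ∈ Ioo (0 : ℝ) 1 → z * τ ∈ Icc 0 σ :=
      fun {z τ} hz hτ => ⟨mul_nonneg hz.1 hτ.1.le, by nlinarith [hz.1, hz.2, hτ.1, hτ.2]⟩
    apply intervalIntegral.intervalIntegral_pos_of_pos_on _ _ zero_lt_one
    · exact ((hg.intervalIntegrable_scaled hz.1 le_rfl zero_le_one).sub
        (((hg.intervalIntegrable_scaled hx.1 le_rfl zero_le_one).const_mul a).add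
        ((hg.intervalIntegrable_scaled hy.1 le_rfl zero_le_one).const_mul b)))
    · intro τ hτ
      have h := hg.strictConcaveOn.2 (hmem hx hτ) (hmem hy hτ)
        (by simpa [hτ.1.ne'] using hne) ha hb hab
      simp only [smul_eq_mul] at h
      rw [show a * (x * τ) + b * (y * τ) = (a * x + b * y) * τ by ring] at h
      linarith
  · exact hg.intervalIntegrable_scaled hz.1 le_rfl zero_le_one
  · exact (((hg.intervalIntegrable_scaled hx.1 le_rfl zero_le_one).const_mul a).add
        ((hg.intervalIntegrable_scaled hy.1 le_rfl zero_le_one).const_mul b))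
  · exact (hg.intervalIntegrable_scaled hx.1 le_rfl zero_le_one).const_mul a
  · exact (hg.intervalIntegrable_scaled hy.1 le_rfl zero_le_one).const_mul b

theorem hasDerivAt_mean (hg : IsGeneralizedLogistic g σ) {u : ℝ} (hu : 0 < u) :
    HasDerivAt (fun v => primitive g v / v) ((g u - primitive g u / u) / u) u := by
  refine ((hg.hasDerivAt_primitive hu).div (hasDerivAt_id u) hu.ne').congr_deriv ?_
  simp only [id, mul_one]
  field_simp

theorem deriv_mean (hg : IsGeneralizedLogistic g σ) {u : ℝ} (hu : 0 < u) :
    deriv (fun v => primitive g v / v) u = (g u - primitive g u / u) / u :=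
  (hg.hasDerivAt_mean hu).deriv

theorem strictAntiOn_deriv_mean (hg : IsGeneralizedLogistic g σ) :
    StrictAntiOn (deriv fun v => primitive g v / v) (Ioc 0 σ) :=
  (hg.strictConcaveOn_mean.subset Ioc_subset_Icc_self (convex_Ioc 0 σ)).strictAntiOn_deriv
    fun _ hx => (hg.hasDerivAt_mean hx.1).differentiableAt

theorem primitive_pos (hg : IsGeneralizedLogistic g σ) {u : ℝ} (hu : u ∈ Ioc 0 σ) :
    0 < primitive g u :=
  intervalIntegral.intervalIntegral_pos_of_pos_on (hg.intervalIntegrable le_rfl hu.1.le)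
    (fun _ ht => hg.pos_of_mem ⟨ht.1, ht.2.trans_le hu.2⟩) hu.1

theorem mean_pos (hg : IsGeneralizedLogistic g σ) {u : ℝ} (hu : u ∈ Ioc 0 σ) :
    0 < primitive g u / u := div_pos (hg.primitive_pos hu) hu.1

theorem continuousOn_mean (hg : IsGeneralizedLogistic g σ) :
    ContinuousOn (fun v => primitive g v / v) (Ioi 0) :=
  fun _ hx => (hg.hasDerivAt_mean hx).continuousAt.continuousWithinAt

theorem tendsto_mean_zero (hg : IsGeneralizedLogistic g σ) :
    Tendsto (fun v => primitive g v / v) (𝓝[>] 0) (𝓝 0) := by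
  have hd : HasDerivWithinAt (primitive g) (g 0) (Ici 0) 0 := by
    apply intervalIntegral.integral_hasDerivWithinAt_right (by simp)
    · exact (hg.continuousOn.mono Ioi_subset_Ici_self).stronglyMeasurableAtFilter_nhdsWithin
        measurableSet_Ioi 0
    · exact (hg.continuousOn 0 self_mem_Ici).mono Ioi_subset_Ici_self
  have := (hasDerivWithinAt_iff_tendsto_slope.1 hd)
  rw [Ici_sdiff_left, hg.map_zero] at this
  refine this.congr fun x => ?_
  simp [slope, primitive_zero, div_eq_inv_mul]

/-- The mean starts at 0 and is positive at σ, so its derivative is positive somewhere; at σ the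
derivative is negative because g(σ) = 0 lies below the mean. Strict concavity leaves a single sign
change. -/
theorem exists_isCStar (hg : IsGeneralizedLogistic g σ) : ∃ c, IsCStar g σ c := by
  have hσ := hg.sigma_pos
  obtain ⟨ξ, hξ, hξd⟩ : ∃ ξ ∈ Ioo 0 σ, 0 < deriv (fun v => primitive g v / v) ξ := by
    have hev : ∀ᶠ v in 𝓝[>] (0 : ℝ), primitive g v / v < primitive g σ / σ :=
      hg.tendsto_mean_zero.eventually_lt_const (hg.mean_pos ⟨hσ, le_rfl⟩)
    obtain ⟨v, hv, hvσ⟩ := (hev.and (Ioo_mem_nhdsGT hσ)).exists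
    obtain ⟨ξ, hξ, h⟩ := exists_deriv_eq_slope (fun v => primitive g v / v) hvσ.2
      (hg.continuousOn_mean.mono fun x hx => hvσ.1.trans_le hx.1)
      (fun x hx => (hg.hasDerivAt_mean (hvσ.1.trans hx.1)).differentiableAt.differentiableWithinAt)
    refine ⟨ξ, ⟨hvσ.1.trans hξ.1, hξ.2⟩, ?_⟩
    rw [h]
    exact div_pos (by linarith) (by linarith [hvσ.2])
  have hσd : deriv (fun v => primitive g v / v) σ < 0 := by
    rw [hg.deriv_mean hσ, hg.map_sigma]
    apply div_neg_of_neg_of_pos _ hσ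
    linarith [hg.mean_pos ⟨hσ, le_rfl⟩]
  have hcont : ContinuousOn (deriv fun v => primitive g v / v) (Icc ξ σ) := by
    have : ContinuousOn (fun u => (g u - primitive g u / u) / u) (Icc ξ σ) := by
      have hsub : Icc ξ σ ⊆ Ioi 0 := fun x hx => hξ.1.trans_le hx.1
      refine ((hg.continuousOn.mono (hsub.trans Ioi_subset_Ici_self)).sub
        (hg.continuousOn_mean.mono hsub)).div continuousOn_id fun x hx => (hsub hx).ne'
    exact this.congr fun x hx => hg.deriv_mean (hξ.1.trans_le hx.1)
  obtain ⟨c, hc, hc0⟩ := intermediate_value_Icc' hξ.2.le hcont ⟨hσd.le, hξd.le⟩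
  have hcξ : ξ ≠ c := by rintro rfl; exact hξd.ne' hc0
  have hcσ : c ≠ σ := by rintro rfl; exact hσd.ne hc0
  have hcm : c ∈ Ioo 0 σ := ⟨hξ.1.trans_le hc.1, lt_of_le_of_ne hc.2 hcσ⟩
  refine ⟨c, hcm, fun u hu => ?_, hc0, fun u hu => ?_, ?_⟩
  · rw [← hc0]
    exact hg.strictAntiOn_deriv_mean ⟨hu.1, (hu.2.trans hcm.2).le⟩ ⟨hcm.1, hcm.2.le⟩ hu.2
  · rw [← hc0]
    exact hg.strictAntiOn_deriv_mean ⟨hcm.1, hcm.2.le⟩ ⟨hcm.1.trans hu.1, hu.2.le⟩ hu.1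
  · rw [hg.deriv_mean hcm.1, div_eq_zero_iff] at hc0
    rcases hc0 with h | h
    · linarith
    · exact absurd h hcm.1.ne'

end IsGeneralizedLogistic

namespace IsCStar

variable {g : ℝ → ℝ} {σ c : ℝ}

theorem unique (h : IsCStar g σ c) {c' : ℝ} (h' : IsCStar g σ c') : c' = c := by
  rcases lt_trichotomy c c' with hlt | heq | hlt
  · exact absurd h.deriv_eq_zero (h'.deriv_pos c ⟨h.mem.1, hlt⟩).ne'
  · exact heq.symm
  · exact absurd h'.deriv_eq_zero (h.deriv_pos c' ⟨h'.mem.1, hlt⟩).ne'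

theorem mean_lt (h : IsCStar g σ c) (hg : IsGeneralizedLogistic g σ) {u : ℝ}
    (hu : u ∈ Ioo 0 c) : primitive g u / u < g u := by
  have := h.deriv_pos u hu
  rw [hg.deriv_mean hu.1] at this
  have := (div_pos_iff_of_pos_right hu.1).1 this
  linarith

theorem le_mean (h : IsCStar g σ c) (hg : IsGeneralizedLogistic g σ) {u : ℝ}
    (hu : u ∈ Ico c σ) : g u ≤ primitive g u / u := by
  rcases hu.1.eq_or_lt with rfl | hlt
  · exact h.value.ge
  have hu0 := h.mem.1.trans hlt
  have := h.deriv_neg u ⟨hlt, hu.2⟩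
  rw [hg.deriv_mean hu0] at this
  by_contra hcon
  have : 0 ≤ (g u - primitive g u / u) / u := div_nonneg (by linarith) hu0.le
  linarith

theorem strictMonoOn_mean (h : IsCStar g σ c) (hg : IsGeneralizedLogistic g σ) :
    StrictMonoOn (fun v => primitive g v / v) (Ioc 0 c) := by
  apply strictMonoOn_of_deriv_pos (convex_Ioc 0 c)
    (hg.continuousOn_mean.mono fun x hx => hx.1)
  rw [interior_Ioc]
  exact h.deriv_pos

theorem lt_of_mean_lt (h : IsCStar g σ c) (hg : IsGeneralizedLogistic g σ) {u : ℝ}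
    (hu : u < σ) (hlt : primitive g u / u < g u) : u < c := by
  by_contra hcon
  linarith [h.le_mean hg ⟨not_lt.1 hcon, hu⟩]

end IsCStar

/-! ### The slope at zero and increments of g -/

namespace IsGeneralizedLogistic

variable {g : ℝ → ℝ} {σ : ℝ}

theorem strictAntiOn_deriv (hg : IsGeneralizedLogistic g σ) : StrictAntiOn (deriv g) (Ioo 0 σ) :=
  (hg.strictConcaveOn.subset Ioo_subset_Icc_self (convex_Ioo 0 σ)).strictAntiOn_deriv
    fun _ hx => hg.differentiableAt hx.1

/-- By concavity g' decreases, so the limit at 0⁺ exists in the extended reals and is a supremum. -/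
theorem derivZeroPlus_eq (hg : IsGeneralizedLogistic g σ) :
    derivZeroPlus g = sSup ((fun u => ((deriv g u : ℝ) : EReal)) '' Ioo 0 σ) := by
  apply Tendsto.limUnder_eq
  apply AntitoneOn.tendsto_nhdsWithin_Ioo_right (nonempty_Ioo.2 hg.sigma_pos)
  · exact fun a ha b hb hab => EReal.coe_le_coe_iff.2 (hg.strictAntiOn_deriv.antitoneOn ha hb hab)
  · exact OrderTop.bddAbove _

theorem deriv_le_derivZeroPlus (hg : IsGeneralizedLogistic g σ) {u : ℝ} (hu : u ∈ Ioo 0 σ) :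
    ((deriv g u : ℝ) : EReal) ≤ derivZeroPlus g := by
  rw [hg.derivZeroPlus_eq]
  exact le_sSup (mem_image_of_mem (fun u => ((deriv g u : ℝ) : EReal)) hu)

theorem exists_lt_deriv (hg : IsGeneralizedLogistic g σ) {M : ℝ} (hM : (M : EReal) < derivZeroPlus g) :
    ∃ δ ∈ Ioo 0 σ, ∀ u ∈ Ioo 0 δ, M < deriv g u := by
  rw [hg.derivZeroPlus_eq, lt_sSup_iff] at hM
  obtain ⟨_, ⟨δ, hδ, rfl⟩, h⟩ := hM
  refine ⟨δ, hδ, fun u hu => (EReal.coe_lt_coe_iff.1 h).trans ?_⟩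
  exact hg.strictAntiOn_deriv ⟨hu.1, hu.2.trans hδ.2⟩ hδ hu.2

theorem derivZeroPlus_pos (hg : IsGeneralizedLogistic g σ) : 0 < derivZeroPlus g := by
  have hσ := hg.sigma_pos
  obtain ⟨ξ, hξ, h⟩ := exists_deriv_eq_slope g (half_pos hσ)
    (hg.continuousOn.mono Icc_subset_Ici_self)
    (fun x hx => (hg.differentiableAt hx.1).differentiableWithinAt)
  have hpos : 0 < deriv g ξ := by
    rw [h, hg.map_zero]
    have := hg.pos_of_mem ⟨half_pos hσ, half_lt_self hσ⟩
    apply div_pos <;> linarith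
  exact lt_of_lt_of_le (EReal.coe_pos.2 hpos)
    (hg.deriv_le_derivZeroPlus ⟨hξ.1, hξ.2.trans (half_lt_self hσ)⟩)

theorem sub_le_of_derivZeroPlus_eq (hg : IsGeneralizedLogistic g σ) {p : ℝ}
    (hp : derivZeroPlus g = p) {a b : ℝ} (ha : 0 ≤ a) (hab : a ≤ b) (hb : b ≤ σ) :
    g b - g a ≤ p * (b - a) := by
  apply (convex_Icc 0 σ).image_sub_le_mul_sub_of_deriv_le hg.continuousOn_Icc _ _ a
    ⟨ha, hab.trans hb⟩ b ⟨ha.trans hab, hb⟩ hab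
  · rw [interior_Icc]
    exact fun x hx => (hg.differentiableAt hx.1).differentiableWithinAt
  · rw [interior_Icc]
    intro x hx
    have := hg.deriv_le_derivZeroPlus hx
    rwa [hp, EReal.coe_le_coe_iff] at this

theorem exists_mul_sub_le (hg : IsGeneralizedLogistic g σ) {M : ℝ}
    (hM : (M : EReal) < derivZeroPlus g) :
    ∃ δ ∈ Ioo 0 σ, ∀ a b, 0 ≤ a → a ≤ b → b ≤ δ → M * (b - a) ≤ g b - g a := by
  obtain ⟨δ, hδ, h⟩ := hg.exists_lt_deriv hM
  refine ⟨δ, hδ, fun a b ha hab hb => ?_⟩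
  apply (convex_Icc 0 δ).mul_sub_le_image_sub_of_le_deriv
    (hg.continuousOn.mono Icc_subset_Ici_self) _ _ a
    ⟨ha, hab.trans hb⟩ b ⟨ha.trans hab, hb⟩ hab
  · rw [interior_Icc]
    exact fun x hx => (hg.differentiableAt hx.1).differentiableWithinAt
  · rw [interior_Icc]
    exact fun x hx => (h x hx).le

/-- A one-sided Lipschitz bound away from 0; none need hold up to 0, where g' may be infinite. -/
theorem exists_sub_le (hg : IsGeneralizedLogistic g σ) {a : ℝ} (ha : 0 < a) (b : ℝ) :
    ∃ C, 0 ≤ C ∧ ∀ u v, a ≤ u → u ≤ v → v ≤ b → g u - g v ≤ C * (v - u) := by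
  have hcont : ContinuousOn (deriv g) (Icc a b) := by
    refine ContinuousOn.mono ?_ (fun x hx => ha.trans_le hx.1 : Icc a b ⊆ Ioi 0)
    exact hg.contDiffOn.continuousOn_deriv_of_isOpen isOpen_Ioi (by norm_num)
  obtain ⟨C, hC⟩ := isCompact_Icc.exists_bound_of_continuousOn hcont
  refine ⟨max C 0, le_max_right _ _, fun u v hu huv hv => ?_⟩
  have := (convex_Icc a b).mul_sub_le_image_sub_of_le_deriv (C := -max C 0)
    (hg.continuousOn.mono fun x hx => ha.le.trans hx.1)
    (fun x hx => (hg.differentiableAt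
      (ha.trans_le (interior_subset hx).1)).differentiableWithinAt)
    (fun x hx => ?_) u ⟨hu, huv.trans hv⟩ v ⟨hu.trans huv, hv⟩ huv
  · linarith
  · have h1 := hC x (interior_subset hx)
    have h2 := neg_abs_le (deriv g x)
    rw [Real.norm_eq_abs] at h1
    linarith [le_max_left C 0]

end IsGeneralizedLogistic

/-! ### The energy deficit and its rescalings -/

/-- The energy deficit `F(α) - F(u)` for `F(u) = lam * G(u) - mu * u`. -/
noncomputable def gap (g : ℝ → ℝ) (lam mu α u : ℝ) : ℝ :=
  lam * (primitive g α - primitive g u) - mu * (α - u)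

/-- The parameters for which solutions of height `α` with positive slope on the left half exist,
on an interval of a suitable length. -/
structure IsAdmissible (g : ℝ → ℝ) (σ lam mu α : ℝ) : Prop where
  lam_pos : 0 < lam
  pos : 0 < α
  lt : α < σ
  mu_lt : mu < lam * g α
  mu_mul_le : mu * α ≤ lam * primitive g α

/-- The scaled increment `(G(α) - G(α s)) / α²`. -/
noncomputable def scaledGap (g : ℝ → ℝ) (α s : ℝ) : ℝ :=
  (primitive g α - primitive g (α * s)) / α ^ 2

theorem gap_eq {g : ℝ → ℝ} {lam mu α : ℝ} (s : ℝ) (hα : 0 < α) :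
    gap g lam mu α (α * s) = α ^ 2 * (lam * scaledGap g α s - mu / α * (1 - s)) := by
  unfold gap scaledGap; field_simp

namespace IsGeneralizedLogistic

variable {g : ℝ → ℝ} {σ : ℝ}

theorem scaledGap_eq (hg : IsGeneralizedLogistic g σ) {α s : ℝ} (hα : 0 < α) (hs : 0 ≤ s) :
    scaledGap g α s = ∫ τ in s..1, g (α * τ) / α := by
  have h := hg.primitive_sub_scaled hα.le hs zero_le_one
  rw [mul_one] at h
  rw [scaledGap, h, intervalIntegral.integral_div]
  field_simp

theorem mul_mem_Icc {α τ : ℝ} (hα : α ∈ Icc 0 σ) (hτ : τ ∈ Icc (0 : ℝ) 1) :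
    α * τ ∈ Icc 0 σ :=
  ⟨mul_nonneg hα.1 hτ.1, by nlinarith [hα.1, hα.2, hτ.1, hτ.2]⟩

/-- Concavity with g(0) = 0 makes g(v)/v nonincreasing; integrate over τ. -/
theorem scaledGap_anti (hg : IsGeneralizedLogistic g σ) {α₁ α₂ s : ℝ} (h1 : 0 < α₁)
    (h12 : α₁ ≤ α₂) (h2 : α₂ ≤ σ) (hs : s ∈ Icc (0 : ℝ) 1) :
    scaledGap g α₂ s ≤ scaledGap g α₁ s := by
  have hα2 := h1.trans_le h12
  rw [hg.scaledGap_eq h1 hs.1, hg.scaledGap_eq hα2 hs.1]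
  apply intervalIntegral.integral_mono_on hs.2
    ((hg.intervalIntegrable_scaled hα2.le hs.1 zero_le_one).div_const _)
    ((hg.intervalIntegrable_scaled h1.le hs.1 zero_le_one).div_const _)
  intro τ hτ
  have hτ01 : τ ∈ Icc (0 : ℝ) 1 := ⟨hs.1.trans hτ.1, hτ.2⟩
  rcases hτ01.1.eq_or_lt with h | h
  · simp [← h, hg.map_zero]
  have := secant_anti hg.concaveOn (a := 0) (b := α₁ * τ) (c := 0) (d := α₂ * τ)
    ⟨le_rfl, hg.sigma_pos.le⟩ (mul_mem_Icc ⟨h1.le, h12.trans h2⟩ hτ01)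
    ⟨le_rfl, hg.sigma_pos.le⟩ (mul_mem_Icc ⟨hα2.le, h2⟩ hτ01) (by positivity) (by positivity)
    le_rfl (by gcongr)
  rw [hg.map_zero, sub_zero, sub_zero, sub_zero, sub_zero, ← div_div, ← div_div,
    div_le_div_iff_of_pos_right h] at this
  exact this

theorem scaledGap_concave (hg : IsGeneralizedLogistic g σ) {α₁ α₂ α t₁ t₂ s : ℝ}
    (h1 : α₁ ∈ Ioc 0 σ) (h2 : α₂ ∈ Ioc 0 σ) (ht1 : 0 < t₁) (ht2 : 0 < t₂) (ht : t₁ + t₂ = 1)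
    (hα : 1 / α = t₁ * (1 / α₁) + t₂ * (1 / α₂)) (hs : s ∈ Icc (0 : ℝ) 1) :
    t₁ * scaledGap g α₁ s + t₂ * scaledGap g α₂ s ≤ scaledGap g α s := by
  have hα1 := h1.1
  have hα2 := h2.1
  have hα0 : 0 < α := by
    have : 0 < 1 / α := by rw [hα]; positivity
    simpa using this
  have i1 := (hg.intervalIntegrable_scaled hα1.le hs.1 zero_le_one).div_const α₁
  have i2 := (hg.intervalIntegrable_scaled hα2.le hs.1 zero_le_one).div_const α₂
  rw [hg.scaledGap_eq hα1 hs.1, hg.scaledGap_eq hα2 hs.1, hg.scaledGap_eq hα0 hs.1,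
    ← intervalIntegral.integral_const_mul, ← intervalIntegral.integral_const_mul,
    ← intervalIntegral.integral_add (i1.const_mul _) (i2.const_mul _)]
  apply intervalIntegral.integral_mono_on hs.2 ((i1.const_mul _).add (i2.const_mul _))
    ((hg.intervalIntegrable_scaled hα0.le hs.1 zero_le_one).div_const _)
  intro τ hτ
  have hτ01 : τ ∈ Icc (0 : ℝ) 1 := ⟨hs.1.trans hτ.1, hτ.2⟩
  exact perspective_concave hg.concaveOn hα1 hα2 ht1 ht2 ht hα
    (mul_mem_Icc ⟨hα1.le, h1.2⟩ hτ01) (mul_mem_Icc ⟨hα2.le, h2.2⟩ hτ01)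

/-- On the edge the deficit is λ(sG(α) - G(αs)). This form turns it into increments of g over [αsτ,
ατ], whose length is proportional to α, so that concavity controls it through secant slopes. -/
theorem chordGap_eq (hg : IsGeneralizedLogistic g σ) {α s : ℝ} (hα : 0 < α) (hs : 0 ≤ s) :
    (s * primitive g α - primitive g (α * s)) / α ^ 2 =
      s * ∫ τ in (0 : ℝ)..1, (g (α * τ) - g (α * s * τ)) / α := by
  have h1 := hg.primitive_sub_scaled hα.le le_rfl zero_le_one
  have h2 := hg.primitive_sub_scaled (mul_nonneg hα.le hs) le_rfl zero_le_one
  rw [mul_one, mul_zero, primitive_zero, sub_zero] at h1 h2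
  rw [h1, h2, intervalIntegral.integral_div, intervalIntegral.integral_sub
    (hg.intervalIntegrable_scaled hα.le le_rfl zero_le_one)
    (hg.intervalIntegrable_scaled (mul_nonneg hα.le hs) le_rfl zero_le_one)]
  field_simp

theorem intervalIntegrable_chord (hg : IsGeneralizedLogistic g σ) {α s : ℝ} (hα : 0 < α)
    (hs : 0 ≤ s) :
    IntervalIntegrable (fun τ => (g (α * τ) - g (α * s * τ)) / α) MeasureTheory.volume 0 1 :=
  ((hg.intervalIntegrable_scaled hα.le le_rfl zero_le_one).sub
    (hg.intervalIntegrable_scaled (mul_nonneg hα.le hs) le_rfl zero_le_one)).div_const _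

theorem chordGap_anti (hg : IsGeneralizedLogistic g σ) {α₁ α₂ s : ℝ} (h1 : 0 < α₁)
    (h12 : α₁ ≤ α₂) (h2 : α₂ ≤ σ) (hs : s ∈ Ioo (0 : ℝ) 1) :
    (s * primitive g α₂ - primitive g (α₂ * s)) / α₂ ^ 2 ≤
      (s * primitive g α₁ - primitive g (α₁ * s)) / α₁ ^ 2 := by
  have hα2 := h1.trans_le h12
  rw [hg.chordGap_eq h1 hs.1.le, hg.chordGap_eq hα2 hs.1.le]
  apply mul_le_mul_of_nonneg_left _ hs.1.le
  apply intervalIntegral.integral_mono_on zero_le_one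
    (hg.intervalIntegrable_chord hα2 hs.1.le) (hg.intervalIntegrable_chord h1 hs.1.le)
  intro τ hτ
  rcases hτ.1.eq_or_lt with h | h
  · simp [← h, hg.map_zero]
  have hs' : s ∈ Icc (0 : ℝ) 1 := ⟨hs.1.le, hs.2.le⟩
  have m1 : α₁ ∈ Icc 0 σ := ⟨h1.le, h12.trans h2⟩
  have m2 : α₂ ∈ Icc 0 σ := ⟨hα2.le, h2⟩
  have l1 : α₁ * s * τ < α₁ * τ := by
    apply mul_lt_mul_of_pos_right _ h; nlinarith [hs.2]
  have l2 : α₂ * s * τ < α₂ * τ := by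
    apply mul_lt_mul_of_pos_right _ h; nlinarith [hs.2]
  have := secant_anti hg.concaveOn (mul_mem_Icc (mul_mem_Icc m1 hs') hτ) (mul_mem_Icc m1 hτ)
    (mul_mem_Icc (mul_mem_Icc m2 hs') hτ) (mul_mem_Icc m2 hτ) l1 l2
    (by have := hs.1; gcongr) (by gcongr)
  have hk : 0 < (1 - s) * τ := mul_pos (by linarith [hs.2]) h
  rwa [show α₂ * τ - α₂ * s * τ = α₂ * ((1 - s) * τ) by ring,
    show α₁ * τ - α₁ * s * τ = α₁ * ((1 - s) * τ) by ring, ← div_div _ α₂, ← div_div _ α₁,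
    div_le_div_iff_of_pos_right hk] at this

/-- Map [0, α] affinely onto [αs, α] and use g(sα + (1-s)t) ≥ s·g(α) + (1-s)·g(t). -/
theorem le_primitive_sub (hg : IsGeneralizedLogistic g σ) {α s : ℝ} (hα : α ∈ Icc 0 σ)
    (hs : s ∈ Icc (0 : ℝ) 1) :
    (1 - s) * (s * α * g α + (1 - s) * primitive g α) ≤ primitive g α - primitive g (α * s) := by
  rcases hs.2.eq_or_lt with rfl | hs1
  · simp
  have e1 : primitive g α - primitive g (α * s)
      = (1 - s) * ∫ t in (0 : ℝ)..α, g (α * s + (1 - s) * t) := by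
    rw [hg.primitive_sub (mul_nonneg hα.1 hs.1) hα.1,
      intervalIntegral.mul_integral_comp_add_mul]
    ring_nf
  have e2 : s * α * g α + (1 - s) * primitive g α
      = ∫ t in (0 : ℝ)..α, (s * g α + (1 - s) * g t) := by
    rw [intervalIntegral.integral_add (by simp)
      ((hg.intervalIntegrable le_rfl hα.1).const_mul _)]
    simp [primitive]
    ring
  rw [e1, e2]
  apply mul_le_mul_of_nonneg_left _ (by linarith)
  apply intervalIntegral.integral_mono_on hα.1
  · exact IntervalIntegrable.add (by simp) ((hg.intervalIntegrable le_rfl hα.1).const_mul _)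
  · apply ContinuousOn.intervalIntegrable
    rw [uIcc_of_le hα.1]
    exact hg.continuousOn.comp (by fun_prop) fun t ht =>
      add_nonneg (mul_nonneg hα.1 hs.1) (mul_nonneg (by linarith) ht.1)
  · intro t ht
    have := hg.concaveOn.2 hα ⟨ht.1, ht.2.trans hα.2⟩ hs.1 (by linarith : (0 : ℝ) ≤ 1 - s)
      (by ring)
    simp only [smul_eq_mul] at this
    rwa [mul_comm s α] at this

/-- The lower bound vanishes like s(1-s), so the kernel is dominated by the arcsine density. The
other term produced by `le_primitive_sub`, (1-s)²(λG(α) - μα), is nonnegative by admissibility and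
is dropped. -/
theorem le_gap (hg : IsGeneralizedLogistic g σ) {lam mu α s : ℝ} (h : IsAdmissible g σ lam mu α)
    (hs : s ∈ Icc (0 : ℝ) 1) :
    α * (lam * g α - mu) * (s * (1 - s)) ≤ gap g lam mu α (α * s) := by
  have h1 := mul_le_mul_of_nonneg_left (hg.le_primitive_sub ⟨h.pos.le, h.lt.le⟩ hs) h.lam_pos.le
  have h2 : 0 ≤ (1 - s) ^ 2 * (lam * primitive g α - mu * α) :=
    mul_nonneg (sq_nonneg _) (by linarith [h.mu_mul_le])
  unfold gap
  nlinarith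

theorem gap_pos (hg : IsGeneralizedLogistic g σ) {lam mu α s : ℝ} (h : IsAdmissible g σ lam mu α)
    (hs : s ∈ Ioo (0 : ℝ) 1) : 0 < gap g lam mu α (α * s) := by
  refine lt_of_lt_of_le ?_ (hg.le_gap h ⟨hs.1.le, hs.2.le⟩)
  have h1 := h.pos
  have h2 := sub_pos.2 h.mu_lt
  have h3 := hs.1
  have h4 := sub_pos.2 hs.2
  positivity

/-- Upper bound for the energy deficit near the maximum. -/
theorem gap_le (hg : IsGeneralizedLogistic g σ) {lam mu a α C u : ℝ} (hlam : 0 ≤ lam)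
    (ha : 0 ≤ a) (hC : ∀ u v, a ≤ u → u ≤ v → v ≤ α → g u - g v ≤ C * (v - u)) (hC0 : 0 ≤ C)
    (hau : a ≤ u) (huα : u ≤ α) :
    gap g lam mu α u ≤ (lam * g α - mu) * (α - u) + lam * C * (α - u) ^ 2 := by
  have h : primitive g α - primitive g u ≤ ∫ t in u..α, (g α + C * (α - u)) := by
    rw [hg.primitive_sub (ha.trans hau) (ha.trans (hau.trans huα))]
    apply intervalIntegral.integral_mono_on huα
      (hg.intervalIntegrable (ha.trans hau) (ha.trans (hau.trans huα))) (by simp)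
    intro t ht
    have := hC t α (hau.trans ht.1) ht.2 le_rfl
    have : C * (α - t) ≤ C * (α - u) := by gcongr; exact ht.1
    linarith
  simp only [intervalIntegral.integral_const, smul_eq_mul] at h
  have := mul_le_mul_of_nonneg_left h hlam
  unfold gap
  nlinarith

end IsGeneralizedLogistic

/-! ### Reference integrals -/

theorem hasDerivAt_arcsin_two_mul_sub {s : ℝ} (hs : s ∈ Ioo (0 : ℝ) 1) :
    HasDerivAt (fun s : ℝ => Real.arcsin (2 * s - 1)) (1 / √(s * (1 - s))) s := by
  have h1 : HasDerivAt (fun s : ℝ => 2 * s - 1) 2 s := by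
    simpa using ((hasDerivAt_id s).const_mul 2).sub_const 1
  have h2 := (Real.hasDerivAt_arcsin (x := 2 * s - 1) (by linarith [hs.1])
    (by linarith [hs.2])).comp s h1
  refine h2.congr_deriv ?_
  rw [show 1 - (2 * s - 1) ^ 2 = 2 ^ 2 * (s * (1 - s)) by ring, Real.sqrt_mul (by norm_num),
    Real.sqrt_sq (by norm_num)]
  field_simp

theorem intervalIntegrable_arcsine :
    IntervalIntegrable (fun s : ℝ => 1 / √(s * (1 - s))) MeasureTheory.volume 0 1 := by
  apply intervalIntegral.intervalIntegrable_deriv_of_nonneg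
    (g := fun s : ℝ => Real.arcsin (2 * s - 1))
  · exact (Real.continuous_arcsin.comp (by fun_prop)).continuousOn
  · simpa using fun s h0 h1 => hasDerivAt_arcsin_two_mul_sub ⟨h0, h1⟩
  · intro s _; positivity

theorem integral_arcsine : ∫ s in (0 : ℝ)..1, 1 / √(s * (1 - s)) = Real.pi := by
  rw [intervalIntegral.integral_eq_sub_of_hasDerivAt_of_le zero_le_one
    (f := fun s : ℝ => Real.arcsin (2 * s - 1))
    (Real.continuous_arcsin.comp (by fun_prop)).continuousOn
    (fun s hs => hasDerivAt_arcsin_two_mul_sub hs) intervalIntegrable_arcsine]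
  norm_num

theorem intervalIntegrable_inv_sqrt_one_sub_sq :
    IntervalIntegrable (fun s : ℝ => 1 / √(1 - s ^ 2)) MeasureTheory.volume 0 1 := by
  apply intervalIntegral.intervalIntegrable_deriv_of_nonneg (g := Real.arcsin)
  · exact Real.continuous_arcsin.continuousOn
  · simpa using fun s h0 h1 => Real.hasDerivAt_arcsin (x := s) (by linarith) (by linarith)
  · intro s _; positivity

theorem integral_inv_sqrt_one_sub_sq :
    ∫ s in (0 : ℝ)..1, 1 / √(1 - s ^ 2) = Real.pi / 2 := by
  rw [intervalIntegral.integral_eq_sub_of_hasDerivAt_of_le zero_le_one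
    (f := Real.arcsin) Real.continuous_arcsin.continuousOn
    (fun s hs => Real.hasDerivAt_arcsin (by linarith [hs.1]) (by linarith [hs.2]))
    intervalIntegrable_inv_sqrt_one_sub_sq]
  simp

theorem integral_lt_of_forall_lt {f h : ℝ → ℝ}
    (hf : IntervalIntegrable f MeasureTheory.volume 0 1)
    (hh : IntervalIntegrable h MeasureTheory.volume 0 1) (hlt : ∀ s ∈ Ioo (0 : ℝ) 1, f s < h s) :
    ∫ s in (0 : ℝ)..1, f s < ∫ s in (0 : ℝ)..1, h s := by
  rw [← sub_pos, ← intervalIntegral.integral_sub hh hf]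
  exact intervalIntegral.intervalIntegral_pos_of_pos_on (hh.sub hf)
    (fun s hs => sub_pos.2 (hlt s hs)) zero_lt_one

/-! ### The time map: integrability, continuity, bounds and divergence -/

/-- The time map: half of the length of the interval on which a solution of height `α` lives. -/
noncomputable def timeMap (g : ℝ → ℝ) (lam mu α : ℝ) : ℝ :=
  ∫ u in (0 : ℝ)..α, slowness (gap g lam mu α u)

theorem timeMapZero_eq (g : ℝ → ℝ) (lam α : ℝ) : timeMapZero g lam α = timeMap g lam 0 α := by
  unfold timeMapZero timeMap
  congr 1
  ext u
  rw [slowness, gap]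
  ring_nf

/-- Puts the integral on a fixed interval, so that time maps at different heights compare pointwise
in s. -/
theorem timeMap_eq (g : ℝ → ℝ) (lam mu α : ℝ) :
    timeMap g lam mu α = ∫ s in (0 : ℝ)..1, α * slowness (gap g lam mu α (α * s)) := by
  rw [intervalIntegral.integral_const_mul, intervalIntegral.mul_integral_comp_mul_left
    (f := fun u => slowness (gap g lam mu α u)), mul_zero, mul_one, timeMap]

namespace IsGeneralizedLogistic

variable {g : ℝ → ℝ} {σ : ℝ}

theorem continuousOn_gap_scaled (hg : IsGeneralizedLogistic g σ) (lam mu : ℝ) {α : ℝ}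
    (hα : 0 ≤ α) : ContinuousOn (fun s => gap g lam mu α (α * s)) (Ici 0) := by
  unfold gap
  have : ContinuousOn (fun s => primitive g (α * s)) (Ici 0) :=
    hg.continuousOn_primitive.comp (by fun_prop) fun s hs => mul_nonneg hα hs
  fun_prop

theorem aestronglyMeasurable_scaled (hg : IsGeneralizedLogistic g σ) (lam mu : ℝ) {α : ℝ}
    (hα : 0 ≤ α) : MeasureTheory.AEStronglyMeasurable
      (fun s => α * slowness (gap g lam mu α (α * s)))
      (MeasureTheory.volume.restrict (uIoc 0 1)) := by
  have h : AEMeasurable (fun s => gap g lam mu α (α * s))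
      (MeasureTheory.volume.restrict (uIoc 0 1)) := by
    apply ContinuousOn.aemeasurable _ measurableSet_uIoc
    refine (hg.continuousOn_gap_scaled lam mu hα).mono ?_
    rw [uIoc_of_le zero_le_one]
    exact fun s hs => hs.1.le
  exact ((measurable_slowness.comp_aemeasurable h).const_mul α).aestronglyMeasurable

theorem mul_slowness_le_of_le {α D B k : ℝ} (hα : 0 < α) (hB : 0 < B) (hk : 0 < k)
    (h : α ^ 2 * (B * k) / 2 ≤ D) : α * slowness D ≤ α + 1 / √B * (1 / √k) := by
  have hE : 0 < α ^ 2 * (B * k) / 2 := by positivity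
  have hs : √(2 * (α ^ 2 * (B * k) / 2)) = α * (√B * √k) := by
    rw [show 2 * (α ^ 2 * (B * k) / 2) = α ^ 2 * (B * k) by ring, Real.sqrt_mul (by positivity),
      Real.sqrt_sq hα.le, Real.sqrt_mul hB.le]
  calc α * slowness D ≤ α * (1 + 1 / √(2 * (α ^ 2 * (B * k) / 2))) := by
        gcongr
        exact (slowness_anti hE h).trans (slowness_le hE)
    _ = _ := by rw [hs]; field_simp

theorem le_mul_slowness_of_le {α D B k : ℝ} (hα : 0 < α) (hB : 0 < B) (hk : 0 < k) (hD : 0 < D)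
    (h : D ≤ α ^ 2 * (B * k) / 2) : 1 / √B * (1 / √k) ≤ α * slowness D := by
  have hE : 0 < α ^ 2 * (B * k) / 2 := by positivity
  have hs : √(2 * (α ^ 2 * (B * k) / 2)) = α * (√B * √k) := by
    rw [show 2 * (α ^ 2 * (B * k) / 2) = α ^ 2 * (B * k) by ring, Real.sqrt_mul (by positivity),
      Real.sqrt_sq hα.le, Real.sqrt_mul hB.le]
  calc 1 / √B * (1 / √k) = α * (1 / √(2 * (α ^ 2 * (B * k) / 2))) := by
        rw [hs]; field_simp
    _ ≤ α * slowness D := by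
        gcongr
        exact (inv_sqrt_le_slowness hE).trans (slowness_anti hD h)

/-- A majorant depending on the parameters only through a lower bound c for α(λg(α) - μ), as
dominated convergence requires. -/
theorem mul_slowness_gap_le (hg : IsGeneralizedLogistic g σ) {lam mu α c s : ℝ}
    (h : IsAdmissible g σ lam mu α) (hc : 0 < c) (hcα : c ≤ α * (lam * g α - mu))
    (hs : s ∈ Ioo (0 : ℝ) 1) :
    α * slowness (gap g lam mu α (α * s)) ≤ σ + σ * (1 / √(2 * c)) * (1 / √(s * (1 - s))) := by
  have hα := h.pos
  have hσ := hg.sigma_pos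
  have hk : 0 < s * (1 - s) := mul_pos hs.1 (by linarith [hs.2])
  have hB : 0 < 2 * c / α ^ 2 := by positivity
  have hle := hg.le_gap h ⟨hs.1.le, hs.2.le⟩
  have h1 := mul_slowness_le_of_le (D := gap g lam mu α (α * s)) hα hB hk (by
    refine le_trans (le_of_eq ?_) ((mul_le_mul_of_nonneg_right hcα hk.le).trans hle)
    field_simp)
  rw [Real.sqrt_div (by positivity), Real.sqrt_sq hα.le, one_div_div] at h1
  refine h1.trans ?_
  have h2 : α ≤ σ := h.lt.le
  have h3 : α / √(2 * c) ≤ σ * (1 / √(2 * c)) := by rw [mul_one_div]; gcongr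
  gcongr

theorem intervalIntegrable_timeMap_scaled (hg : IsGeneralizedLogistic g σ) {lam mu α : ℝ}
    (h : IsAdmissible g σ lam mu α) :
    IntervalIntegrable (fun s => α * slowness (gap g lam mu α (α * s)))
      MeasureTheory.volume 0 1 := by
  have hpos : 0 < α * (lam * g α - mu) := mul_pos h.pos (sub_pos.2 h.mu_lt)
  have hb : IntervalIntegrable (fun s => σ + σ * (1 / √(2 * (α * (lam * g α - mu)))) *
      (1 / √(s * (1 - s)))) MeasureTheory.volume 0 1 :=
    IntervalIntegrable.add (by simp) (intervalIntegrable_arcsine.const_mul _)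
  refine hb.mono_fun (hg.aestronglyMeasurable_scaled lam mu h.pos.le) ?_
  rw [uIoc_of_le zero_le_one, ← MeasureTheory.restrict_Ioo_eq_restrict_Ioc]
  refine (MeasureTheory.ae_restrict_mem measurableSet_Ioo).mono fun s hs => ?_
  have h1 := hg.mul_slowness_gap_le h hpos le_rfl hs
  have h2 : 0 ≤ α * slowness (gap g lam mu α (α * s)) :=
    mul_nonneg h.pos.le (slowness_pos (hg.gap_pos h hs)).le
  beta_reduce
  rw [Real.norm_of_nonneg h2]
  exact h1.trans (le_abs_self _)

theorem intervalIntegrable_timeMap (hg : IsGeneralizedLogistic g σ) {lam mu α : ℝ}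
    (h : IsAdmissible g σ lam mu α) :
    IntervalIntegrable (fun u => slowness (gap g lam mu α u)) MeasureTheory.volume 0 α := by
  have h1 := (hg.intervalIntegrable_timeMap_scaled h).const_mul (α⁻¹)
  have h2 := h1.comp_mul_left (c := α⁻¹)
  have hα := h.pos.ne'
  simpa [hα, mul_inv_cancel_left₀, inv_mul_cancel_left₀] using h2

theorem continuousOn_timeMap (hg : IsGeneralizedLogistic g σ) :
    ContinuousOn (fun p : ℝ × ℝ × ℝ => timeMap g p.1 p.2.1 p.2.2)
      {p | IsAdmissible g σ p.1 p.2.1 p.2.2} := by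
  intro p₀ h₀
  have h₀' : IsAdmissible g σ p₀.1 p₀.2.1 p₀.2.2 := h₀
  have hpos : 0 < p₀.2.2 * (p₀.1 * g p₀.2.2 - p₀.2.1) :=
    mul_pos h₀'.pos (sub_pos.2 h₀'.mu_lt)
  have hgc : ContinuousAt (fun p : ℝ × ℝ × ℝ => g p.2.2) p₀ :=
    (hg.continuousAt h₀'.pos).comp (f := fun p : ℝ × ℝ × ℝ => p.2.2) (by fun_prop)
  have hfc : ContinuousAt (fun p : ℝ × ℝ × ℝ => p.2.2 * (p.1 * g p.2.2 - p.2.1)) p₀ :=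
    ContinuousAt.mul (by fun_prop) (ContinuousAt.sub (ContinuousAt.mul (by fun_prop) hgc)
      (by fun_prop))
  refine ContinuousWithinAt.congr (f := fun p : ℝ × ℝ × ℝ =>
    ∫ s in (0 : ℝ)..1, p.2.2 * slowness (gap g p.1 p.2.1 p.2.2 (p.2.2 * s))) ?_
    (fun p _ => timeMap_eq g _ _ _) (timeMap_eq g _ _ _)
  -- Half the value at p₀: nearby admissible parameters stay above it and share one majorant.
  set c := p₀.2.2 * (p₀.1 * g p₀.2.2 - p₀.2.1) / 2 with hc
  have hc0 : 0 < c := by positivity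
  apply intervalIntegral.continuousWithinAt_of_dominated_interval
    (bound := fun s => σ + σ * (1 / √(2 * c)) * (1 / √(s * (1 - s))))
  · filter_upwards [self_mem_nhdsWithin] with p hp
    exact hg.aestronglyMeasurable_scaled _ _ (IsAdmissible.pos hp).le
  · filter_upwards [self_mem_nhdsWithin, hfc.continuousWithinAt.eventually_const_lt (half_lt_self hpos)]
      with p hp hcp
    have hp' : IsAdmissible g σ p.1 p.2.1 p.2.2 := hp
    have hne : ∀ᵐ s : ℝ, s ≠ 1 := by simp [MeasureTheory.ae_iff]
    filter_upwards [hne] with s hs1 hs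
    rw [uIoc_of_le zero_le_one] at hs
    have hs' : s ∈ Ioo (0 : ℝ) 1 := ⟨hs.1, lt_of_le_of_ne hs.2 hs1⟩
    rw [Real.norm_of_nonneg (mul_nonneg hp'.pos.le (slowness_pos (hg.gap_pos hp' hs')).le)]
    exact hg.mul_slowness_gap_le hp' hc0 hcp.le hs'
  · exact IntervalIntegrable.add (by simp) (intervalIntegrable_arcsine.const_mul _)
  · have hne : ∀ᵐ s : ℝ, s ≠ 1 := by simp [MeasureTheory.ae_iff]
    filter_upwards [hne] with s hs1 hs
    rw [uIoc_of_le zero_le_one] at hs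
    have hs' : s ∈ Ioo (0 : ℝ) 1 := ⟨hs.1, lt_of_le_of_ne hs.2 hs1⟩
    apply ContinuousAt.continuousWithinAt
    have hG : ∀ x : ℝ, 0 < x → ContinuousAt (primitive g) x := fun x hx =>
      (hg.hasDerivAt_primitive hx).continuousAt
    have c1 : ContinuousAt (fun p : ℝ × ℝ × ℝ => primitive g p.2.2) p₀ :=
      (hG _ h₀'.pos).comp (f := fun p : ℝ × ℝ × ℝ => p.2.2) (by fun_prop)
    have c2 : ContinuousAt (fun p : ℝ × ℝ × ℝ => primitive g (p.2.2 * s)) p₀ :=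
      (hG _ (mul_pos h₀'.pos hs'.1)).comp (f := fun p : ℝ × ℝ × ℝ => p.2.2 * s) (by fun_prop)
    have c3 : ContinuousAt (fun p : ℝ × ℝ × ℝ => gap g p.1 p.2.1 p.2.2 (p.2.2 * s)) p₀ := by
      unfold gap; fun_prop
    have c4 : ContinuousAt (fun p : ℝ × ℝ × ℝ => slowness (gap g p.1 p.2.1 p.2.2 (p.2.2 * s))) p₀ :=
      (continuousOn_slowness.continuousAt (Ioi_mem_nhds (hg.gap_pos h₀' hs'))).comp
        (f := fun p : ℝ × ℝ × ℝ => gap g p.1 p.2.1 p.2.2 (p.2.2 * s)) c3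
    fun_prop

/-- Continuity of the time map along a continuous family of admissible parameters. -/
theorem continuousOn_timeMap_comp (hg : IsGeneralizedLogistic g σ) {lam mu α : ℝ → ℝ} {S : Set ℝ}
    (h1 : ContinuousOn lam S) (h2 : ContinuousOn mu S) (h3 : ContinuousOn α S)
    (h : ∀ t ∈ S, IsAdmissible g σ (lam t) (mu t) (α t)) :
    ContinuousOn (fun t => timeMap g (lam t) (mu t) (α t)) S :=
  hg.continuousOn_timeMap.comp (f := fun t => (lam t, mu t, α t)) (by fun_prop) h

theorem timeMap_lt_of_mu_lt (hg : IsGeneralizedLogistic g σ) {lam mu₁ mu₂ α : ℝ}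
    (h2 : IsAdmissible g σ lam mu₂ α) (h12 : mu₁ < mu₂) :
    timeMap g lam mu₁ α < timeMap g lam mu₂ α := by
  have hα := h2.pos
  have h1 : IsAdmissible g σ lam mu₁ α := ⟨h2.lam_pos, hα, h2.lt, h12.trans h2.mu_lt,
    (mul_le_mul_of_nonneg_right h12.le hα.le).trans h2.mu_mul_le⟩
  rw [timeMap_eq g _ _ α, timeMap_eq g _ _ α]
  refine integral_lt_of_forall_lt (hg.intervalIntegrable_timeMap_scaled h1)
    (hg.intervalIntegrable_timeMap_scaled h2) fun s hs => ?_
  apply mul_lt_mul_of_pos_left _ hα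
  apply slowness_strictAntiOn (hg.gap_pos h2 hs) (hg.gap_pos h1 hs)
  unfold gap
  have : 0 < α - α * s := by nlinarith [hs.2]
  nlinarith

theorem le_timeMap (hg : IsGeneralizedLogistic g σ) {lam mu α : ℝ}
    (h : IsAdmissible g σ lam mu α) : α ≤ timeMap g lam mu α := by
  have := intervalIntegral.integral_mono_on_of_le_Ioo zero_le_one (f := fun _ => α) (by simp)
    (hg.intervalIntegrable_timeMap_scaled h) (fun s hs => by
      have := one_le_slowness (hg.gap_pos h hs)
      nlinarith [h.pos])
  rw [timeMap_eq g _ _ α]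
  simpa using this

theorem timeMap_le_of_le_gap (hg : IsGeneralizedLogistic g σ) {lam mu α B I : ℝ} {k : ℝ → ℝ}
    (h : IsAdmissible g σ lam mu α) (hB : 0 < B) (hk : ∀ s ∈ Ioo (0 : ℝ) 1, 0 < k s)
    (hki : IntervalIntegrable (fun s => 1 / √(k s)) MeasureTheory.volume 0 1)
    (hI : ∫ s in (0 : ℝ)..1, 1 / √(k s) = I)
    (hle : ∀ s ∈ Ioo (0 : ℝ) 1, α ^ 2 * (B * k s) / 2 ≤ gap g lam mu α (α * s)) :
    timeMap g lam mu α ≤ α + I / √B := by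
  have := intervalIntegral.integral_mono_on_of_le_Ioo zero_le_one
    (hg.intervalIntegrable_timeMap_scaled h)
    (IntervalIntegrable.add (by simp) (hki.const_mul (1 / √B)))
    (g := fun s => α + 1 / √B * (1 / √(k s)))
    (fun s hs => mul_slowness_le_of_le h.pos hB (hk s hs) (hle s hs))
  rw [timeMap_eq g _ _ α]
  refine this.trans (le_of_eq ?_)
  rw [intervalIntegral.integral_add (by simp) (hki.const_mul _),
    intervalIntegral.integral_const_mul, hI]
  simp
  ring

theorem le_timeMap_of_gap_le (hg : IsGeneralizedLogistic g σ) {lam mu α B I : ℝ} {k : ℝ → ℝ}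
    (h : IsAdmissible g σ lam mu α) (hB : 0 < B) (hk : ∀ s ∈ Ioo (0 : ℝ) 1, 0 < k s)
    (hki : IntervalIntegrable (fun s => 1 / √(k s)) MeasureTheory.volume 0 1)
    (hI : ∫ s in (0 : ℝ)..1, 1 / √(k s) = I)
    (hle : ∀ s ∈ Ioo (0 : ℝ) 1, gap g lam mu α (α * s) ≤ α ^ 2 * (B * k s) / 2) :
    I / √B ≤ timeMap g lam mu α := by
  have := intervalIntegral.integral_mono_on_of_le_Ioo zero_le_one
    (hki.const_mul (1 / √B)) (hg.intervalIntegrable_timeMap_scaled h)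
    (fun s hs => le_mul_slowness_of_le h.pos hB (hk s hs) (hg.gap_pos h hs) (hle s hs))
  rw [timeMap_eq g _ _ α]
  refine le_trans (le_of_eq ?_) this
  rw [intervalIntegral.integral_const_mul, hI]
  ring

/-- Divergence of the time map at equilibria. -/
theorem log_le_timeMap (hg : IsGeneralizedLogistic g σ) {lam mu α a C : ℝ}
    (h : IsAdmissible g σ lam mu α) (ha : 0 < a) (h2a : 2 * a ≤ α) (hC0 : 0 ≤ C)
    (hC : ∀ u v, a ≤ u → u ≤ v → v ≤ σ → g u - g v ≤ C * (v - u))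
    (hfa : lam * g α - mu < a) :
    1 / √(2 * (1 + lam * C)) * Real.log (a / (lam * g α - mu)) ≤ timeMap g lam mu α := by
  set f := lam * g α - mu with hf
  have hf0 : 0 < f := sub_pos.2 h.mu_lt
  have hlam := h.lam_pos
  have hα := h.pos
  set B := 1 + lam * C with hB
  have hB0 : 0 < B := by positivity
  have hint := hg.intervalIntegrable_timeMap h
  have hgap : ∀ u ∈ Ioo 0 α, 0 < gap g lam mu α u := fun u hu => by
    have := hg.gap_pos h (s := u / α) ⟨div_pos hu.1 hα, (div_lt_one hα).2 hu.2⟩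
    rwa [mul_div_cancel₀ _ hα.ne'] at this
  -- Only the part at distance between f and a from the maximum is kept; it already produces the
  -- logarithm.
  have h1 : ∫ u in (α - a)..(α - f), slowness (gap g lam mu α u) ≤ timeMap g lam mu α := by
    apply intervalIntegral.integral_mono_interval (by linarith) (by linarith) (by linarith) _ hint
    rw [← MeasureTheory.restrict_Ioo_eq_restrict_Ioc]
    exact (MeasureTheory.ae_restrict_mem measurableSet_Ioo).mono fun u hu =>
      (slowness_pos (hgap u hu)).le
  refine le_trans ?_ h1
  have e1 : ∫ u in (α - a)..(α - f), 1 / √(2 * B) * (α - u)⁻¹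
      = 1 / √(2 * B) * Real.log (a / f) := by
    rw [intervalIntegral.integral_const_mul,
      intervalIntegral.integral_comp_sub_left (fun y => y⁻¹), sub_sub_cancel, sub_sub_cancel,
      integral_inv_of_pos hf0 ha]
  rw [← e1]
  apply intervalIntegral.integral_mono_on (by linarith)
  · apply ContinuousOn.intervalIntegrable
    rw [uIcc_of_le (by linarith)]
    refine continuousOn_const.mul (ContinuousOn.inv₀ (by fun_prop) fun u hu => ?_)
    linarith [hu.2]
  · refine hint.mono_set ?_
    rw [uIcc_of_le (by linarith), uIcc_of_le hα.le]
    exact Icc_subset_Icc (by linarith) (by linarith)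
  · intro u hu
    have hy : f ≤ α - u := by linarith [hu.2]
    have hy0 : 0 < α - u := hf0.trans_le hy
    have hu0 : 0 < u := by linarith [hu.1]
    have hle := hg.gap_le (mu := mu) (α := α) hlam.le ha.le
      (fun u v h1 h2 h3 => hC u v h1 h2 (h3.trans h.lt.le)) hC0
      (u := u) (by linarith [hu.1]) (by linarith)
    -- Here f ≤ α - u absorbs the linear term of `gap_le` into a quadratic one, so the kernel is at
    -- least a multiple of 1/(α - u).
    have hle2 : gap g lam mu α u ≤ B * (α - u) ^ 2 := by
      refine hle.trans ?_
      rw [← hf, hB]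
      nlinarith
    have hgu := hgap u ⟨hu0, by linarith⟩
    calc 1 / √(2 * B) * (α - u)⁻¹ = 1 / √(2 * (B * (α - u) ^ 2)) := by
          rw [← mul_assoc, Real.sqrt_mul (by positivity : 0 ≤ 2 * B), Real.sqrt_sq hy0.le]
          field_simp
      _ ≤ slowness (B * (α - u) ^ 2) := inv_sqrt_le_slowness (by positivity)
      _ ≤ _ := slowness_anti hgu hle2

theorem exists_lt_timeMap (hg : IsGeneralizedLogistic g σ) (lam : ℝ) (hlam : 0 < lam) {a : ℝ}
    (ha : 0 < a) (K : ℝ) :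
    ∃ η, 0 < η ∧ ∀ mu α, IsAdmissible g σ lam mu α → 2 * a ≤ α → lam * g α - mu < η →
      K < timeMap g lam mu α := by
  obtain ⟨C, hC0, hC⟩ := hg.exists_sub_le ha σ
  have hB : 0 < √(2 * (1 + lam * C)) := by positivity
  set r := √(2 * (1 + lam * C))
  -- Chosen so that log(a/f) > r|K| + 1 whenever f < η; the extra 1 gives strictness.
  refine ⟨a * Real.exp (-(r * |K|) - 1), by positivity, fun mu α h h2a hlt => ?_⟩
  have hf0 : 0 < lam * g α - mu := sub_pos.2 h.mu_lt
  have hexp : Real.exp (-(r * |K|) - 1) < 1 := by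
    rw [Real.exp_lt_one_iff]; linarith [mul_nonneg hB.le (abs_nonneg K)]
  have h1 := hg.log_le_timeMap h ha h2a hC0 hC (by nlinarith)
  refine lt_of_lt_of_le ?_ h1
  have h2 : r * |K| + 1 < Real.log (a / (lam * g α - mu)) := by
    rw [Real.lt_log_iff_exp_lt (by positivity), lt_div_iff₀ hf0]
    calc Real.exp (r * |K| + 1) * (lam * g α - mu)
        < Real.exp (r * |K| + 1) * (a * Real.exp (-(r * |K|) - 1)) := by gcongr
      _ = a * (Real.exp (r * |K| + 1) * Real.exp (-(r * |K|) - 1)) := by ring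
      _ = a := by rw [← Real.exp_add]; simp
  rw [one_div_mul_eq_div, lt_div_iff₀ hB]
  nlinarith [le_abs_self K]

end IsGeneralizedLogistic

/-! ### Monotonicity and convexity of the time maps -/

/-- The time map on the boundary `mu * α = lam * G(α)` of the admissible set, where the solutions
have zero slope at the end points. -/
noncomputable def edgeTimeMap (g : ℝ → ℝ) (lam α : ℝ) : ℝ :=
  timeMap g lam (lam * (primitive g α / α)) α

theorem gap_zero_eq {g : ℝ → ℝ} {lam α : ℝ} (s : ℝ) (hα : 0 < α) :
    gap g lam 0 α (α * s) = α ^ 2 * (lam * scaledGap g α s) := by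
  rw [gap_eq s hα]; ring

theorem gap_edge_eq {g : ℝ → ℝ} {lam α : ℝ} (s : ℝ) (hα : 0 < α) :
    gap g lam (lam * (primitive g α / α)) α (α * s) =
      α ^ 2 * (lam * ((s * primitive g α - primitive g (α * s)) / α ^ 2)) := by
  unfold gap
  field_simp
  ring

theorem IsAdmissible.mono {g : ℝ → ℝ} {σ lam mu₁ mu₂ α : ℝ} (h : IsAdmissible g σ lam mu₂ α)
    (h12 : mu₁ ≤ mu₂) : IsAdmissible g σ lam mu₁ α :=
  ⟨h.lam_pos, h.pos, h.lt, h12.trans_lt h.mu_lt,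
    (mul_le_mul_of_nonneg_right h12 h.pos.le).trans h.mu_mul_le⟩

theorem pos_of_one_div_eq {α₁ α₂ α t₁ t₂ : ℝ} (h1 : 0 < α₁) (h2 : 0 < α₂) (ht1 : 0 < t₁)
    (ht2 : 0 < t₂) (hα : 1 / α = t₁ * (1 / α₁) + t₂ * (1 / α₂)) : 0 < α := by
  have : 0 < 1 / α := by rw [hα]; positivity
  simpa using this

namespace IsGeneralizedLogistic

variable {g : ℝ → ℝ} {σ : ℝ}

theorem isAdmissible_zero (hg : IsGeneralizedLogistic g σ) {lam α : ℝ} (hlam : 0 < lam)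
    (hα : α ∈ Ioo 0 σ) : IsAdmissible g σ lam 0 α :=
  ⟨hlam, hα.1, hα.2, mul_pos hlam (hg.pos_of_mem hα), by
    rw [zero_mul]; exact (mul_pos hlam (hg.primitive_pos ⟨hα.1, hα.2.le⟩)).le⟩

theorem isAdmissible_edge (hg : IsGeneralizedLogistic g σ) {c lam α : ℝ} (hc : IsCStar g σ c)
    (hlam : 0 < lam) (hα : α ∈ Ioo 0 c) :
    IsAdmissible g σ lam (lam * (primitive g α / α)) α := by
  refine ⟨hlam, hα.1, hα.2.trans hc.mem.2, ?_, ?_⟩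
  · exact mul_lt_mul_of_pos_left (hc.mean_lt hg hα) hlam
  · rw [mul_assoc, div_mul_cancel₀ _ hα.1.ne']

theorem timeMap_zero_lt (hg : IsGeneralizedLogistic g σ) {lam α₁ α₂ : ℝ} (hlam : 0 < lam)
    (h1 : 0 < α₁) (h12 : α₁ < α₂) (h2 : α₂ < σ) : timeMap g lam 0 α₁ < timeMap g lam 0 α₂ := by
  have a1 := hg.isAdmissible_zero hlam (α := α₁) ⟨h1, h12.trans h2⟩
  have a2 := hg.isAdmissible_zero hlam (α := α₂) ⟨h1.trans h12, h2⟩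
  rw [timeMap_eq, timeMap_eq]
  refine integral_lt_of_forall_lt (hg.intervalIntegrable_timeMap_scaled a1)
    (hg.intervalIntegrable_timeMap_scaled a2) fun s hs => ?_
  have hp := hg.gap_pos a2 hs
  rw [gap_zero_eq s a2.pos] at hp
  rw [gap_zero_eq s a1.pos, gap_zero_eq s a2.pos]
  apply mul_slowness_lt h1 h12 ((pos_iff_pos_of_mul_pos hp).1 (pow_pos a2.pos 2))
  exact mul_le_mul_of_nonneg_left (hg.scaledGap_anti h1 h12.le h2.le ⟨hs.1.le, hs.2.le⟩) hlam.le

theorem edgeTimeMap_lt (hg : IsGeneralizedLogistic g σ) {c lam α₁ α₂ : ℝ} (hc : IsCStar g σ c)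
    (hlam : 0 < lam) (h1 : 0 < α₁) (h12 : α₁ < α₂) (h2 : α₂ < c) :
    edgeTimeMap g lam α₁ < edgeTimeMap g lam α₂ := by
  have a1 := hg.isAdmissible_edge hc hlam (α := α₁) ⟨h1, h12.trans h2⟩
  have a2 := hg.isAdmissible_edge hc hlam (α := α₂) ⟨h1.trans h12, h2⟩
  rw [edgeTimeMap, edgeTimeMap, timeMap_eq, timeMap_eq]
  refine integral_lt_of_forall_lt (hg.intervalIntegrable_timeMap_scaled a1)
    (hg.intervalIntegrable_timeMap_scaled a2) fun s hs => ?_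
  have hp := hg.gap_pos a2 hs
  rw [gap_edge_eq s a2.pos] at hp
  rw [gap_edge_eq s a1.pos, gap_edge_eq s a2.pos]
  apply mul_slowness_lt h1 h12 ((pos_iff_pos_of_mul_pos hp).1 (pow_pos a2.pos 2))
  exact mul_le_mul_of_nonneg_left (hg.chordGap_anti h1 h12.le (h2.trans hc.mem.2).le hs) hlam.le

theorem edgeTimeMap_lt_of_lam_lt (hg : IsGeneralizedLogistic g σ) {c lam₁ lam₂ α : ℝ}
    (hc : IsCStar g σ c) (h1 : 0 < lam₁) (h12 : lam₁ < lam₂) (hα : α ∈ Ioo 0 c) :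
    edgeTimeMap g lam₂ α < edgeTimeMap g lam₁ α := by
  have a1 := hg.isAdmissible_edge hc h1 hα
  have a2 := hg.isAdmissible_edge hc (h1.trans h12) hα
  rw [edgeTimeMap, edgeTimeMap, timeMap_eq, timeMap_eq]
  refine integral_lt_of_forall_lt (hg.intervalIntegrable_timeMap_scaled a2)
    (hg.intervalIntegrable_timeMap_scaled a1) fun s hs => ?_
  have hp1 := hg.gap_pos a1 hs
  have hp2 := hg.gap_pos a2 hs
  apply mul_lt_mul_of_pos_left _ hα.1
  apply slowness_strictAntiOn hp1 hp2
  rw [gap_edge_eq s hα.1] at hp1 ⊢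
  rw [gap_edge_eq s hα.1]
  have hα2 : 0 < α ^ 2 := pow_pos hα.1 2
  apply mul_lt_mul_of_pos_left _ hα2
  apply mul_lt_mul_of_pos_right h12
  exact (pos_iff_pos_of_mul_pos ((pos_iff_pos_of_mul_pos hp1).1 hα2)).1 h1

/-- Strict joint convexity of the time map in `(1/α, mu/α)`. -/
theorem timeMap_convex (hg : IsGeneralizedLogistic g σ) {lam mu₁ mu₂ mu α₁ α₂ α t₁ t₂ : ℝ}
    (h1 : IsAdmissible g σ lam mu₁ α₁) (h2 : IsAdmissible g σ lam mu₂ α₂) (hne : α₁ ≠ α₂)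
    (ht1 : 0 < t₁) (ht2 : 0 < t₂) (ht : t₁ + t₂ = 1)
    (hα : 1 / α = t₁ * (1 / α₁) + t₂ * (1 / α₂))
    (hmu : mu / α = t₁ * (mu₁ / α₁) + t₂ * (mu₂ / α₂)) :
    IsAdmissible g σ lam mu α ∧
      timeMap g lam mu α < t₁ * timeMap g lam mu₁ α₁ + t₂ * timeMap g lam mu₂ α₂ := by
  have hα0 := pos_of_one_div_eq h1.pos h2.pos ht1 ht2 hα
  have p1 := h1.pos
  have p2 := h2.pos
  have hlam := h1.lam_pos
  have m1 : α₁ ∈ Ioc 0 σ := ⟨p1, h1.lt.le⟩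
  have m2 : α₂ ∈ Ioc 0 σ := ⟨p2, h2.lt.le⟩
  -- Each admissibility condition is convex in (1/α, μ/α): the bound α < σ is linear in 1/α, and the
  -- other two bound μ/α by concave functions of 1/α.
  have hadm : IsAdmissible g σ lam mu α := by
    refine ⟨hlam, hα0, ?_, ?_, ?_⟩
    · rw [← one_div_lt_one_div hg.sigma_pos hα0, hα]
      have e1 := one_div_lt_one_div_of_lt p1 h1.lt
      have e2 := one_div_lt_one_div_of_lt p2 h2.lt
      calc 1 / σ = t₁ * (1 / σ) + t₂ * (1 / σ) := by rw [← add_mul, ht, one_mul]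
        _ < _ := by gcongr
    · have h := perspective_concave hg.concaveOn (τ := 1) p1 p2 ht1 ht2 ht hα
        (by simpa using ⟨p1.le, h1.lt.le⟩) (by simpa using ⟨p2.le, h2.lt.le⟩)
      simp only [mul_one] at h
      have e1 : mu₁ / α₁ < lam * g α₁ / α₁ := by gcongr; exact h1.mu_lt
      have e2 : mu₂ / α₂ < lam * g α₂ / α₂ := by gcongr; exact h2.mu_lt
      have e3 : mu / α < lam * g α / α := by
        rw [hmu]
        calc t₁ * (mu₁ / α₁) + t₂ * (mu₂ / α₂)
            < t₁ * (lam * g α₁ / α₁) + t₂ * (lam * g α₂ / α₂) := by gcongr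
          _ = lam * (t₁ * (g α₁ / α₁) + t₂ * (g α₂ / α₂)) := by ring
          _ ≤ lam * (g α / α) := by gcongr
          _ = _ := by ring
      exact (div_lt_div_iff_of_pos_right hα0).1 e3
    · have h := hg.scaledGap_concave m1 m2 ht1 ht2 ht hα (s := 0) ⟨le_rfl, zero_le_one⟩
      simp only [scaledGap, mul_zero, primitive_zero, sub_zero] at h
      have e1 : mu₁ / α₁ ≤ lam * (primitive g α₁ / α₁ ^ 2) := by
        rw [mul_div_assoc', div_le_div_iff₀ p1 (by positivity)]
        nlinarith [h1.mu_mul_le]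
      have e2 : mu₂ / α₂ ≤ lam * (primitive g α₂ / α₂ ^ 2) := by
        rw [mul_div_assoc', div_le_div_iff₀ p2 (by positivity)]
        nlinarith [h2.mu_mul_le]
      have e3 : mu / α ≤ lam * (primitive g α / α ^ 2) := by
        rw [hmu]
        calc t₁ * (mu₁ / α₁) + t₂ * (mu₂ / α₂)
            ≤ t₁ * (lam * (primitive g α₁ / α₁ ^ 2)) + t₂ * (lam * (primitive g α₂ / α₂ ^ 2)) := by
              gcongr
          _ = lam * (t₁ * (primitive g α₁ / α₁ ^ 2) + t₂ * (primitive g α₂ / α₂ ^ 2)) := by ring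
          _ ≤ _ := by gcongr
      have e4 := mul_le_mul_of_nonneg_right e3 (by positivity : 0 ≤ α ^ 2)
      calc mu * α = mu / α * α ^ 2 := by field_simp
        _ ≤ _ := e4
        _ = _ := by field_simp
  refine ⟨hadm, ?_⟩
  have i1 := hg.intervalIntegrable_timeMap_scaled h1
  have i2 := hg.intervalIntegrable_timeMap_scaled h2
  rw [timeMap_eq, timeMap_eq, timeMap_eq, ← intervalIntegral.integral_const_mul,
    ← intervalIntegral.integral_const_mul,
    ← intervalIntegral.integral_add (i1.const_mul _) (i2.const_mul _)]
  refine integral_lt_of_forall_lt (hg.intervalIntegrable_timeMap_scaled hadm)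
    ((i1.const_mul _).add (i2.const_mul _)) fun s hs => ?_
  have g1 := hg.gap_pos h1 hs
  have g2 := hg.gap_pos h2 hs
  rw [gap_eq s p1] at g1 ⊢
  rw [gap_eq s p2] at g2 ⊢
  rw [gap_eq s hα0]
  apply mul_slowness_convex p1 p2 hne ((pos_iff_pos_of_mul_pos g1).1 (by positivity))
    ((pos_iff_pos_of_mul_pos g2).1 (by positivity)) ht1 ht2 ht hα
  rw [hmu]
  have h := mul_le_mul_of_nonneg_left
    (hg.scaledGap_concave m1 m2 ht1 ht2 ht hα (s := s) ⟨hs.1.le, hs.2.le⟩) hlam.le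
  nlinarith

/-! ### Small amplitudes, the thresholds κ and 4κ, and roots of the time maps -/

theorem integral_id_mul (p s : ℝ) : ∫ τ in s..(1 : ℝ), p * τ = p * (1 - s ^ 2) / 2 := by
  rw [intervalIntegral.integral_const_mul, integral_id]; ring

theorem le_scaledGap (hg : IsGeneralizedLogistic g σ) {M α s : ℝ} (hα : 0 < α)
    (hM : ∀ a b, 0 ≤ a → a ≤ b → b ≤ α → M * (b - a) ≤ g b - g a) (hs : s ∈ Icc (0 : ℝ) 1) :
    M * (1 - s ^ 2) / 2 ≤ scaledGap g α s := by
  rw [hg.scaledGap_eq hα hs.1, ← integral_id_mul M s]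
  apply intervalIntegral.integral_mono_on hs.2 (Continuous.intervalIntegrable (by fun_prop) _ _)
    ((hg.intervalIntegrable_scaled hα.le hs.1 zero_le_one).div_const _)
  intro τ hτ
  have := hM 0 (α * τ) le_rfl (mul_nonneg hα.le (hs.1.trans hτ.1)) (by nlinarith [hτ.2])
  rw [hg.map_zero] at this
  rw [le_div_iff₀ hα]
  linarith

theorem scaledGap_le (hg : IsGeneralizedLogistic g σ) {M α s : ℝ} (hα : 0 < α)
    (hM : ∀ a b, 0 ≤ a → a ≤ b → b ≤ α → g b - g a ≤ M * (b - a)) (hs : s ∈ Icc (0 : ℝ) 1) :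
    scaledGap g α s ≤ M * (1 - s ^ 2) / 2 := by
  rw [hg.scaledGap_eq hα hs.1, ← integral_id_mul M s]
  apply intervalIntegral.integral_mono_on hs.2
    ((hg.intervalIntegrable_scaled hα.le hs.1 zero_le_one).div_const _)
    (Continuous.intervalIntegrable (by fun_prop) _ _)
  intro τ hτ
  have := hM 0 (α * τ) le_rfl (mul_nonneg hα.le (hs.1.trans hτ.1)) (by nlinarith [hτ.2])
  rw [hg.map_zero] at this
  rw [div_le_iff₀ hα]
  linarith

theorem le_chordGap (hg : IsGeneralizedLogistic g σ) {M α s : ℝ} (hα : 0 < α)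
    (hM : ∀ a b, 0 ≤ a → a ≤ b → b ≤ α → M * (b - a) ≤ g b - g a) (hs : s ∈ Icc (0 : ℝ) 1) :
    M * (s * (1 - s)) / 2 ≤ (s * primitive g α - primitive g (α * s)) / α ^ 2 := by
  rw [hg.chordGap_eq hα hs.1, show M * (s * (1 - s)) / 2 = s * (M * (1 - s) * (1 - 0 ^ 2) / 2) by
    ring, ← integral_id_mul (M * (1 - s)) 0]
  apply mul_le_mul_of_nonneg_left _ hs.1
  apply intervalIntegral.integral_mono_on zero_le_one
    (Continuous.intervalIntegrable (by fun_prop) _ _) (hg.intervalIntegrable_chord hα hs.1)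
  intro τ hτ
  have h1 : 0 ≤ α * τ := mul_nonneg hα.le hτ.1
  have := hM (α * s * τ) (α * τ) (by nlinarith [hs.1]) (by nlinarith [hs.2])
    (by nlinarith [hτ.2])
  rw [le_div_iff₀ hα]
  linarith

theorem chordGap_le (hg : IsGeneralizedLogistic g σ) {M α s : ℝ} (hα : 0 < α)
    (hM : ∀ a b, 0 ≤ a → a ≤ b → b ≤ α → g b - g a ≤ M * (b - a)) (hs : s ∈ Icc (0 : ℝ) 1) :
    (s * primitive g α - primitive g (α * s)) / α ^ 2 ≤ M * (s * (1 - s)) / 2 := by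
  rw [hg.chordGap_eq hα hs.1, show M * (s * (1 - s)) / 2 = s * (M * (1 - s) * (1 - 0 ^ 2) / 2) by
    ring, ← integral_id_mul (M * (1 - s)) 0]
  apply mul_le_mul_of_nonneg_left _ hs.1
  apply intervalIntegral.integral_mono_on zero_le_one (hg.intervalIntegrable_chord hα hs.1)
    (Continuous.intervalIntegrable (by fun_prop) _ _)
  intro τ hτ
  have h1 : 0 ≤ α * τ := mul_nonneg hα.le hτ.1
  have := hM (α * s * τ) (α * τ) (by nlinarith [hs.1]) (by nlinarith [hs.2])
    (by nlinarith [hτ.2])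
  rw [div_le_iff₀ hα]
  linarith

theorem one_sub_sq_pos {s : ℝ} (hs : s ∈ Ioo (0 : ℝ) 1) : 0 < 1 - s ^ 2 := by
  nlinarith [hs.1, hs.2]

/-- If the slopes of g on [0, α] are at least M, the deficit at μ = 0 dominates that of the linear
problem, α²λM(1-s²)/2, whose kernel integrates to π/2. On the edge the profile is s(1-s) and the
integral π, which accounts for the factor 4 between the thresholds. -/
theorem timeMap_zero_le (hg : IsGeneralizedLogistic g σ) {lam M α : ℝ} (hlam : 0 < lam)
    (hα : α ∈ Ioo 0 σ) (hM0 : 0 < M)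
    (hM : ∀ a b, 0 ≤ a → a ≤ b → b ≤ α → M * (b - a) ≤ g b - g a) :
    timeMap g lam 0 α ≤ α + Real.pi / 2 / √(lam * M) := by
  apply hg.timeMap_le_of_le_gap (hg.isAdmissible_zero hlam hα) (by positivity)
    (fun s hs => one_sub_sq_pos hs) intervalIntegrable_inv_sqrt_one_sub_sq
    integral_inv_sqrt_one_sub_sq
  intro s hs
  rw [gap_zero_eq s hα.1]
  have h1 := mul_le_mul_of_nonneg_left (hg.le_scaledGap hα.1 hM ⟨hs.1.le, hs.2.le⟩) hlam.le
  have h2 := mul_le_mul_of_nonneg_left h1 (sq_nonneg α)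
  linarith

theorem le_timeMap_zero (hg : IsGeneralizedLogistic g σ) {lam M α : ℝ} (hlam : 0 < lam)
    (hα : α ∈ Ioo 0 σ) (hM0 : 0 < M)
    (hM : ∀ a b, 0 ≤ a → a ≤ b → b ≤ α → g b - g a ≤ M * (b - a)) :
    Real.pi / 2 / √(lam * M) ≤ timeMap g lam 0 α := by
  apply hg.le_timeMap_of_gap_le (hg.isAdmissible_zero hlam hα) (by positivity)
    (fun s hs => one_sub_sq_pos hs) intervalIntegrable_inv_sqrt_one_sub_sq
    integral_inv_sqrt_one_sub_sq
  intro s hs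
  rw [gap_zero_eq s hα.1]
  have h1 := mul_le_mul_of_nonneg_left (hg.scaledGap_le hα.1 hM ⟨hs.1.le, hs.2.le⟩) hlam.le
  have h2 := mul_le_mul_of_nonneg_left h1 (sq_nonneg α)
  linarith

theorem edgeTimeMap_le (hg : IsGeneralizedLogistic g σ) {c lam M α : ℝ} (hc : IsCStar g σ c)
    (hlam : 0 < lam) (hα : α ∈ Ioo 0 c) (hM0 : 0 < M)
    (hM : ∀ a b, 0 ≤ a → a ≤ b → b ≤ α → M * (b - a) ≤ g b - g a) :
    edgeTimeMap g lam α ≤ α + Real.pi / √(lam * M) := by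
  apply hg.timeMap_le_of_le_gap (hg.isAdmissible_edge hc hlam hα) (by positivity)
    (fun s hs => mul_pos hs.1 (sub_pos.2 hs.2)) intervalIntegrable_arcsine integral_arcsine
  intro s hs
  rw [gap_edge_eq s hα.1]
  have h1 := mul_le_mul_of_nonneg_left (hg.le_chordGap hα.1 hM ⟨hs.1.le, hs.2.le⟩) hlam.le
  have h2 := mul_le_mul_of_nonneg_left h1 (sq_nonneg α)
  linarith

theorem le_edgeTimeMap (hg : IsGeneralizedLogistic g σ) {c lam M α : ℝ} (hc : IsCStar g σ c)
    (hlam : 0 < lam) (hα : α ∈ Ioo 0 c) (hM0 : 0 < M)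
    (hM : ∀ a b, 0 ≤ a → a ≤ b → b ≤ α → g b - g a ≤ M * (b - a)) :
    Real.pi / √(lam * M) ≤ edgeTimeMap g lam α := by
  apply hg.le_timeMap_of_gap_le (hg.isAdmissible_edge hc hlam hα) (by positivity)
    (fun s hs => mul_pos hs.1 (sub_pos.2 hs.2)) intervalIntegrable_arcsine integral_arcsine
  intro s hs
  rw [gap_edge_eq s hα.1]
  have h1 := mul_le_mul_of_nonneg_left (hg.chordGap_le hα.1 hM ⟨hs.1.le, hs.2.le⟩) hlam.le
  have h2 := mul_le_mul_of_nonneg_left h1 (sq_nonneg α)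
  linarith

end IsGeneralizedLogistic

theorem div_sqrt_lt {x y L : ℝ} (hx : 0 ≤ x) (hy : 0 < y) (hL : 0 < L) (h : x ^ 2 < y * L ^ 2) :
    x / √y < L := by
  rw [div_lt_iff₀ (by positivity), ← abs_of_nonneg hx, ← abs_of_pos (by positivity : 0 < L * √y),
    ← sq_lt_sq, mul_pow, Real.sq_sqrt hy.le]
  linarith

theorem le_div_sqrt {x y L : ℝ} (hx : 0 ≤ x) (hy : 0 < y) (hL : 0 < L) (h : y * L ^ 2 ≤ x ^ 2) :
    L ≤ x / √y := by
  rw [le_div_iff₀ (by positivity), ← abs_of_nonneg hx, ← abs_of_pos (by positivity : 0 < L * √y),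
    ← sq_le_sq, mul_pow, Real.sq_sqrt hy.le]
  linarith

namespace IsGeneralizedLogistic

variable {g : ℝ → ℝ} {σ : ℝ}

theorem exists_derivZeroPlus_eq (hg : IsGeneralizedLogistic g σ) (L : ℝ)
    (h : derivZeroPlus g < ⊤) :
    ∃ p : ℝ, 0 < p ∧ derivZeroPlus g = p ∧ kappa g L = Real.pi ^ 2 / (4 * p * L ^ 2) := by
  have h0 := hg.derivZeroPlus_pos
  have hbot : derivZeroPlus g ≠ ⊥ := (bot_lt_of_lt h0).ne'
  have heq := EReal.coe_toReal h.ne hbot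
  refine ⟨(derivZeroPlus g).toReal, ?_, heq.symm, ?_⟩
  · rw [← heq] at h0
    exact_mod_cast h0
  · rw [kappa, if_neg h.ne]

theorem kappa_nonneg (hg : IsGeneralizedLogistic g σ) (L : ℝ) : 0 ≤ kappa g L := by
  rcases eq_or_ne (derivZeroPlus g) ⊤ with h | h
  · rw [kappa, if_pos h]
  · obtain ⟨p, hp, -, hk⟩ := hg.exists_derivZeroPlus_eq L h.lt_top
    rw [hk]; positivity

/-- Used with n = 1 for κ and n = 4 for 4κ: the conclusion says that the limiting time
√n·(π/2)/√(λM) is below L, with M strictly below g'(0⁺) and hence a valid slope bound near 0. It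
treats finite and infinite g'(0⁺) together. -/
theorem exists_slope (hg : IsGeneralizedLogistic g σ) {L lam n : ℝ} (hL : 0 < L)
    (hn : 0 < n) (hlam : 0 < lam) (h : n * kappa g L < lam) :
    ∃ M : ℝ, 0 < M ∧ (M : EReal) < derivZeroPlus g ∧ n * Real.pi ^ 2 / 4 < lam * M * L ^ 2 := by
  set q := n * Real.pi ^ 2 / (4 * lam * L ^ 2) with hq
  have hπ := Real.pi_pos
  have hq0 : 0 < q := by positivity
  have key : ∀ M, q < M → n * Real.pi ^ 2 / 4 < lam * M * L ^ 2 := by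
    intro M hM
    have : n * Real.pi ^ 2 / 4 = lam * q * L ^ 2 := by rw [hq]; field_simp
    rw [this]; gcongr
  rcases eq_or_ne (derivZeroPlus g) ⊤ with ht | ht
  · exact ⟨q + 1, by linarith, by rw [ht]; exact EReal.coe_lt_top _, key _ (by linarith)⟩
  · obtain ⟨p, hp, hpe, hk⟩ := hg.exists_derivZeroPlus_eq L ht.lt_top
    have hqp : q < p := by
      rw [hk, mul_div_assoc', div_lt_iff₀ (by positivity)] at h
      rw [hq, div_lt_iff₀ (by positivity)]
      linarith
    obtain ⟨M, h1, h2⟩ := exists_between hqp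
    exact ⟨M, by linarith, by rw [hpe]; exact_mod_cast h2, key M h1⟩

theorem exists_timeMap_zero_lt (hg : IsGeneralizedLogistic g σ) {L lam : ℝ} (hL : 0 < L)
    (h : kappa g L < lam) : ∃ α ∈ Ioo 0 σ, timeMap g lam 0 α < L := by
  have hlam := (hg.kappa_nonneg L).trans_lt h
  obtain ⟨M, hM0, hM, hML⟩ := hg.exists_slope (n := 1) hL one_pos hlam (by rwa [one_mul])
  obtain ⟨δ, hδ, hδM⟩ := hg.exists_mul_sub_le hM
  have hlt := div_sqrt_lt (x := Real.pi / 2) (by positivity) (mul_pos hlam hM0) hL (by linarith)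
  obtain ⟨α, hα0, hα⟩ := exists_between (lt_min hδ.1 (sub_pos.2 hlt))
  have h1 : α < δ := hα.trans_le (min_le_left _ _)
  have h2 := hα.trans_le (min_le_right _ _)
  have hα' : α ∈ Ioo 0 σ := ⟨hα0, h1.trans hδ.2⟩
  refine ⟨α, hα', (hg.timeMap_zero_le hlam hα' hM0
    fun a b ha hab hb => hδM a b ha hab (hb.trans h1.le)).trans_lt (by linarith)⟩

theorem exists_edgeTimeMap_lt (hg : IsGeneralizedLogistic g σ) {c L lam : ℝ} (hc : IsCStar g σ c)
    (hL : 0 < L) (h : 4 * kappa g L < lam) : ∃ α ∈ Ioo 0 c, edgeTimeMap g lam α < L := by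
  have hlam : 0 < lam := lt_of_le_of_lt (by linarith [hg.kappa_nonneg L]) h
  obtain ⟨M, hM0, hM, hML⟩ := hg.exists_slope (n := 4) hL four_pos hlam h
  obtain ⟨δ, hδ, hδM⟩ := hg.exists_mul_sub_le hM
  have hlt := div_sqrt_lt (x := Real.pi) (by positivity) (mul_pos hlam hM0) hL (by linarith)
  obtain ⟨α, hα0, hα⟩ := exists_between (lt_min (lt_min hδ.1 hc.mem.1) (sub_pos.2 hlt))
  have h1 : α < δ := hα.trans_le ((min_le_left _ _).trans (min_le_left _ _))
  have h1' : α < c := hα.trans_le ((min_le_left _ _).trans (min_le_right _ _))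
  have h2 := hα.trans_le (min_le_right _ _)
  have hα' : α ∈ Ioo 0 c := ⟨hα0, h1'⟩
  refine ⟨α, hα', (hg.edgeTimeMap_le hc hlam hα' hM0
    fun a b ha hab hb => hδM a b ha hab (hb.trans h1.le)).trans_lt (by linarith)⟩

theorem le_timeMap_zero_of_le_kappa (hg : IsGeneralizedLogistic g σ) {L lam α : ℝ} (hL : 0 < L)
    (hfin : derivZeroPlus g < ⊤) (hlam : 0 < lam) (h : lam ≤ kappa g L) (hα : α ∈ Ioo 0 σ) :
    L ≤ timeMap g lam 0 α := by
  obtain ⟨p, hp, hpe, hk⟩ := hg.exists_derivZeroPlus_eq L hfin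
  refine le_trans (le_div_sqrt (by positivity) (mul_pos hlam hp) hL ?_)
    (hg.le_timeMap_zero hlam hα hp fun a b ha hab hb =>
      hg.sub_le_of_derivZeroPlus_eq hpe ha hab (hb.trans hα.2.le))
  rw [hk, le_div_iff₀ (by positivity)] at h
  linarith

theorem le_edgeTimeMap_of_le_kappa (hg : IsGeneralizedLogistic g σ) {c L lam α : ℝ}
    (hc : IsCStar g σ c) (hL : 0 < L) (hfin : derivZeroPlus g < ⊤) (hlam : 0 < lam)
    (h : lam ≤ 4 * kappa g L) (hα : α ∈ Ioo 0 c) : L ≤ edgeTimeMap g lam α := by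
  obtain ⟨p, hp, hpe, hk⟩ := hg.exists_derivZeroPlus_eq L hfin
  refine le_trans (le_div_sqrt (by positivity) (mul_pos hlam hp) hL ?_)
    (hg.le_edgeTimeMap hc hlam hα hp fun a b ha hab hb =>
      hg.sub_le_of_derivZeroPlus_eq hpe ha hab (hb.trans (hα.2.trans hc.mem.2).le))
  rw [hk, mul_div_assoc', le_div_iff₀ (by positivity)] at h
  linarith

theorem continuousOn_timeMap_zero (hg : IsGeneralizedLogistic g σ) {lam : ℝ} (hlam : 0 < lam) :
    ContinuousOn (timeMap g lam 0) (Ioo 0 σ) :=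
  hg.continuousOn_timeMap_comp continuousOn_const continuousOn_const continuousOn_id
    fun _ hα => hg.isAdmissible_zero hlam hα

theorem continuousOn_edgeTimeMap (hg : IsGeneralizedLogistic g σ) {c lam : ℝ}
    (hc : IsCStar g σ c) (hlam : 0 < lam) : ContinuousOn (edgeTimeMap g lam) (Ioo 0 c) :=
  hg.continuousOn_timeMap_comp continuousOn_const
    (continuousOn_const.mul (hg.continuousOn_mean.mono fun _ hx => hx.1)) continuousOn_id
    fun _ hα => hg.isAdmissible_edge hc hlam hα

/-- As α → σ the value λg(α) tends to 0 = μ, so the maximum approaches an equilibrium and the time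
map diverges. -/
theorem exists_lt_timeMap_zero (hg : IsGeneralizedLogistic g σ) {lam β : ℝ} (hlam : 0 < lam)
    (hβ : β ∈ Ioo 0 σ) (K : ℝ) : ∃ α ∈ Ioo β σ, K < timeMap g lam 0 α := by
  obtain ⟨η, hη, h⟩ := hg.exists_lt_timeMap lam hlam (half_pos hβ.1) K
  have hcont : Tendsto (fun α => lam * g α - 0) (𝓝[<] σ) (𝓝 (lam * g σ - 0)) :=
    (((hg.continuousAt hg.sigma_pos).tendsto.mono_left nhdsWithin_le_nhds).const_mul lam).sub_const 0
  rw [hg.map_sigma, mul_zero, sub_zero] at hcont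
  obtain ⟨α, h1, h2⟩ := ((hcont.eventually_lt_const hη).and (Ioo_mem_nhdsLT hβ.2)).exists
  exact ⟨α, h2, h 0 α (hg.isAdmissible_zero hlam ⟨hβ.1.trans h2.1, h2.2⟩) (by linarith [h2.1]) h1⟩

/-- At c* the mean equals g, so the edge value of μ approaches λg(α) and the time map diverges. -/
theorem exists_lt_edgeTimeMap (hg : IsGeneralizedLogistic g σ) {c lam β : ℝ} (hc : IsCStar g σ c)
    (hlam : 0 < lam) (hβ : β ∈ Ioo 0 c) (K : ℝ) : ∃ α ∈ Ioo β c, K < edgeTimeMap g lam α := by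
  obtain ⟨η, hη, h⟩ := hg.exists_lt_timeMap lam hlam (half_pos hβ.1) K
  have hcont : Tendsto (fun α => lam * g α - lam * (primitive g α / α)) (𝓝[<] c)
      (𝓝 (lam * g c - lam * (primitive g c / c))) :=
    (((hg.continuousAt hc.mem.1).tendsto.mono_left nhdsWithin_le_nhds).const_mul lam).sub
      (((hg.hasDerivAt_mean hc.mem.1).continuousAt.tendsto.mono_left
        nhdsWithin_le_nhds).const_mul lam)
  rw [hc.value, sub_self] at hcont
  obtain ⟨α, h1, h2⟩ := ((hcont.eventually_lt_const hη).and (Ioo_mem_nhdsLT hβ.2)).exists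
  exact ⟨α, h2, h _ α (hg.isAdmissible_edge hc hlam ⟨hβ.1.trans h2.1, h2.2⟩)
    (by linarith [h2.1]) h1⟩

theorem exists_timeMap_zero_eq (hg : IsGeneralizedLogistic g σ) {L lam : ℝ} (hL : 0 < L)
    (h : kappa g L < lam) : ∃ γ ∈ Ioo 0 σ, timeMap g lam 0 γ = L := by
  have hlam := (hg.kappa_nonneg L).trans_lt h
  obtain ⟨a, ha, haL⟩ := hg.exists_timeMap_zero_lt hL h
  obtain ⟨b, hb, hbL⟩ := hg.exists_lt_timeMap_zero hlam ha L
  have hsub : Icc a b ⊆ Ioo 0 σ := fun x hx => ⟨ha.1.trans_le hx.1, hx.2.trans_lt hb.2⟩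
  obtain ⟨γ, hγ, h⟩ := intermediate_value_Icc hb.1.le
    ((hg.continuousOn_timeMap_zero hlam).mono hsub) ⟨haL.le, hbL.le⟩
  exact ⟨γ, hsub hγ, h⟩

theorem exists_edgeTimeMap_eq (hg : IsGeneralizedLogistic g σ) {c L lam : ℝ}
    (hc : IsCStar g σ c) (hL : 0 < L) (h : 4 * kappa g L < lam) :
    ∃ θ ∈ Ioo 0 c, edgeTimeMap g lam θ = L := by
  have hlam : 0 < lam := lt_of_le_of_lt (by linarith [hg.kappa_nonneg L]) h
  obtain ⟨a, ha, haL⟩ := hg.exists_edgeTimeMap_lt hc hL h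
  obtain ⟨b, hb, hbL⟩ := hg.exists_lt_edgeTimeMap hc hlam ha L
  have hsub : Icc a b ⊆ Ioo 0 c := fun x hx => ⟨ha.1.trans_le hx.1, hx.2.trans_lt hb.2⟩
  obtain ⟨γ, hγ, h⟩ := intermediate_value_Icc hb.1.le
    ((hg.continuousOn_edgeTimeMap hc hlam).mono hsub) ⟨haL.le, hbL.le⟩
  exact ⟨γ, hsub hγ, h⟩

theorem timeMap_zero_lt_iff (hg : IsGeneralizedLogistic g σ) {lam α₁ α₂ : ℝ} (hlam : 0 < lam)
    (h1 : α₁ ∈ Ioo 0 σ) (h2 : α₂ ∈ Ioo 0 σ) :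
    timeMap g lam 0 α₁ < timeMap g lam 0 α₂ ↔ α₁ < α₂ :=
  StrictMonoOn.lt_iff_lt (f := timeMap g lam 0) (s := Ioo 0 σ)
    (fun _ ha _ hb hab => hg.timeMap_zero_lt hlam ha.1 hab hb.2) h1 h2

theorem edgeTimeMap_lt_iff (hg : IsGeneralizedLogistic g σ) {c lam α₁ α₂ : ℝ}
    (hc : IsCStar g σ c) (hlam : 0 < lam) (h1 : α₁ ∈ Ioo 0 c) (h2 : α₂ ∈ Ioo 0 c) :
    edgeTimeMap g lam α₁ < edgeTimeMap g lam α₂ ↔ α₁ < α₂ :=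
  StrictMonoOn.lt_iff_lt (f := edgeTimeMap g lam) (s := Ioo 0 c)
    (fun _ ha _ hb hab => hg.edgeTimeMap_lt hc hlam ha.1 hab hb.2) h1 h2

theorem timeMap_lt_iff (hg : IsGeneralizedLogistic g σ) {lam mu₁ mu₂ α : ℝ}
    (h1 : IsAdmissible g σ lam mu₁ α) (h2 : IsAdmissible g σ lam mu₂ α) :
    timeMap g lam mu₁ α < timeMap g lam mu₂ α ↔ mu₁ < mu₂ :=
  StrictMonoOn.lt_iff_lt (f := fun mu => timeMap g lam mu α)
    (s := {mu | IsAdmissible g σ lam mu α})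
    (fun _ _ _ hb hab => hg.timeMap_lt_of_mu_lt hb hab) h1 h2

end IsGeneralizedLogistic

/-! ### The level set of the time map -/

/-- `(mu, α)` lies on the bifurcation curve, in terms of the time map. -/
structure OnCurve (g : ℝ → ℝ) (σ L lam mu α : ℝ) : Prop where
  mu_pos : 0 < mu
  adm : IsAdmissible g σ lam mu α
  eq : timeMap g lam mu α = L

namespace IsGeneralizedLogistic

variable {g : ℝ → ℝ} {σ : ℝ}

theorem onCurve_unique (hg : IsGeneralizedLogistic g σ) {L lam mu₁ mu₂ α : ℝ}
    (h1 : OnCurve g σ L lam mu₁ α) (h2 : OnCurve g σ L lam mu₂ α) : mu₁ = mu₂ := by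
  rcases lt_trichotomy mu₁ mu₂ with h | h | h
  · have := hg.timeMap_lt_of_mu_lt h2.adm h
    rw [h1.eq, h2.eq] at this
    exact absurd this (lt_irrefl _)
  · exact h
  · have := hg.timeMap_lt_of_mu_lt h1.adm h
    rw [h1.eq, h2.eq] at this
    exact absurd this (lt_irrefl _)

theorem exists_onCurve_of_le (hg : IsGeneralizedLogistic g σ) {L lam mu α : ℝ}
    (h : IsAdmissible g σ lam mu α) (hmu : 0 < mu) (h0 : timeMap g lam 0 α < L)
    (h1 : L ≤ timeMap g lam mu α) : ∃ mu', OnCurve g σ L lam mu' α := by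
  have hadm : ∀ x ∈ Icc 0 mu, IsAdmissible g σ lam x α := fun x hx => h.mono hx.2
  obtain ⟨mu', hm, heq⟩ := intermediate_value_Icc hmu.le
    (hg.continuousOn_timeMap_comp (lam := fun _ => lam) (mu := id) (α := fun _ => α)
      continuousOn_const continuousOn_id continuousOn_const hadm) ⟨h0.le, h1⟩
  refine ⟨mu', lt_of_le_of_ne hm.1 ?_, hadm _ hm, heq⟩
  rintro rfl
  exact h0.ne heq

/-- T(μ, α) increases continuously in μ, from its value at μ = 0 up to the edge value if α < c*. If
α ≥ c*, then g(α) ≤ G(α)/α, so the only upper constraint is μ < λg(α), where T diverges. -/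
theorem exists_onCurve_iff (hg : IsGeneralizedLogistic g σ) {c L lam α : ℝ} (hc : IsCStar g σ c)
    (hlam : 0 < lam) (hα : α ∈ Ioo 0 σ) :
    (∃ mu, OnCurve g σ L lam mu α) ↔
      timeMap g lam 0 α < L ∧ (c ≤ α ∨ L ≤ edgeTimeMap g lam α) := by
  constructor
  · rintro ⟨mu, h⟩
    refine ⟨h.eq ▸ hg.timeMap_lt_of_mu_lt h.adm h.mu_pos, ?_⟩
    refine or_iff_not_imp_left.2 fun hcα => ?_
    have hedge := hg.isAdmissible_edge hc hlam ⟨hα.1, not_le.1 hcα⟩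
    rw [← h.eq, edgeTimeMap, ← not_lt, hg.timeMap_lt_iff hedge h.adm, not_lt, mul_div_assoc',
      le_div_iff₀ hα.1]
    exact h.adm.mu_mul_le
  · rintro ⟨h0, h1⟩
    by_cases hcα : c ≤ α
    · obtain ⟨η, hη, hK⟩ := hg.exists_lt_timeMap lam hlam (half_pos hα.1) L
      have hpos : 0 < lam * g α := mul_pos hlam (hg.pos_of_mem hα)
      obtain ⟨mu, hm1, hm2⟩ := exists_between
        (max_lt hpos (sub_lt_self (lam * g α) hη))
      have hm0 := (le_max_left _ _).trans_lt hm1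
      have hadm : IsAdmissible g σ lam mu α := by
        refine ⟨hlam, hα.1, hα.2, hm2, ?_⟩
        have := hc.le_mean hg ⟨hcα, hα.2⟩
        rw [le_div_iff₀ hα.1] at this
        have h3 := mul_le_mul_of_nonneg_left this hlam.le
        have h4 := mul_le_mul_of_nonneg_right hm2.le hα.1.le
        linarith
      have := (le_max_right _ _).trans_lt hm1
      exact hg.exists_onCurve_of_le hadm hm0 h0 (hK mu α hadm (by linarith) (by linarith)).le
    · have hedge := hg.isAdmissible_edge hc hlam ⟨hα.1, not_le.1 hcα⟩
      exact hg.exists_onCurve_of_le hedge (mul_pos hlam (hg.mean_pos ⟨hα.1, hα.2.le⟩)) h0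
        (h1.resolve_left hcα)

/-- Join the outer points by a segment in (1/α, μ/α). At height α₂ strict convexity gives T < L on
it, so the segment lies below μ₂ there; and its μ is at least the smaller outer value, since μ =
const is a line through the origin. -/
theorem onCurve_min_lt (hg : IsGeneralizedLogistic g σ) {L lam mu₁ mu₂ mu₃ α₁ α₂ α₃ : ℝ}
    (h1 : OnCurve g σ L lam mu₁ α₁) (h2 : OnCurve g σ L lam mu₂ α₂)
    (h3 : OnCurve g σ L lam mu₃ α₃) (h12 : α₁ < α₂) (h23 : α₂ < α₃) : min mu₁ mu₃ < mu₂ := by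
  have p1 := h1.adm.pos
  have p2 := h2.adm.pos
  have p3 := h3.adm.pos
  have hd : 0 < 1 / α₁ - 1 / α₃ := sub_pos.2 (one_div_lt_one_div_of_lt p1 (h12.trans h23))
  set t₁ := (1 / α₂ - 1 / α₃) / (1 / α₁ - 1 / α₃) with ht₁
  set t₃ := (1 / α₁ - 1 / α₂) / (1 / α₁ - 1 / α₃) with ht₃
  have ht1 : 0 < t₁ := div_pos (sub_pos.2 (one_div_lt_one_div_of_lt p2 h23)) hd
  have ht3 : 0 < t₃ := div_pos (sub_pos.2 (one_div_lt_one_div_of_lt p1 h12)) hd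
  have ht : t₁ + t₃ = 1 := by
    rw [ht₁, ht₃, ← add_div, div_eq_one_iff_eq hd.ne']; ring
  have hα : 1 / α₂ = t₁ * (1 / α₁) + t₃ * (1 / α₃) := by
    rw [ht₁, ht₃, div_mul_eq_mul_div, div_mul_eq_mul_div, ← add_div, eq_div_iff hd.ne']; ring
  set mu := α₂ * (t₁ * (mu₁ / α₁) + t₃ * (mu₃ / α₃)) with hmu
  obtain ⟨hadm, hlt⟩ := hg.timeMap_convex h1.adm h3.adm (h12.trans h23).ne ht1 ht3 ht hα
    (mu := mu) (by rw [hmu]; field_simp)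
  rw [h1.eq, h3.eq, ← add_mul, ht, one_mul, ← h2.eq, hg.timeMap_lt_iff hadm h2.adm] at hlt
  refine lt_of_le_of_lt ?_ hlt
  have e1 : α₂ * (1 / α₂) = 1 := by field_simp
  calc min mu₁ mu₃ = α₂ * (t₁ * (min mu₁ mu₃ / α₁) + t₃ * (min mu₁ mu₃ / α₃)) := by
        have : α₂ * (t₁ * (min mu₁ mu₃ / α₁) + t₃ * (min mu₁ mu₃ / α₃))
            = min mu₁ mu₃ * (α₂ * (t₁ * (1 / α₁) + t₃ * (1 / α₃))) := by ring
        rw [this, ← hα, e1, mul_one]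
    _ ≤ mu := by
        rw [hmu]
        gcongr
        · exact min_le_left _ _
        · exact min_le_right _ _

theorem eventually_isAdmissible (hg : IsGeneralizedLogistic g σ) {lam mu α₀ : ℝ} (hlam : 0 < lam)
    (hα : α₀ ∈ Ioo 0 σ) (h1 : mu < lam * g α₀) (h2 : mu * α₀ < lam * primitive g α₀) :
    ∀ᶠ α in 𝓝 α₀, IsAdmissible g σ lam mu α := by
  have c1 : ContinuousAt (fun α => lam * g α) α₀ := continuousAt_const.mul (hg.continuousAt hα.1)
  have c2 : ContinuousAt (fun α => lam * primitive g α) α₀ :=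
    continuousAt_const.mul (hg.hasDerivAt_primitive hα.1).continuousAt
  have c3 : ContinuousAt (fun α => mu * α) α₀ := by fun_prop
  filter_upwards [Ioo_mem_nhds hα.1 hα.2, c1.eventually_const_lt h1, c3.eventually_lt c2 h2]
    with α h3 h4 h5
  exact ⟨hlam, h3.1, h3.2, h4, h5.le⟩

theorem continuousAt_timeMap (hg : IsGeneralizedLogistic g σ) {lam mu α₀ : ℝ} (hlam : 0 < lam)
    (hα : α₀ ∈ Ioo 0 σ) (h1 : mu < lam * g α₀) (h2 : mu * α₀ < lam * primitive g α₀) :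
    ContinuousAt (timeMap g lam mu) α₀ :=
  ContinuousOn.continuousAt (s := {α | IsAdmissible g σ lam mu α})
    (hg.continuousOn_timeMap_comp continuousOn_const continuousOn_const continuousOn_id
      fun _ h => h) (hg.eventually_isAdmissible hlam hα h1 h2)

/-- Where `T(mu, ·) < L`, nearby points of the curve have larger `mu`. -/
theorem eventually_lt_of_timeMap_lt (hg : IsGeneralizedLogistic g σ) {L lam mu α₀ : ℝ}
    (hlam : 0 < lam) (hα : α₀ ∈ Ioo 0 σ) (h1 : mu < lam * g α₀)
    (h2 : mu * α₀ < lam * primitive g α₀) (hlt : timeMap g lam mu α₀ < L) :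
    ∀ᶠ α in 𝓝 α₀, ∀ mu', OnCurve g σ L lam mu' α → mu < mu' := by
  filter_upwards [hg.eventually_isAdmissible hlam hα h1 h2,
    (hg.continuousAt_timeMap hlam hα h1 h2).eventually_lt_const hlt] with α h3 h4 mu' h5
  rwa [← h5.eq, hg.timeMap_lt_iff h3 h5.adm] at h4

theorem eventually_gt_of_lt_timeMap (hg : IsGeneralizedLogistic g σ) {L lam mu α₀ : ℝ}
    (hlam : 0 < lam) (hα : α₀ ∈ Ioo 0 σ) (h1 : mu < lam * g α₀)
    (h2 : mu * α₀ < lam * primitive g α₀) (hlt : L < timeMap g lam mu α₀) :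
    ∀ᶠ α in 𝓝 α₀, ∀ mu', OnCurve g σ L lam mu' α → mu' < mu := by
  filter_upwards [hg.eventually_isAdmissible hlam hα h1 h2,
    (hg.continuousAt_timeMap hlam hα h1 h2).eventually_const_lt hlt] with α h3 h4 mu' h5
  rwa [← h5.eq, hg.timeMap_lt_iff h5.adm h3] at h4

theorem eventually_lt_of_strict (hg : IsGeneralizedLogistic g σ) {L lam mu₀ mu α₀ : ℝ}
    (hlam : 0 < lam) (hα : α₀ ∈ Ioo 0 σ) (h1 : mu₀ < lam * g α₀)
    (h2 : mu₀ * α₀ < lam * primitive g α₀) (h0 : timeMap g lam mu₀ α₀ = L) (hmu : mu₀ < mu) :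
    ∀ᶠ α in 𝓝 α₀, ∀ mu', OnCurve g σ L lam mu' α → mu' < mu := by
  have h2' : mu₀ < lam * primitive g α₀ / α₀ := by rwa [lt_div_iff₀ hα.1]
  obtain ⟨mu₁, h3, h4⟩ := exists_between (lt_min hmu (lt_min h1 h2'))
  have h5 : mu₁ < lam * g α₀ := h4.trans_le ((min_le_right _ _).trans (min_le_left _ _))
  have h6 : mu₁ * α₀ < lam * primitive g α₀ := by
    rw [← lt_div_iff₀ hα.1]
    exact h4.trans_le ((min_le_right _ _).trans (min_le_right _ _))
  filter_upwards [hg.eventually_gt_of_lt_timeMap (L := L) hlam hα h5 h6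
    (h0 ▸ hg.timeMap_lt_of_mu_lt ⟨hlam, hα.1, hα.2, h5, h6.le⟩ h3)] with α h mu' h'
  exact (h mu' h').trans (h4.trans_le (min_le_left _ _))

/-- T is strictly monotone in μ, so comparing m(α) with a fixed μ amounts to comparing L with T(μ,
α), and continuity of T carries over. -/
theorem continuousOn_of_onCurve (hg : IsGeneralizedLogistic g σ) {L lam : ℝ} {I : Set ℝ}
    {m : ℝ → ℝ} (hm : ∀ α ∈ I, OnCurve g σ L lam (m α) α) : ContinuousOn m I := by
  intro α₀ hα₀
  have h0 := hm α₀ hα₀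
  have hlam := h0.adm.lam_pos
  have hmem : α₀ ∈ Ioo 0 σ := ⟨h0.adm.pos, h0.adm.lt⟩
  refine tendsto_order.2 ⟨fun mu hmu => ?_, fun mu hmu => ?_⟩
  · have h2 : mu * α₀ < lam * primitive g α₀ :=
      (mul_lt_mul_of_pos_right hmu h0.adm.pos).trans_le h0.adm.mu_mul_le
    have h3 := hg.eventually_lt_of_timeMap_lt hlam hmem (hmu.trans h0.adm.mu_lt) h2
      (h0.eq ▸ hg.timeMap_lt_of_mu_lt h0.adm hmu)
    filter_upwards [nhdsWithin_le_nhds h3, self_mem_nhdsWithin] with α h h'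
    exact h _ (hm α h')
  · rcases h0.adm.mu_mul_le.lt_or_eq with hlt | heq
    · filter_upwards [nhdsWithin_le_nhds (hg.eventually_lt_of_strict hlam hmem h0.adm.mu_lt hlt
        h0.eq hmu), self_mem_nhdsWithin] with α h h'
      exact h _ (hm α h')
    -- At an edge point no larger μ is admissible for comparison; the constraint m(α) ≤ λG(α)/α, an
    -- equality at α₀, bounds m from above instead.
    · have hc : ContinuousAt (fun α => lam * (primitive g α / α)) α₀ :=
        continuousAt_const.mul (hg.hasDerivAt_mean hmem.1).continuousAt
      have hlt : lam * (primitive g α₀ / α₀) < mu := by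
        rwa [← mul_div_assoc, ← heq, mul_div_cancel_right₀ _ hmem.1.ne']
      filter_upwards [nhdsWithin_le_nhds (hc.eventually_lt_const hlt), self_mem_nhdsWithin]
        with α h h'
      refine lt_of_le_of_lt ?_ h
      have h4 := (hm α h').adm
      rw [← mul_div_assoc, le_div_iff₀ h4.pos]
      exact h4.mu_mul_le

theorem tendsto_of_onCurve (hg : IsGeneralizedLogistic g σ) {L lam γ : ℝ} (hlam : 0 < lam)
    {m : ℝ → ℝ} (hγ : γ ∈ Ioo 0 σ) (hγL : timeMap g lam 0 γ = L)
    (hm : ∀ᶠ α in 𝓝[<] γ, OnCurve g σ L lam (m α) α) : Tendsto m (𝓝[<] γ) (𝓝 0) := by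
  refine tendsto_order.2 ⟨fun mu hmu => ?_, fun mu hmu => ?_⟩
  · filter_upwards [hm] with α h using hmu.trans h.mu_pos
  · filter_upwards [hm, nhdsWithin_le_nhds (hg.eventually_lt_of_strict hlam hγ
      (mul_pos hlam (hg.pos_of_mem hγ))
      (by rw [zero_mul]; exact mul_pos hlam (hg.primitive_pos ⟨hγ.1, hγ.2.le⟩)) hγL hmu)]
      with α h h'
    exact h' _ h

end IsGeneralizedLogistic

/-! ### Unimodality and the initial rise at the edge -/

/-- A continuous strictly quasiconcave function with an interior peak is strictly unimodal. -/
theorem exists_unimodal {m : ℝ → ℝ} {I : Set ℝ} {a x b : ℝ} (hcont : ContinuousOn m I)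
    (hq : ∀ u ∈ I, ∀ v ∈ I, ∀ w ∈ I, u < v → v < w → min (m u) (m w) < m v)
    (hax : a < x) (hxb : x < b) (hI : Icc a b ⊆ I)
    (hout : ∀ u ∈ I, u ≤ a ∨ b ≤ u → m u < m x) :
    ∃ y ∈ interior I, StrictMonoOn m (I ∩ Iic y) ∧ StrictAntiOn m (I ∩ Ici y) := by
  obtain ⟨y, hy, hmax⟩ := isCompact_Icc.exists_isMaxOn ⟨x, hax.le, hxb.le⟩ (hcont.mono hI)
  have hxy : m x ≤ m y := hmax ⟨hax.le, hxb.le⟩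
  have hya : a < y := by
    by_contra hcon
    exact (hout y (hI hy) (Or.inl (not_lt.1 hcon))).not_ge hxy
  have hyb : y < b := by
    by_contra hcon
    exact (hout y (hI hy) (Or.inr (not_lt.1 hcon))).not_ge hxy
  have hmaxI : ∀ u ∈ I, m u ≤ m y := fun u hu => by
    by_cases h : u ∈ Icc a b
    · exact hmax h
    · refine (hout u hu ?_).le.trans hxy
      by_contra hcon
      push Not at hcon
      exact h ⟨hcon.1.le, hcon.2.le⟩
  have hyI : y ∈ interior I :=
    mem_interior.2 ⟨Ioo a b, Ioo_subset_Icc_self.trans hI, isOpen_Ioo, hya, hyb⟩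
  have hyI' := interior_subset hyI
  refine ⟨y, hyI, fun u hu v hv huv => ?_, fun u hu v hv huv => ?_⟩
  · rcases (mem_Iic.1 hv.2).eq_or_lt with rfl | hvy
    -- A second point attaining the maximum would force a larger value in between.
    · refine lt_of_le_of_ne (hmaxI u hu.1) fun heq => ?_
      obtain ⟨w, hw1, hw2⟩ := exists_between (max_lt huv hya)
      have hwI : w ∈ I := hI ⟨((le_max_right _ _).trans_lt hw1).le, (hw2.trans hyb).le⟩
      have := hq u hu.1 w hwI v hyI' ((le_max_left _ _).trans_lt hw1) hw2
      rw [heq, min_self] at this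
      exact this.not_ge (hmaxI w hwI)
    · have := hq u hu.1 v hv.1 y hyI' huv hvy
      rwa [min_eq_left (hmaxI u hu.1)] at this
  · rcases (mem_Ici.1 hu.2).eq_or_lt with rfl | hyu
    · refine lt_of_le_of_ne (hmaxI v hv.1) fun heq => ?_
      obtain ⟨w, hw1, hw2⟩ := exists_between (lt_min huv hyb)
      have hwI : w ∈ I := hI ⟨(hya.trans hw1).le, (hw2.trans_le (min_le_right _ _)).le⟩
      have := hq y hyI' w hwI v hv.1 hw1 (hw2.trans_le (min_le_left _ _))
      rw [heq, min_self] at this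
      exact this.not_ge (hmaxI w hwI)
    · have := hq y hyI' u hu.1 v hv.1 hyu huv
      rwa [min_eq_right (hmaxI v hv.1)] at this

/-- Raising the energy deficit at least four-fold lowers the kernel by a definite amount. -/
theorem mul_slowness_le_sub {θ α α₁ D E m δ : ℝ} (hα : 0 < α) (hα₁ : α ≤ α₁)
    (hαθ : α ≤ 3 / 2 * θ) (hθ : 0 < θ) (hD : 0 < D) (hE : 4 * D ≤ E) (hm : 0 < m)
    (hDm : D ≤ m * δ) :
    α * slowness E ≤ θ * slowness D + α₁ - θ / 4 / √(2 * m) / √δ := by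
  have h1 := slowness_le_of_four_mul_le hD hE
  have h2 := inv_sqrt_le_slowness hD
  have h3 : 1 / √(2 * m) / √δ ≤ 1 / √(2 * D) := by
    rw [div_div, ← Real.sqrt_mul (by positivity)]
    apply one_div_le_one_div_of_le (by positivity)
    apply Real.sqrt_le_sqrt
    linarith
  set r := 1 / √(2 * D) with hr
  have hr0 : 0 < r := by positivity
  -- Halving the singular part while α ≤ 3θ/2 leaves at most 3/4 of θr, so a quarter of it is
  -- gained.
  have h4 : α * slowness E ≤ α₁ + 3 / 4 * θ * r := by
    calc α * slowness E ≤ α * (1 + 1 / 2 * r) := mul_le_mul_of_nonneg_left h1 hα.le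
      _ = α + α * (1 / 2 * r) := by ring
      _ ≤ α₁ + 3 / 2 * θ * (1 / 2 * r) := by gcongr
      _ = _ := by ring
  have h5 : θ * r ≤ θ * slowness D := mul_le_mul_of_nonneg_left h2 hθ.le
  have h6 : θ / 4 / √(2 * m) / √δ ≤ θ / 4 * r := by
    calc θ / 4 / √(2 * m) / √δ = θ / 4 * (1 / √(2 * m) / √δ) := by ring
      _ ≤ _ := by gcongr
  linarith

namespace IsGeneralizedLogistic

variable {g : ℝ → ℝ} {σ : ℝ}

theorem mul_slowness_gap_convex (hg : IsGeneralizedLogistic g σ) {lam mu α₁ α₂ α t₁ t₂ s : ℝ}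
    (h1 : IsAdmissible g σ lam mu α₁) (h2 : IsAdmissible g σ lam mu α₂) (hne : α₁ ≠ α₂)
    (ht1 : 0 < t₁) (ht2 : 0 < t₂) (ht : t₁ + t₂ = 1)
    (hα : 1 / α = t₁ * (1 / α₁) + t₂ * (1 / α₂)) (hs : s ∈ Ioo (0 : ℝ) 1) :
    α * slowness (gap g lam mu α (α * s)) <
      t₁ * (α₁ * slowness (gap g lam mu α₁ (α₁ * s))) +
        t₂ * (α₂ * slowness (gap g lam mu α₂ (α₂ * s))) := by
  have p1 := h1.pos
  have p2 := h2.pos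
  have g1 := hg.gap_pos h1 hs
  have g2 := hg.gap_pos h2 hs
  rw [gap_eq s p1] at g1 ⊢
  rw [gap_eq s p2] at g2 ⊢
  rw [gap_eq s (pos_of_one_div_eq p1 p2 ht1 ht2 hα)]
  apply mul_slowness_convex p1 p2 hne ((pos_iff_pos_of_mul_pos g1).1 (by positivity))
    ((pos_iff_pos_of_mul_pos g2).1 (by positivity)) ht1 ht2 ht hα
  have h := mul_le_mul_of_nonneg_left
    (hg.scaledGap_concave ⟨p1, h1.lt.le⟩ ⟨p2, h2.lt.le⟩ ht1 ht2 ht hα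
      (s := s) ⟨hs.1.le, hs.2.le⟩) h1.lam_pos.le
  have h' : mu / α = t₁ * (mu / α₁) + t₂ * (mu / α₂) := by
    rw [div_eq_mul_one_div, hα]; ring
  rw [h']
  linarith

theorem isAdmissible_edge_of_le (hg : IsGeneralizedLogistic g σ) {c lam θ α : ℝ}
    (hc : IsCStar g σ c) (hlam : 0 < lam) (hθ : 0 < θ) (hθα : θ ≤ α) (hα : α < c) :
    IsAdmissible g σ lam (lam * (primitive g θ / θ)) α :=
  (hg.isAdmissible_edge hc hlam ⟨hθ.trans_le hθα, hα⟩).mono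
    (mul_le_mul_of_nonneg_left ((hc.strictMonoOn_mean hg).monotoneOn ⟨hθ, hθα.trans hα.le⟩
      ⟨hθ.trans_le hθα, hα.le⟩ hθα) hlam.le)

/-- The energy deficit at `0` grows linearly as the height `α` moves above the edge value `θ`. -/
theorem exists_mul_sub_le_gap (hg : IsGeneralizedLogistic g σ) {c lam θ α₁ : ℝ}
    (hc : IsCStar g σ c) (hlam : 0 < lam) (hθ : 0 < θ) (h1 : θ < α₁) (hα₁ : α₁ < c) :
    ∃ b, 0 < b ∧ ∀ α ∈ Ioo θ α₁, ∀ u ∈ Icc 0 θ,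
      b * (α - θ) ≤ gap g lam (lam * (primitive g θ / θ)) α u := by
  set A := fun v => primitive g v / v with hA
  have hmono : A θ < A α₁ := hc.strictMonoOn_mean hg ⟨hθ, (h1.trans hα₁).le⟩
    ⟨hθ.trans h1, hα₁.le⟩ h1
  refine ⟨lam * θ * ((A α₁ - A θ) / (α₁ - θ)),
    mul_pos (mul_pos hlam hθ) (div_pos (sub_pos.2 hmono) (sub_pos.2 h1)), fun α hα u hu => ?_⟩
  have hα0 := hθ.trans hα.1
  -- The mean is concave, so its slope from θ to α is at least its slope from θ to the fixed α₁.
  have hslope : (A α₁ - A θ) / (α₁ - θ) ≤ (A α - A θ) / (α - θ) :=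
    secant_anti hg.strictConcaveOn_mean.concaveOn
      ⟨hθ.le, (h1.trans (hα₁.trans hc.mem.2)).le⟩
      ⟨hα0.le, (hα.2.trans (hα₁.trans hc.mem.2)).le⟩
      ⟨hθ.le, (h1.trans (hα₁.trans hc.mem.2)).le⟩
      ⟨(hθ.trans h1).le, (hα₁.trans hc.mem.2).le⟩ hα.1 h1 le_rfl hα.2.le
  have hAα : A θ ≤ A α := (hc.strictMonoOn_mean hg).monotoneOn ⟨hθ, (h1.trans hα₁).le⟩
    ⟨hα0, (hα.2.trans hα₁).le⟩ hα.1.le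
  have hGα : primitive g α = α * A α := by simp only [hA]; field_simp
  have hGu : primitive g u ≤ u * A θ := by
    rcases hu.1.eq_or_lt with rfl | hu0
    · simp [primitive_zero]
    · have : A u ≤ A θ := (hc.strictMonoOn_mean hg).monotoneOn
        ⟨hu0, (hu.2.trans_lt (h1.trans hα₁)).le⟩ ⟨hθ, (h1.trans hα₁).le⟩ hu.2
      have e : primitive g u = u * A u := by simp only [hA]; field_simp
      rw [e]; gcongr
  have hpos : 0 < α - θ := sub_pos.2 hα.1
  calc lam * θ * ((A α₁ - A θ) / (α₁ - θ)) * (α - θ)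
      ≤ lam * θ * ((A α - A θ) / (α - θ)) * (α - θ) := by gcongr
    _ = lam * (θ * (A α - A θ)) := by field_simp
    _ ≤ lam * (α * (A α - A θ)) := by
        have := sub_nonneg.2 hAα
        have := hα.1.le
        gcongr
    _ = lam * (primitive g α - u * A θ) - lam * A θ * (α - u) := by rw [hGα]; ring
    _ ≤ _ := by unfold gap; gcongr

set_option maxHeartbeats 1000000 in
/-- Just above the edge value `θ` the time map decreases in the height. -/
theorem exists_timeMap_lt_edge (hg : IsGeneralizedLogistic g σ) {c lam θ β : ℝ}
    (hc : IsCStar g σ c) (hlam : 0 < lam) (hθ : θ ∈ Ioo 0 c) (hβ : θ < β) :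
    ∃ α ∈ Ioo θ β, α < c ∧
      timeMap g lam (lam * (primitive g θ / θ)) α < edgeTimeMap g lam θ := by
  have hθ0 := hθ.1
  obtain ⟨α₁, h1, h1'⟩ := exists_between
    (lt_min (lt_min hβ hθ.2) (by linarith : θ < 3 / 2 * θ))
  have hβ₁ : α₁ < β := h1'.trans_le ((min_le_left _ _).trans (min_le_left _ _))
  have hc₁ : α₁ < c := h1'.trans_le ((min_le_left _ _).trans (min_le_right _ _))
  have hθ₁ : α₁ < 3 / 2 * θ := h1'.trans_le (min_le_right _ _)
  have hα₁0 : 0 < α₁ := hθ0.trans h1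
  obtain ⟨b, hb, hgap⟩ := hg.exists_mul_sub_le_gap hc hlam hθ0 h1 hc₁
  set mu := lam * (primitive g θ / θ) with hmu
  have hmu0 : 0 < mu := mul_pos hlam (hg.mean_pos ⟨hθ0, (hθ.2.trans hc.mem.2).le⟩)
  have admθ : IsAdmissible g σ lam mu θ := hg.isAdmissible_edge hc hlam hθ
  have adm₁ : IsAdmissible g σ lam mu α₁ := hg.isAdmissible_edge_of_le hc hlam hθ0 h1.le hc₁
  set T₁ := timeMap g lam mu α₁ with hT₁
  have hT₁0 : 0 < T₁ := hα₁0.trans_le (hg.le_timeMap adm₁)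
  -- With e = α - θ and s < δ = de, the deficit for θ is at most μθδ = be/4 and that for α at least
  -- be: the factor four of `mul_slowness_le_sub`.
  set d := b / (4 * mu * θ) with hd
  have hd0 : 0 < d := by positivity
  set B := θ / 4 / √(2 * (mu * θ)) with hB
  have hB0 : 0 < B := by positivity
  set τ := α₁ / (θ * (α₁ - θ)) with hτ
  have hαθ : 0 < α₁ - θ := sub_pos.2 h1
  have hτ0 : 0 < τ := by positivity
  set A := d * α₁ + τ * T₁ with hA
  have hA0 : 0 < A := by positivity
  -- The three bounds give α < α₁, δ < 1/2, and A√e < B√d for the final comparison of orders.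
  obtain ⟨e, he0, he⟩ := exists_between (lt_min (lt_min hαθ (by positivity : 0 < 1 / (2 * d)))
    (by positivity : 0 < (B * √d / A) ^ 2))
  have he1 : e < α₁ - θ := he.trans_le ((min_le_left _ _).trans (min_le_left _ _))
  have he2 : e < 1 / (2 * d) := he.trans_le ((min_le_left _ _).trans (min_le_right _ _))
  have he3 : √e < B * √d / A := by
    rw [Real.sqrt_lt' (by positivity)]
    exact he.trans_le (min_le_right _ _)
  set α := θ + e with hα
  have hα0 : 0 < α := by positivity
  have hαm : α ∈ Ioo θ α₁ := ⟨by linarith, by linarith⟩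
  have admα : IsAdmissible g σ lam mu α :=
    hg.isAdmissible_edge_of_le hc hlam hθ0 hαm.1.le (hαm.2.trans hc₁)
  refine ⟨α, ⟨hαm.1, hαm.2.trans hβ₁⟩, hαm.2.trans hc₁, ?_⟩
  set δ := d * e with hδ
  have hδ0 : 0 < δ := by positivity
  have hδ1 : δ < 1 / 2 := by
    rw [lt_div_iff₀ (by positivity)] at he2
    rw [hδ]; linarith
  have hden : 0 < 1 / θ - 1 / α₁ := sub_pos.2 (one_div_lt_one_div_of_lt hθ0 h1)
  set t := (1 / θ - 1 / α) / (1 / θ - 1 / α₁) with ht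
  have ht0 : 0 < t := div_pos (sub_pos.2 (one_div_lt_one_div_of_lt hθ0 hαm.1)) hden
  have ht1 : t < 1 := by
    rw [ht, div_lt_one hden]
    linarith [one_div_lt_one_div_of_lt hα0 hαm.2]
  have htα : 1 / α = t * (1 / α₁) + (1 - t) * (1 / θ) := by
    have : t * (1 / θ - 1 / α₁) = 1 / θ - 1 / α := div_mul_cancel₀ _ hden.ne'
    linarith
  -- The weight of α₁ in the convex combination is O(e).
  have htτ : t ≤ τ * e := by
    rw [ht, div_le_iff₀ hden]
    have e1 : τ * e * (1 / θ - 1 / α₁) = e / θ ^ 2 := by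
      rw [hτ]; field_simp
    have e2 : 1 / θ - 1 / α = e / (θ * α) := by
      rw [hα]; field_simp; ring
    rw [e1, e2]
    apply div_le_div_of_nonneg_left he0.le (by positivity)
    nlinarith [hαm.1]
  set k := fun a s => a * slowness (gap g lam mu a (a * s)) with hk
  have hkpos : ∀ {a}, IsAdmissible g σ lam mu a → ∀ s ∈ Ioo (0 : ℝ) 1, 0 < k a s := fun ha s hs =>
    mul_pos ha.pos (slowness_pos (hg.gap_pos ha hs))
  -- Convexity between θ and α₁ limits any increase of the kernel to t times the integrable kernel
  -- at α₁.
  have hconv : ∀ s ∈ Ioo (0 : ℝ) 1, k α s - k θ s - t * k α₁ s ≤ 0 := by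
    intro s hs
    have g1 := hg.gap_pos adm₁ hs
    have g2 := hg.gap_pos admθ hs
    have hle : k α s < t * k α₁ s + (1 - t) * k θ s :=
      hg.mul_slowness_gap_convex adm₁ admθ h1.ne' ht0 (sub_pos.2 ht1) (by ring) htα hs
    have := mul_pos ht0 (hkpos admθ s hs)
    linarith
  have hsmall : ∀ s ∈ Ioo 0 δ, k α s - k θ s - t * k α₁ s ≤ α₁ - B / √δ := by
    intro s hs
    have hs' : s ∈ Ioo (0 : ℝ) 1 := ⟨hs.1, by linarith [hs.2]⟩
    have hs0 := hs.1
    have gθ := hg.gap_pos admθ hs'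
    have hgθ : gap g lam mu θ (θ * s) ≤ mu * θ * s := by
      have hG : lam * primitive g θ = mu * θ := by rw [hmu]; field_simp
      have hG0 : 0 ≤ primitive g (θ * s) := by
        apply (hg.primitive_pos ⟨by positivity, ?_⟩).le
        nlinarith [hs'.2, hθ.2, hc.mem.2]
      unfold gap
      nlinarith
    have hgα : 4 * gap g lam mu θ (θ * s) ≤ gap g lam mu α (α * s) := by
      refine le_trans ?_ (hgap α hαm (α * s) ⟨by positivity, ?_⟩)
      · have : 4 * (mu * θ * s) ≤ 4 * (mu * θ * δ) := by gcongr; exact hs.2.le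
        have e1 : 4 * (mu * θ * δ) = b * (α - θ) := by
          rw [hδ, hd, hα]; field_simp; ring
        linarith
      · have : α * s ≤ 3 / 2 * θ * (1 / 2) := by
          gcongr
          · linarith [hαm.2]
          · linarith [hs.2]
        linarith
    have hm : gap g lam mu θ (θ * s) ≤ mu * θ * δ := hgθ.trans (by gcongr; exact hs.2.le)
    have h1 : k α s ≤ k θ s + α₁ - B / √δ :=
      mul_slowness_le_sub hα0 hαm.2.le (by linarith [hαm.2]) hθ0 gθ hgα (by positivity) hm
    have := mul_pos ht0 (hkpos adm₁ s hs')
    linarith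
  have iα := hg.intervalIntegrable_timeMap_scaled admα
  have iθ := hg.intervalIntegrable_timeMap_scaled admθ
  have i₁ := hg.intervalIntegrable_timeMap_scaled adm₁
  have iall : IntervalIntegrable (fun s => k α s - k θ s - t * k α₁ s) MeasureTheory.volume 0 1 :=
    (iα.sub iθ).sub (i₁.const_mul t)
  have ileft := iall.mono_set (c := 0) (d := δ) (by
    rw [uIcc_of_le hδ0.le, uIcc_of_le zero_le_one]; exact Icc_subset_Icc le_rfl (by linarith))
  have iright := iall.mono_set (c := δ) (d := 1) (by
    rw [uIcc_of_le (by linarith), uIcc_of_le zero_le_one]; exact Icc_subset_Icc hδ0.le le_rfl)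
  have hleft : ∫ s in (0 : ℝ)..δ, (k α s - k θ s - t * k α₁ s) ≤ δ * (α₁ - B / √δ) := by
    have := intervalIntegral.integral_mono_on_of_le_Ioo hδ0.le ileft
      (g := fun _ => α₁ - B / √δ) (by simp) hsmall
    rwa [intervalIntegral.integral_const, smul_eq_mul, sub_zero] at this
  have hright : ∫ s in δ..(1 : ℝ), (k α s - k θ s - t * k α₁ s) ≤ 0 := by
    have := intervalIntegral.integral_mono_on_of_le_Ioo (by linarith) iright
      (g := fun _ => (0 : ℝ)) (by simp) fun s hs => hconv s ⟨hδ0.trans hs.1, hs.2⟩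
    simpa using this
  have htot : ∫ s in (0 : ℝ)..1, (k α s - k θ s - t * k α₁ s)
      = timeMap g lam mu α - edgeTimeMap g lam θ - t * T₁ := by
    rw [intervalIntegral.integral_sub (iα.sub iθ) (i₁.const_mul t),
      intervalIntegral.integral_sub iα iθ, intervalIntegral.integral_const_mul t, hT₁, edgeTimeMap,
      ← hmu, timeMap_eq g lam mu α, timeMap_eq g lam mu θ, timeMap_eq g lam mu α₁]
  have hsum := intervalIntegral.integral_add_adjacent_intervals ileft iright
  rw [htot] at hsum
  have hδs : δ / √δ = √d * √e := by
    rw [Real.div_sqrt, hδ, Real.sqrt_mul hd0.le]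
  have hee : e = √e * √e := (Real.mul_self_sqrt he0.le).symm
  have hse : 0 < √e := by positivity
  -- The loss is at most A·e and the gain is B·√d·√e, so the total is negative.
  have hfin : δ * (α₁ - B / √δ) + t * T₁ < 0 := by
    have e1 : δ * (α₁ - B / √δ) = δ * α₁ - B * (δ / √δ) := by ring
    rw [e1, hδs]
    have e2 : t * T₁ ≤ τ * e * T₁ := by gcongr
    have e3 : δ * α₁ + τ * e * T₁ = A * √e * √e := by
      rw [mul_assoc A, ← hee, hδ, hA]; ring
    rw [lt_div_iff₀ hA0] at he3
    nlinarith [mul_lt_mul_of_pos_right he3 hse]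
  linarith

end IsGeneralizedLogistic

/-! ### From solutions to the level set -/

/-- The momentum `p / √(1 - p²)` inverts `v ↦ v / √(1 + v²)`. -/
theorem sqrt_one_add_momentum_sq {p : ℝ} (hp : |p| < 1) :
    √(1 + (p / √(1 - p ^ 2)) ^ 2) = 1 / √(1 - p ^ 2) := by
  have h : 0 < 1 - p ^ 2 := by
    have := (sq_lt_one_iff_abs_lt_one p).2 hp
    linarith
  rw [Real.sqrt_eq_iff_mul_self_eq (by positivity) (by positivity), div_pow, Real.sq_sqrt h.le,
    div_mul_div_comm, Real.mul_self_sqrt h.le]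
  field_simp
  ring

namespace IsGeneralizedLogistic

variable {g : ℝ → ℝ} {σ : ℝ}

theorem hasDerivAt_gap (hg : IsGeneralizedLogistic g σ) (lam mu α : ℝ) {u : ℝ} (hu : 0 < u) :
    HasDerivAt (gap g lam mu α) (-(lam * g u - mu)) u := by
  have h1 := (((hg.hasDerivAt_primitive hu).const_sub (primitive g α)).const_mul lam).sub
    (((hasDerivAt_id u).const_sub α).const_mul mu)
  refine HasDerivAt.congr_deriv h1 ?_
  ring

theorem continuousOn_gap (hg : IsGeneralizedLogistic g σ) (lam mu α : ℝ) :
    ContinuousOn (gap g lam mu α) (Ici 0) := by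
  have := hg.continuousOn_primitive
  unfold gap
  fun_prop

theorem gap_self (g : ℝ → ℝ) (lam mu α : ℝ) : gap g lam mu α α = 0 := by simp [gap]

/-- If the energy deficit to `α` is nonnegative below `α`, it is positive at every critical
value other than `α`. -/
theorem gap_pos_of_nonneg (hg : IsGeneralizedLogistic g σ) {lam mu α c : ℝ} (hlam : 0 < lam)
    (hmu : 0 < mu) (h : ∀ y ∈ Ioo 0 α, 0 ≤ gap g lam mu α y) (hc : c ∈ Ioo 0 α) :
    0 < gap g lam mu α c := by
  refine lt_of_le_of_ne (h c hc) fun h0 => ?_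
  have hmin : IsLocalMin (gap g lam mu α) c := by
    filter_upwards [Ioo_mem_nhds hc.1 hc.2] with y hy
    rw [← h0]; exact h y hy
  have hfc : lam * g c - mu = 0 := by
    have := hmin.hasDerivAt_eq_zero (hg.hasDerivAt_gap lam mu α hc.1)
    linarith
  have hlt : ∀ y, 0 < mu - lam * g y ∨ y < σ := fun y => by
    by_cases hy : y < σ
    · exact Or.inr hy
    · left
      nlinarith [hg.nonpos_of_le (not_lt.1 hy)]
  have hcσ : c < σ := (hlt c).resolve_left (by linarith)
  -- If f = λg - μ were nonnegative at some y > c, strict concavity would make f positive just right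
  -- of c, and the deficit would drop below its value 0 there.
  have hneg : ∀ y, c < y → lam * g y - mu < 0 := by
    intro y hcy
    by_contra hcon
    push Not at hcon
    have hyσ : y < σ := (hlt y).resolve_left (by linarith)
    obtain ⟨z, hz, hz'⟩ := exists_between (lt_min hcy hc.2)
    have hzy : z < y := hz'.trans_le (min_le_left _ _)
    have hzα : z < α := hz'.trans_le (min_le_right _ _)
    have hanti : StrictAntiOn (gap g lam mu α) (Icc c z) := by
      apply strictAntiOn_of_deriv_neg (convex_Icc c z)
        ((hg.continuousOn_gap lam mu α).mono fun x hx => hc.1.le.trans hx.1)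
      rw [interior_Icc]
      intro x hx
      rw [(hg.hasDerivAt_gap lam mu α (hc.1.trans hx.1)).deriv]
      have hxy : x < y := hx.2.trans hzy
      set t := (y - x) / (y - c) with ht
      have hyc : 0 < y - c := by linarith
      have ht0 : 0 < t := div_pos (by linarith) hyc
      have ht1 : 0 < 1 - t := by
        have : t < 1 := by rw [ht, div_lt_one hyc]; linarith [hx.1]
        linarith
      have hconc := hg.strictConcaveOn.2 (x := c) (y := y) ⟨hc.1.le, hcσ.le⟩
        ⟨(hc.1.trans hcy).le, hyσ.le⟩ hcy.ne ht0 ht1 (by ring)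
      simp only [smul_eq_mul] at hconc
      have hxe : t * c + (1 - t) * y = x := by
        have : t * (y - c) = y - x := div_mul_cancel₀ _ hyc.ne'
        linarith
      rw [hxe] at hconc
      have e1 : lam * (t * g c + (1 - t) * g y) < lam * g x := by gcongr
      have e2 : mu ≤ lam * (t * g c + (1 - t) * g y) := by
        have := mul_nonneg ht1.le hcon
        have : t * (lam * g c - mu) = 0 := by rw [hfc, mul_zero]
        linarith
      linarith
    have := hanti ⟨le_rfl, hz.le⟩ ⟨hz.le, le_rfl⟩ hz
    rw [← h0] at this
    exact this.not_ge (h z ⟨hc.1.trans hz, hzα⟩)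
  -- With f negative beyond c, the deficit would increase strictly from 0 at c to 0 at α.
  have hmono : StrictMonoOn (gap g lam mu α) (Icc c α) := by
    apply strictMonoOn_of_deriv_pos (convex_Icc c α)
      ((hg.continuousOn_gap lam mu α).mono fun x hx => hc.1.le.trans hx.1)
    rw [interior_Icc]
    intro x hx
    rw [(hg.hasDerivAt_gap lam mu α (hc.1.trans hx.1)).deriv]
    linarith [hneg x hx.1]
  have := hmono ⟨le_rfl, hc.2.le⟩ ⟨hc.2.le, le_rfl⟩ hc.2
  rw [gap_self, ← h0] at this
  exact lt_irrefl _ this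

/-- A height at which the time integral converges is admissible. -/
theorem isAdmissible_of_integrableOn (hg : IsGeneralizedLogistic g σ) {lam mu α : ℝ}
    (hlam : 0 < lam) (hmu : 0 < mu) (hα : 0 < α) (hpos : ∀ y ∈ Ioo 0 α, 0 < gap g lam mu α y)
    (hint : MeasureTheory.IntegrableOn (fun y => slowness (gap g lam mu α y)) (Ioo 0 α)) :
    IsAdmissible g σ lam mu α := by
  -- Otherwise the deficit increases up to its value 0 at α, so it is negative just below α.
  have hnonneg : mu ≤ lam * g α := by
    by_contra hcon
    push Not at hcon
    have hc : ContinuousAt (fun y => lam * g y) α := continuousAt_const.mul (hg.continuousAt hα)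
    obtain ⟨δ, hδ, h⟩ := Metric.eventually_nhds_iff.1 (hc.eventually_lt_const hcon)
    obtain ⟨y, hy, hyα⟩ := exists_between (max_lt hα (sub_lt_self α hδ))
    have hy0 := (le_max_left _ _).trans_lt hy
    have hyδ := (le_max_right _ _).trans_lt hy
    have hmono : StrictMonoOn (gap g lam mu α) (Icc y α) := by
      apply strictMonoOn_of_deriv_pos (convex_Icc y α)
        ((hg.continuousOn_gap lam mu α).mono fun x hx => hy0.le.trans hx.1)
      rw [interior_Icc]
      intro x hx
      rw [(hg.hasDerivAt_gap lam mu α (hy0.trans hx.1)).deriv]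
      have := h (y := x) (by rw [Real.dist_eq, abs_lt]; constructor <;> linarith [hx.1, hx.2])
      linarith
    have := hmono ⟨le_rfl, hyα.le⟩ ⟨hyα.le, le_rfl⟩ hyα
    rw [gap_self] at this
    exact this.not_gt (hpos y ⟨hy0, hyα⟩)
  have hασ : α < σ := by
    by_contra hcon
    nlinarith [hg.nonpos_of_le (not_lt.1 hcon)]
  refine ⟨hlam, hα, hασ, lt_of_le_of_ne hnonneg fun heq => ?_, ?_⟩
  -- If λg(α) = μ, the deficit is at most quadratic at α, and integrability of the kernel would make
  -- 1/(y - α) integrable.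
  · obtain ⟨C, hC0, hC⟩ := hg.exists_sub_le (half_pos hα) σ
    set B := lam * (C + 1) with hB
    have hB0 : 0 < B := by positivity
    have hsub : Ioo (α / 2) α ⊆ Ioo 0 α := Ioo_subset_Ioo_left (half_pos hα).le
    have hinv : MeasureTheory.IntegrableOn (fun y => (y - α)⁻¹) (Ioo (α / 2) α) := by
      refine MeasureTheory.Integrable.mono' ((hint.mono_set hsub).const_mul √(2 * B)) ?_ ?_
      · exact (by fun_prop : Measurable fun y : ℝ => (y - α)⁻¹).aestronglyMeasurable
      · refine (MeasureTheory.ae_restrict_mem measurableSet_Ioo).mono fun y hy => ?_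
        have hyα : 0 < α - y := sub_pos.2 hy.2
        have hle := hg.gap_le (mu := mu) hlam.le (half_pos hα).le
          (fun u v h1 h2 h3 => hC u v h1 h2 (h3.trans hασ.le)) hC0 hy.1.le hy.2.le
        rw [← heq, sub_self, zero_mul, zero_add] at hle
        have hle2 : gap g lam mu α y ≤ B * (α - y) ^ 2 := by
          refine hle.trans ?_
          rw [hB]; gcongr; linarith
        have h1 := (inv_sqrt_le_slowness (by positivity : 0 < B * (α - y) ^ 2)).trans
          (slowness_anti (hpos y (hsub hy)) hle2)
        rw [← mul_assoc, Real.sqrt_mul (by positivity : 0 ≤ 2 * B), Real.sqrt_sq hyα.le,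
          div_le_iff₀ (by positivity)] at h1
        rw [Real.norm_eq_abs, abs_inv, abs_sub_comm, abs_of_pos hyα, inv_le_iff_one_le_mul₀ hyα]
        linarith
    have := (intervalIntegrable_sub_inv_iff (a := α / 2) (b := α) (c := α)).1
      ((intervalIntegrable_iff_integrableOn_Ioo_of_le (by linarith)).2 hinv)
    rcases this with h | h
    · linarith
    · exact h right_mem_uIcc
  · have h0 : 0 ≤ gap g lam mu α 0 := by
      have hc := (hg.continuousOn_gap lam mu α 0 self_mem_Ici).mono Ioi_subset_Ici_self
      refine ge_of_tendsto hc ?_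
      filter_upwards [Ioo_mem_nhdsGT hα] with y hy using (hpos y hy).le
    rw [gap, primitive_zero] at h0
    linarith

end IsGeneralizedLogistic

namespace IsPositiveSolution

variable {g : ℝ → ℝ} {σ L lam mu : ℝ} {u : ℝ → ℝ}

theorem hasDerivAt (hu : IsPositiveSolution g L lam mu u) {x : ℝ} (hx : x ∈ Ioo (-L) L) :
    HasDerivAt u (deriv u x) x :=
  ((hu.contDiffOn.contDiffAt (isOpen_Ioo.mem_nhds hx)).differentiableAt
    (by norm_num)).hasDerivAt

theorem hasDerivAt_momentum (hu : IsPositiveSolution g L lam mu u) {x : ℝ}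
    (hx : x ∈ Ioo (-L) L) :
    HasDerivAt (fun y => deriv u y / √(1 - deriv u y ^ 2)) (-(lam * g (u x) - mu)) x := by
  have hc1 : ContDiffOn ℝ 1 (deriv u) (Ioo (-L) L) :=
    ((contDiffOn_succ_iff_deriv_of_isOpen (n := 1) isOpen_Ioo).1
      (by simpa [one_add_one_eq_two] using hu.contDiffOn)).2.2
  have hd : DifferentiableAt ℝ (deriv u) x :=
    (hc1.contDiffAt (isOpen_Ioo.mem_nhds hx)).differentiableAt (by norm_num)
  have h1 : 0 < 1 - deriv u x ^ 2 := by
    have := (sq_lt_one_iff_abs_lt_one _).2 (hu.abs_deriv_lt_one x hx)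
    linarith
  have hd2 : DifferentiableAt ℝ (fun y => deriv u y / √(1 - deriv u y ^ 2)) x :=
    hd.div (((differentiableAt_const _).sub (hd.pow 2)).sqrt h1.ne') (by positivity)
  have e := hu.equation x hx
  exact hd2.hasDerivAt.congr_deriv (by linarith)

/-- Conservation of energy. -/
theorem energy (hu : IsPositiveSolution g L lam mu u) (hg : IsGeneralizedLogistic g σ)
    {x₀ x : ℝ} (h₀ : x₀ ∈ Ioo (-L) L) (hcrit : deriv u x₀ = 0) (hx : x ∈ Ioo (-L) L) :
    gap g lam mu (u x₀) (u x) = 1 / √(1 - deriv u x ^ 2) - 1 := by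
  set v := fun y => deriv u y / √(1 - deriv u y ^ 2) with hv
  -- In terms of the momentum v, whose derivative the equation gives, 1/√(1-u'²) is √(1+v²).
  have hder : ∀ y ∈ Ioo (-L) L,
      HasDerivAt (fun y => √(1 + v y ^ 2) - gap g lam mu (u x₀) (u y)) 0 y := by
    intro y hy
    have h1 := hu.hasDerivAt_momentum hy
    have h2 : HasDerivAt (fun y => 1 + v y ^ 2) (2 * v y * (-(lam * g (u y) - mu))) y := by
      simpa using (h1.pow 2).const_add 1
    have h3 := h2.sqrt (by positivity)
    have h4 := (hg.hasDerivAt_gap lam mu (u x₀) (hu.pos y hy)).comp y (hu.hasDerivAt hy)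
    refine (h3.sub h4).congr_deriv ?_
    have hs := sqrt_one_add_momentum_sq (hu.abs_deriv_lt_one y hy)
    have hp : 0 < 1 - deriv u y ^ 2 := by
      have := (sq_lt_one_iff_abs_lt_one _).2 (hu.abs_deriv_lt_one y hy)
      linarith
    simp only [hv] at hs ⊢
    rw [hs]
    field_simp
    ring
  have hconst := isOpen_Ioo.is_const_of_deriv_eq_zero isPreconnected_Ioo
    (fun y hy => (hder y hy).differentiableAt.differentiableWithinAt)
    (fun y hy => (hder y hy).deriv) hx h₀
  simp only [hv] at hconst
  rw [sqrt_one_add_momentum_sq (hu.abs_deriv_lt_one x hx),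
    IsGeneralizedLogistic.gap_self, hcrit] at hconst
  simp at hconst
  rw [one_div]
  linarith

/-- The energy law solved for the speed; this is why `slowness` has its form. -/
theorem slowness_gap (hu : IsPositiveSolution g L lam mu u) (hg : IsGeneralizedLogistic g σ)
    {x₀ x : ℝ} (h₀ : x₀ ∈ Ioo (-L) L) (hcrit : deriv u x₀ = 0) (hx : x ∈ Ioo (-L) L)
    (hpos : 0 < deriv u x) :
    slowness (gap g lam mu (u x₀) (u x)) = 1 / deriv u x := by
  rw [hu.energy hg h₀ hcrit hx]
  have hp : 0 < 1 - deriv u x ^ 2 := by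
    have := (sq_lt_one_iff_abs_lt_one _).2 (hu.abs_deriv_lt_one x hx)
    linarith
  set p := deriv u x
  set r := √(1 - p ^ 2) with hr
  have hr0 : 0 < r := by positivity
  have hr2 : r ^ 2 = 1 - p ^ 2 := Real.sq_sqrt hp.le
  have hs : (1 / r - 1) ^ 2 + 2 * (1 / r - 1) = (p / r) ^ 2 := by
    have : p ^ 2 = 1 - r ^ 2 := by linarith
    rw [div_pow, this]
    field_simp
    ring
  rw [slowness, hs, Real.sqrt_sq (by positivity)]
  field_simp
  ring

/-- The part of a solution to the left of its first maximum is described by the time map. -/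
theorem left_branch (hu : IsPositiveSolution g L lam mu u) (hg : IsGeneralizedLogistic g σ)
    (hlam : 0 < lam) (hmu : 0 < mu) {x₀ : ℝ} (h₀ : x₀ ∈ Ioo (-L) L)
    (hmax : ∀ x ∈ Ioo (-L) L, u x ≤ u x₀) (hfirst : ∀ x ∈ Ioo (-L) x₀, u x < u x₀) :
    IsAdmissible g σ lam mu (u x₀) ∧ timeMap g lam mu (u x₀) = x₀ + L := by
  set α := u x₀ with hα
  have hα0 : 0 < α := hu.pos x₀ h₀
  have hsub : ∀ {x}, x ∈ Ioo (-L) x₀ → x ∈ Ioo (-L) L := fun hx => ⟨hx.1, hx.2.trans h₀.2⟩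
  have hcrit : deriv u x₀ = 0 := by
    apply IsLocalMax.deriv_eq_zero
    filter_upwards [isOpen_Ioo.mem_nhds h₀] with x hx using hmax x hx
  have hcont : ContinuousOn u (Icc (-L) x₀) := hu.continuousOn.mono (Icc_subset_Icc_right h₀.2.le)
  -- Every level below α is attained before x₀, so facts about the deficit along the solution become
  -- facts about all y in (0, α).
  have hsurj : Ioo 0 α ⊆ u '' Ioo (-L) x₀ := by
    have := intermediate_value_Ioo h₀.1.le hcont
    rwa [hu.left_eq_zero] at this
  have hnn : ∀ y ∈ Ioo 0 α, 0 ≤ gap g lam mu α y := by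
    intro y hy
    obtain ⟨x, hx, rfl⟩ := hsurj hy
    rw [hu.energy hg h₀ hcrit (hsub hx), sub_nonneg, one_le_div (by
      have := (sq_lt_one_iff_abs_lt_one _).2 (hu.abs_deriv_lt_one x (hsub hx))
      apply Real.sqrt_pos.2; linarith)]
    exact Real.sqrt_le_one.2 (by nlinarith [sq_nonneg (deriv u x)])
  have hgpos : ∀ y ∈ Ioo 0 α, 0 < gap g lam mu α y := fun y hy =>
    hg.gap_pos_of_nonneg hlam hmu hnn hy
  have hne : ∀ x ∈ Ioo (-L) x₀, deriv u x ≠ 0 := by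
    intro x hx h0
    have := hgpos (u x) ⟨hu.pos x (hsub hx), hfirst x hx⟩
    rw [hu.energy hg h₀ hcrit (hsub hx), h0] at this
    simp at this
  have hdpos : ∀ x ∈ Ioo (-L) x₀, 0 < deriv u x := by
    rcases hasDerivWithinAt_forall_lt_or_forall_gt_of_forall_ne (convex_Ioo (-L) x₀)
      (fun x hx => (hu.hasDerivAt (hsub hx)).hasDerivWithinAt) hne with h | h
    · exfalso
      have hanti : StrictAntiOn u (Icc (-L) x₀) :=
        strictAntiOn_of_deriv_neg (convex_Icc _ _) hcont (by rw [interior_Icc]; exact h)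
      have := hanti ⟨le_rfl, h₀.1.le⟩ ⟨h₀.1.le, le_rfl⟩ h₀.1
      rw [hu.left_eq_zero] at this
      linarith
    · exact h
  have hmono : StrictMonoOn u (Icc (-L) x₀) :=
    strictMonoOn_of_deriv_pos (convex_Icc _ _) hcont (by rw [interior_Icc]; exact hdpos)
  have himage : u '' Ioo (-L) x₀ = Ioo 0 α := by
    refine Subset.antisymm ?_ hsurj
    rintro _ ⟨x, hx, rfl⟩
    exact ⟨hu.pos x (hsub hx), hfirst x hx⟩
  have hinj : InjOn u (Ioo (-L) x₀) := hmono.injOn.mono Ioo_subset_Icc_self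
  have hd : ∀ x ∈ Ioo (-L) x₀, HasDerivWithinAt u (deriv u x) (Ioo (-L) x₀) x :=
    fun x hx => (hu.hasDerivAt (hsub hx)).hasDerivWithinAt
  -- Under y = u(x) the integrand becomes u'·(1/u') = 1, which gives both integrability and the
  -- value x₀ + L.
  have hone : EqOn (fun x => |deriv u x| • slowness (gap g lam mu α (u x))) (fun _ => (1 : ℝ))
      (Ioo (-L) x₀) := by
    intro x hx
    have h1 := hdpos x hx
    simp only [smul_eq_mul]
    rw [hu.slowness_gap hg h₀ hcrit (hsub hx) h1, abs_of_pos h1, mul_one_div_cancel h1.ne']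
  have hint : MeasureTheory.IntegrableOn (fun y => slowness (gap g lam mu α y)) (Ioo 0 α) := by
    rw [← himage, MeasureTheory.integrableOn_image_iff_integrableOn_abs_deriv_smul
      measurableSet_Ioo hd hinj, MeasureTheory.integrableOn_congr_fun hone measurableSet_Ioo]
    simp
  refine ⟨hg.isAdmissible_of_integrableOn hlam hmu hα0 hgpos hint, ?_⟩
  rw [timeMap, intervalIntegral.integral_of_le hα0.le, MeasureTheory.integral_Ioc_eq_integral_Ioo,
    ← himage, MeasureTheory.integral_image_eq_integral_abs_deriv_smul measurableSet_Ioo hd hinj,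
    MeasureTheory.setIntegral_congr_fun measurableSet_Ioo hone]
  simp
  linarith [h₀.1]

theorem comp_neg (hu : IsPositiveSolution g L lam mu u) :
    IsPositiveSolution g L lam mu (fun x => u (-x)) := by
  have hIcc : ∀ {x}, x ∈ Icc (-L) L → -x ∈ Icc (-L) L := fun hx =>
    ⟨by linarith [hx.2], by linarith [hx.1]⟩
  have hIoo : ∀ {x}, x ∈ Ioo (-L) L → -x ∈ Ioo (-L) L := fun hx =>
    ⟨by linarith [hx.2], by linarith [hx.1]⟩
  have hd : (deriv fun x => u (-x)) = fun x => -deriv u (-x) := by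
    ext x; exact deriv_comp_neg u x
  refine ⟨hu.continuousOn.comp (by fun_prop) fun x hx => hIcc hx,
    hu.contDiffOn.comp (by fun_prop) fun x hx => hIoo hx, fun x hx => ?_, fun x hx => ?_,
    by simpa using hu.right_eq_zero, hu.left_eq_zero, fun x hx => hu.pos _ (hIoo hx)⟩
  · rw [hd, abs_neg]
    exact hu.abs_deriv_lt_one _ (hIoo hx)
  · rw [hd]
    have h := (hu.hasDerivAt_momentum (hIoo hx)).comp x (hasDerivAt_neg x)
    have h2 : HasDerivAt (fun y => -deriv u (-y) / √(1 - (-deriv u (-y)) ^ 2))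
        (-(lam * g (u (-x)) - mu)) x := by
      refine (h.neg.congr_of_eventuallyEq (Eventually.of_forall fun y => ?_)).congr_deriv (by ring)
      simp [neg_div]
    rw [h2.deriv, neg_neg]

theorem supNorm_eq (hu : IsPositiveSolution g L lam mu u) {x₀ : ℝ} (h₀ : x₀ ∈ Icc (-L) L)
    (hmax : ∀ x ∈ Icc (-L) L, u x ≤ u x₀) : supNorm L u = u x₀ := by
  have hnn : ∀ x ∈ Icc (-L) L, 0 ≤ u x := by
    intro x hx
    rcases hx.1.eq_or_lt with rfl | h1
    · exact hu.left_eq_zero.ge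
    rcases hx.2.eq_or_lt with rfl | h2
    · exact hu.right_eq_zero.ge
    exact (hu.pos x ⟨h1, h2⟩).le
  apply IsGreatest.csSup_eq
  refine ⟨⟨x₀, h₀, abs_of_nonneg (hnn x₀ h₀)⟩, ?_⟩
  rintro _ ⟨x, hx, rfl⟩
  simp only [abs_of_nonneg (hnn x hx)]
  exact hmax x hx

/-- There is a first point where the maximum is attained. -/
theorem exists_first_max (hu : IsPositiveSolution g L lam mu u) (hL : 0 < L) :
    ∃ x₀ ∈ Ioo (-L) L, (∀ x ∈ Icc (-L) L, u x ≤ u x₀) ∧ ∀ x ∈ Ioo (-L) x₀, u x < u x₀ := by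
  obtain ⟨y, hy, hmax⟩ := isCompact_Icc.exists_isMaxOn ⟨0, by linarith, hL.le⟩ hu.continuousOn
  have hpos : 0 < u y := (hu.pos 0 ⟨by linarith, hL⟩).trans_le (hmax ⟨by linarith, hL.le⟩)
  have hclosed : IsCompact (Icc (-L) L ∩ u ⁻¹' {u y}) :=
    isCompact_Icc.of_isClosed_subset
      (hu.continuousOn.preimage_isClosed_of_isClosed isClosed_Icc isClosed_singleton)
      inter_subset_left
  obtain ⟨x₀, ⟨hx₀, hx₀y⟩, hleast⟩ := hclosed.exists_isLeast ⟨y, hy, rfl⟩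
  have hx₀y' : u x₀ = u y := hx₀y
  have hne1 : -L ≠ x₀ := by
    rintro rfl
    rw [hu.left_eq_zero] at hx₀y'; linarith
  have hne2 : x₀ ≠ L := by
    rintro rfl
    rw [hu.right_eq_zero] at hx₀y'; linarith
  refine ⟨x₀, ⟨lt_of_le_of_ne hx₀.1 hne1, lt_of_le_of_ne hx₀.2 hne2⟩,
    fun x hx => hx₀y' ▸ hmax hx, fun x hx => ?_⟩
  have hxI : x ∈ Icc (-L) L := ⟨hx.1.le, (hx.2.trans_le hx₀.2).le⟩
  refine lt_of_le_of_ne (hx₀y' ▸ hmax hxI) fun heq => ?_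
  exact (hleast ⟨hxI, heq.trans hx₀y'⟩).not_gt hx.2

/-- The left branches of u and of its reflection have the same height, hence the same duration, so
the first maximum x₀ and the last maximum -x₁ are symmetric about 0. It remains to exclude x₀ < -x₁.
-/
theorem onCurve (hu : IsPositiveSolution g L lam mu u) (hg : IsGeneralizedLogistic g σ)
    (hL : 0 < L) (hlam : 0 < lam) (hmu : 0 < mu) : OnCurve g σ L lam mu (supNorm L u) := by
  obtain ⟨x₀, h₀, hmax, hfirst⟩ := hu.exists_first_max hL
  obtain ⟨x₁, h₁, hmax₁, hfirst₁⟩ := hu.comp_neg.exists_first_max hL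
  have hneg : -x₁ ∈ Ioo (-L) L := ⟨by linarith [h₁.2], by linarith [h₁.1]⟩
  have heq : u (-x₁) = u x₀ := by
    apply le_antisymm (hmax _ ⟨hneg.1.le, hneg.2.le⟩)
    have := hmax₁ (-x₀) ⟨by linarith [h₀.2], by linarith [h₀.1]⟩
    simpa using this
  obtain ⟨hadm, hT⟩ := hu.left_branch hg hlam hmu h₀ (fun x hx => hmax x ⟨hx.1.le, hx.2.le⟩) hfirst
  obtain ⟨-, hT₁⟩ := hu.comp_neg.left_branch hg hlam hmu h₁
    (fun x hx => hmax₁ x ⟨hx.1.le, hx.2.le⟩) hfirst₁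
  rw [heq, hT] at hT₁
  have hle : x₀ ≤ -x₁ := by
    by_contra hcon
    have := hfirst (-x₁) ⟨hneg.1, not_le.1 hcon⟩
    exact this.ne heq
  have hcrit : deriv u x₀ = 0 := by
    apply IsLocalMax.deriv_eq_zero
    filter_upwards [isOpen_Ioo.mem_nhds h₀] with x hx using hmax x ⟨hx.1.le, hx.2.le⟩
  have hx0 : x₀ = 0 := by
    by_contra hne
    have hlt : x₀ < -x₁ := lt_of_le_of_ne hle fun h => hne (by linarith)
    have hIsub : ∀ {x}, x ∈ Ioo x₀ (-x₁) → x ∈ Ioo (-L) L := fun hx =>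
      ⟨h₀.1.trans hx.1, hx.2.trans hneg.2⟩
    -- A dip between the two maxima would have a critical minimum below α, where the energy law
    -- gives deficit 0 although the deficit is positive below α.
    have hconst : ∀ x ∈ Ioo x₀ (-x₁), u x = u x₀ := by
      obtain ⟨z, hz, hmin⟩ := isCompact_Icc.exists_isMinOn (nonempty_Icc.2 hlt.le)
        (hu.continuousOn.mono (Icc_subset_Icc h₀.1.le hneg.2.le))
      suffices hzα : u z = u x₀ by
        intro x hx
        have := hIsub hx
        exact le_antisymm (hmax x ⟨this.1.le, this.2.le⟩)
          (hzα ▸ hmin ⟨hx.1.le, hx.2.le⟩)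
      by_contra hzne
      have hz' : z ∈ Ioo x₀ (-x₁) := by
        refine ⟨lt_of_le_of_ne hz.1 ?_, lt_of_le_of_ne hz.2 ?_⟩
        · rintro rfl; exact hzne rfl
        · rintro rfl; exact hzne heq
      have hzc : deriv u z = 0 := by
        apply IsLocalMin.deriv_eq_zero
        filter_upwards [isOpen_Ioo.mem_nhds hz'] with x hx using hmin ⟨hx.1.le, hx.2.le⟩
      have hzI := hIsub hz'
      have hzlt : u z < u x₀ := lt_of_le_of_ne (hmax z ⟨hzI.1.le, hzI.2.le⟩) hzne
      have h1 := hg.gap_pos hadm (s := u z / u x₀)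
        ⟨div_pos (hu.pos z hzI) hadm.pos, (div_lt_one hadm.pos).2 hzlt⟩
      rw [mul_div_cancel₀ _ hadm.pos.ne', hu.energy hg h₀ hcrit hzI, hzc] at h1
      simp at h1
    -- On a plateau the momentum vanishes identically, so the equation gives λg(α) = μ, against
    -- strict admissibility.
    obtain ⟨x, hx⟩ := exists_between hlt
    have hev : (fun y => deriv u y / √(1 - deriv u y ^ 2)) =ᶠ[𝓝 x] fun _ => 0 := by
      filter_upwards [isOpen_Ioo.mem_nhds hx] with y hy
      have : deriv u y = 0 := by
        apply IsLocalMax.deriv_eq_zero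
        filter_upwards [isOpen_Ioo.mem_nhds hy] with w hw
        rw [hconst y hy]; exact (hconst w hw).le
      simp [this]
    have h1 := (hu.hasDerivAt_momentum (hIsub hx)).unique
      ((hasDerivAt_const x (0 : ℝ)).congr_of_eventuallyEq hev)
    rw [hconst x hx] at h1
    linarith [hadm.mu_lt]
  rw [hu.supNorm_eq ⟨h₀.1.le, h₀.2.le⟩ hmax]
  exact ⟨hmu, hadm, by rw [hT, hx0, zero_add]⟩

end IsPositiveSolution

/-! ### From the level set to solutions -/

/-- A continuous function whose derivative off a point extends continuously to that point is
differentiable there. -/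
theorem hasDerivAt_of_eventually_hasDerivAt {f h : ℝ → ℝ} {x : ℝ} (hf : ContinuousAt f x)
    (hh : ContinuousAt h x) (hd : ∀ᶠ y in 𝓝[≠] x, HasDerivAt f (h y) y) :
    HasDerivAt f (h x) x := by
  obtain ⟨ε, hε, hball⟩ := Metric.mem_nhdsWithin_iff.1 hd
  have hmem : ∀ y, |y - x| < ε → y ≠ x → HasDerivAt f (h y) y := fun y hy hne =>
    hball ⟨by rwa [Metric.mem_ball, Real.dist_eq], hne⟩
  have hr : ∀ y ∈ Ioo x (x + ε), HasDerivAt f (h y) y := fun y hy =>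
    hmem y (by rw [abs_lt]; constructor <;> linarith [hy.1, hy.2]) hy.1.ne'
  have hl : ∀ y ∈ Ioo (x - ε) x, HasDerivAt f (h y) y := fun y hy =>
    hmem y (by rw [abs_lt]; constructor <;> linarith [hy.1, hy.2]) hy.2.ne
  have A : HasDerivWithinAt f (h x) (Ici x) x := by
    have hs : Ioo x (x + ε) ∈ 𝓝[>] x := Ioo_mem_nhdsGT (by linarith)
    refine hasDerivWithinAt_Ici_of_tendsto_deriv
      (fun y hy => (hr y hy).differentiableAt.differentiableWithinAt) hf.continuousWithinAt hs ?_
    refine Tendsto.congr' ?_ (hh.mono_left nhdsWithin_le_nhds)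
    filter_upwards [hs] with y hy using (hr y hy).deriv.symm
  have B : HasDerivWithinAt f (h x) (Iic x) x := by
    have hs : Ioo (x - ε) x ∈ 𝓝[<] x := Ioo_mem_nhdsLT (by linarith)
    refine hasDerivWithinAt_Iic_of_tendsto_deriv
      (fun y hy => (hl y hy).differentiableAt.differentiableWithinAt) hf.continuousWithinAt hs ?_
    refine Tendsto.congr' ?_ (hh.mono_left nhdsWithin_le_nhds)
    filter_upwards [hs] with y hy using (hl y hy).deriv.symm
  simpa using B.union A

/-- Inverting an increasing primitive: if `k ≥ 1` is integrable on `(0, α)`, continuous there and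
has integral `L`, then `∫₀ᵘ k` has a continuous inverse, shifted here to start at `-L`. -/
theorem exists_inverse_primitive {k : ℝ → ℝ} {α L : ℝ} (hα : 0 < α)
    (hint : MeasureTheory.IntegrableOn k (Ioo 0 α)) (hk : ∀ y ∈ Ioo 0 α, 1 ≤ k y)
    (hcont : ContinuousOn k (Ioo 0 α)) (hL : ∫ y in (0 : ℝ)..α, k y = L) :
    ∃ U : ℝ → ℝ, Continuous U ∧ StrictMono U ∧ U (-L) = 0 ∧ U 0 = α ∧
      ∀ x ∈ Ioo (-L) 0, HasDerivAt U (k (U x))⁻¹ x := by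
  -- Extending k by 1 outside (0, α) makes its primitive an increasing bijection of ℝ with a
  -- globally continuous inverse.
  set e : ℝ → ℝ := (Ioo 0 α).indicator (fun y => k y - 1) with he
  have he0 : ∀ y, 0 ≤ e y := fun y => indicator_nonneg (fun y hy => sub_nonneg.2 (hk y hy)) y
  have hei : MeasureTheory.Integrable e := by
    rw [he, MeasureTheory.integrable_indicator_iff measurableSet_Ioo]
    exact hint.sub (by simp [MeasureTheory.integrableOn_const_iff])
  have hii : ∀ a b, IntervalIntegrable e MeasureTheory.volume a b :=
    fun a b => hei.intervalIntegrable
  set X : ℝ → ℝ := fun y => -L + y + ∫ t in (0 : ℝ)..y, e t with hX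
  have hXc : Continuous X :=
    (continuous_const.add continuous_id).add (intervalIntegral.continuous_primitive hii 0)
  have hXm : StrictMono X := by
    intro a b hab
    have h1 := intervalIntegral.integral_add_adjacent_intervals (hii 0 a) (hii a b)
    have h2 : 0 ≤ ∫ t in a..b, e t :=
      intervalIntegral.integral_nonneg_of_forall hab.le he0
    simp only [hX]
    linarith
  have htop : Tendsto X atTop atTop := by
    refine tendsto_atTop_mono' _ ?_ (tendsto_atTop_add_const_left atTop (-L) tendsto_id)
    filter_upwards [eventually_ge_atTop 0] with y hy
    have := intervalIntegral.integral_nonneg_of_forall hy he0 (μ := MeasureTheory.volume)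
    simp only [hX, id]
    linarith
  have hbot : Tendsto X atBot atBot := by
    refine tendsto_atBot_mono' _ ?_ (tendsto_atBot_add_const_left atBot (-L) tendsto_id)
    filter_upwards [eventually_le_atBot 0] with y hy
    have := intervalIntegral.integral_nonneg_of_forall hy he0 (μ := MeasureTheory.volume)
    rw [intervalIntegral.integral_symm] at this
    simp only [hX, id]
    linarith
  set E := hXm.orderIsoOfSurjective X (hXc.surjective htop hbot) with hE
  have hEX : ∀ y, E.symm (X y) = y := fun y => E.symm_apply_apply y
  have hXE : ∀ x, X (E.symm x) = x := fun x => E.apply_symm_apply x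
  have hX0 : X 0 = -L := by simp [hX]
  have hXα : X α = 0 := by
    have h1 : ∫ t in (0 : ℝ)..α, e t = ∫ t in (0 : ℝ)..α, (k t - 1) := by
      rw [intervalIntegral.integral_of_le hα.le, intervalIntegral.integral_of_le hα.le,
        MeasureTheory.integral_Ioc_eq_integral_Ioo, MeasureTheory.integral_Ioc_eq_integral_Ioo]
      exact MeasureTheory.setIntegral_congr_fun measurableSet_Ioo
        fun y hy => indicator_of_mem hy _
    have h2 : ∫ t in (0 : ℝ)..α, (k t - 1) = L - α := by
      rw [intervalIntegral.integral_sub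
        ((intervalIntegrable_iff_integrableOn_Ioo_of_le hα.le).2 hint) (by simp), hL]
      simp
    simp only [hX, h1, h2]
    ring
  have h0 : E.symm (-L) = 0 := by rw [← hX0, hEX]
  have h1 : E.symm 0 = α := by rw [← hXα, hEX]
  refine ⟨E.symm, E.symm.continuous, E.symm.strictMono, h0, h1, fun x hx => ?_⟩
  have hU : E.symm x ∈ Ioo 0 α := by
    constructor
    · rw [← h0]; exact E.symm.strictMono hx.1
    · rw [← h1]; exact E.symm.strictMono hx.2
  have heU : e =ᶠ[𝓝 (E.symm x)] fun y => k y - 1 := by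
    filter_upwards [isOpen_Ioo.mem_nhds hU] with y hy using indicator_of_mem hy _
  have hkc : ContinuousAt k (E.symm x) := hcont.continuousAt (isOpen_Ioo.mem_nhds hU)
  have hec : ContinuousAt e (E.symm x) := (hkc.sub continuousAt_const).congr heU.symm
  have hder : HasDerivAt X (k (E.symm x)) (E.symm x) := by
    have h3 := intervalIntegral.integral_hasDerivAt_right (hii 0 (E.symm x))
      (hei.aestronglyMeasurable.stronglyMeasurableAtFilter) hec
    refine (((hasDerivAt_id _).const_add (-L)).add h3).congr_deriv ?_
    rw [heU.self_of_nhds]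
    ring
  exact HasDerivAt.of_local_left_inverse E.symm.continuous.continuousAt hder
    (by linarith [hk _ hU]) (Eventually.of_forall hXE)

namespace IsGeneralizedLogistic

variable {g : ℝ → ℝ} {σ : ℝ}

theorem gap_pos_of_mem (hg : IsGeneralizedLogistic g σ) {lam mu α y : ℝ}
    (h : IsAdmissible g σ lam mu α) (hy : y ∈ Ioo 0 α) : 0 < gap g lam mu α y := by
  have := hg.gap_pos h (s := y / α) ⟨div_pos hy.1 h.pos, (div_lt_one h.pos).2 hy.2⟩
  rwa [mul_div_cancel₀ _ h.pos.ne'] at this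

theorem continuousOn_slowness_gap (hg : IsGeneralizedLogistic g σ) {lam mu α : ℝ}
    (h : IsAdmissible g σ lam mu α) :
    ContinuousOn (fun y => slowness (gap g lam mu α y)) (Ioo 0 α) :=
  continuousOn_slowness.comp ((hg.continuousOn_gap lam mu α).mono fun _ hy => hy.1.le)
    fun _ hy => hg.gap_pos_of_mem h hy

/-- A first-order system `u' = v / √(1 + v²)`, `v' = -f(u)` yields a positive solution. -/
theorem isPositiveSolution_of_system (hg : IsGeneralizedLogistic g σ) {L lam mu : ℝ}
    {u v : ℝ → ℝ} (hu : Continuous u)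
    (hdu : ∀ x ∈ Ioo (-L) L, HasDerivAt u (v x / √(1 + v x ^ 2)) x)
    (hdv : ∀ x ∈ Ioo (-L) L, HasDerivAt v (-(lam * g (u x) - mu)) x)
    (h1 : u (-L) = 0) (h2 : u L = 0) (hpos : ∀ x ∈ Ioo (-L) L, 0 < u x) :
    IsPositiveSolution g L lam mu u := by
  have hder : EqOn (deriv u) (fun x => v x / √(1 + v x ^ 2)) (Ioo (-L) L) :=
    fun x hx => (hdu x hx).deriv
  have hq : ∀ w : ℝ, 1 - (w / √(1 + w ^ 2)) ^ 2 = 1 / (1 + w ^ 2) := by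
    intro w
    rw [div_pow, Real.sq_sqrt (by positivity)]
    field_simp
    ring
  have hvC : ContDiffOn ℝ 1 v (Ioo (-L) L) := by
    rw [← zero_add (1 : WithTop ℕ∞), contDiffOn_succ_iff_deriv_of_isOpen isOpen_Ioo]
    refine ⟨fun x hx => (hdv x hx).differentiableAt.differentiableWithinAt, by simp, ?_⟩
    rw [contDiffOn_zero]
    refine ContinuousOn.congr (f := fun x => -(lam * g (u x) - mu)) ?_
      fun x hx => (hdv x hx).deriv
    have : ContinuousOn (fun x => g (u x)) (Ioo (-L) L) :=
      hg.continuousOn.comp hu.continuousOn fun x hx => (hpos x hx).le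
    exact ((continuousOn_const.mul this).sub continuousOn_const).neg
  refine ⟨hu.continuousOn, ?_, fun x hx => ?_, fun x hx => ?_, h1, h2, hpos⟩
  · rw [← one_add_one_eq_two, contDiffOn_succ_iff_deriv_of_isOpen isOpen_Ioo]
    refine ⟨fun x hx => (hdu x hx).differentiableAt.differentiableWithinAt, by simp, ?_⟩
    refine ContDiffOn.congr ?_ hder
    refine hvC.div ((contDiffOn_const.add (hvC.pow 2)).sqrt fun x hx => ?_) fun x hx => ?_ <;>
    positivity
  · rw [hder hx, ← sq_lt_one_iff_abs_lt_one]
    have := hq (v x)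
    have : 0 < 1 / (1 + v x ^ 2) := by positivity
    linarith
  · have hev : (fun y => deriv u y / √(1 - deriv u y ^ 2)) =ᶠ[𝓝 x] v := by
      filter_upwards [isOpen_Ioo.mem_nhds hx] with y hy
      rw [hder hy]
      simp only
      rw [hq, Real.sqrt_div zero_le_one, Real.sqrt_one]
      field_simp
    rw [hev.deriv_eq, (hdv x hx).deriv, neg_neg]

/-- Every point of the level set of the time map comes from a solution. -/
theorem exists_isPositiveSolution (hg : IsGeneralizedLogistic g σ) {L lam mu α : ℝ}
    (h : OnCurve g σ L lam mu α) :
    ∃ u, IsPositiveSolution g L lam mu u ∧ supNorm L u = α := by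
  have hadm := h.adm
  have hα := hadm.pos
  have hL : 0 < L := hα.trans_le (h.eq ▸ hg.le_timeMap hadm)
  set D := gap g lam mu α with hD
  have hDpos : ∀ y ∈ Ioo 0 α, 0 < D y := fun y hy => hg.gap_pos_of_mem hadm hy
  obtain ⟨U, hUc, hUm, hU0, hUα, hUd⟩ := exists_inverse_primitive hα
    ((intervalIntegrable_iff_integrableOn_Ioo_of_le hα.le).1 (hg.intervalIntegrable_timeMap hadm))
    (fun y hy => one_le_slowness (hDpos y hy)) (hg.continuousOn_slowness_gap hadm) h.eq
  have hUmem : ∀ x ∈ Ioo (-L) 0, U x ∈ Ioo 0 α := fun x hx =>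
    ⟨hU0 ▸ hUm hx.1, hUα ▸ hUm hx.2⟩
  set P : ℝ → ℝ := fun y => √(D y ^ 2 + 2 * D y) with hP
  have hPc : ContinuousOn P (Ici 0) := by
    have := hg.continuousOn_gap lam mu α
    exact ((this.pow 2).add (continuousOn_const.mul this)).sqrt
  have hP1 : ∀ y ∈ Ioo 0 α, √(1 + P y ^ 2) = D y + 1 := by
    intro y hy
    have := hDpos y hy
    rw [hP]
    simp only
    rw [Real.sq_sqrt (by positivity), show 1 + (D y ^ 2 + 2 * D y) = (D y + 1) ^ 2 by ring,
      Real.sqrt_sq (by positivity)]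
  have hdU : ∀ x ∈ Ioo (-L) 0, HasDerivAt U (P (U x) / √(1 + P (U x) ^ 2)) x := by
    intro x hx
    refine (hUd x hx).congr_deriv ?_
    rw [hP1 _ (hUmem x hx), slowness, inv_div]
  have hdP : ∀ x ∈ Ioo (-L) 0, HasDerivAt (fun x => P (U x)) (-(lam * g (U x) - mu)) x := by
    intro x hx
    have hy := hUmem x hx
    have hDy := hDpos _ hy
    have hPy : 0 < D (U x) ^ 2 + 2 * D (U x) := by positivity
    have h1 := hg.hasDerivAt_gap lam mu α hy.1
    have h2 := ((h1.pow 2).add (h1.const_mul 2)).sqrt hPy.ne'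
    refine (h2.comp x (hdU x hx)).congr_deriv ?_
    rw [hP1 _ hy]
    simp only [hP, Pi.add_apply, Pi.pow_apply, ← hD]
    have : 0 < √(D (U x) ^ 2 + 2 * D (U x)) := Real.sqrt_pos.2 hPy
    field_simp
    push_cast
    ring
  -- Even reflection of the rising branch; the momentum v is extended oddly.
  set u : ℝ → ℝ := fun x => U (-|x|) with hu
  set v : ℝ → ℝ := fun x => if x ≤ 0 then P (u x) else -P (u x) with hv
  have huc : Continuous u := hUc.comp continuous_abs.neg
  have hu0 : u 0 = α := by simp [hu, hUα]
  have hupos : ∀ x ∈ Ioo (-L) L, 0 < u x := by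
    intro x hx
    rw [← hU0]
    exact hUm (neg_lt_neg (abs_lt.2 ⟨hx.1, hx.2⟩))
  have hPα : P α = 0 := by simp [hP, hD, gap_self]
  have hv0 : v 0 = 0 := by simp [hv, hu0, hPα]
  have hneg : ∀ x ∈ Ioo (-L) 0, HasDerivAt u (v x / √(1 + v x ^ 2)) x ∧
      HasDerivAt v (-(lam * g (u x) - mu)) x := by
    intro x hx
    have hux : ∀ y : ℝ, y < 0 → u y = U y := fun y hy => by simp [hu, abs_of_neg hy]
    have hvx : ∀ y : ℝ, y < 0 → v y = P (U y) := fun y hy => by simp [hv, hy.le, hux y hy]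
    rw [hux x hx.2, hvx x hx.2]
    constructor
    · refine (hdU x hx).congr_of_eventuallyEq ?_
      filter_upwards [Iio_mem_nhds hx.2] with y hy using hux y hy
    · refine (hdP x hx).congr_of_eventuallyEq ?_
      filter_upwards [Iio_mem_nhds hx.2] with y hy using hvx y hy
  have hpos : ∀ x ∈ Ioo 0 L, HasDerivAt u (v x / √(1 + v x ^ 2)) x ∧
      HasDerivAt v (-(lam * g (u x) - mu)) x := by
    intro x hx
    have hux : ∀ y : ℝ, u y = u (-y) := fun y => by simp [hu]
    have hvx : ∀ y : ℝ, 0 < y → v y = -v (-y) := fun y hy => by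
      simp [hv, hy.le, not_le.2 hy, ← hux y]
    obtain ⟨h1, h2⟩ := hneg (-x) ⟨by linarith [hx.2], by linarith [hx.1]⟩
    rw [hux x, hvx x hx.1]
    constructor
    · refine ((h1.comp x (hasDerivAt_neg x)).congr_of_eventuallyEq
        (Eventually.of_forall hux)).congr_deriv ?_
      rw [neg_sq]; ring
    · refine ((h2.comp x (hasDerivAt_neg x)).neg.congr_of_eventuallyEq ?_).congr_deriv (by ring)
      filter_upwards [Ioi_mem_nhds hx.1] with y hy using hvx y hy
  have hne : ∀ᶠ x in 𝓝[≠] (0 : ℝ), HasDerivAt u (v x / √(1 + v x ^ 2)) x ∧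
      HasDerivAt v (-(lam * g (u x) - mu)) x := by
    filter_upwards [self_mem_nhdsWithin,
      mem_nhdsWithin_of_mem_nhds (Ioo_mem_nhds (neg_lt_zero.2 hL) hL)] with x hx0 hx
    rcases lt_or_gt_of_ne hx0 with h0 | h0
    · exact hneg x ⟨hx.1, h0⟩
    · exact hpos x ⟨h0, hx.2⟩
  have hvc : ContinuousAt v 0 := by
    have hPu : Tendsto (fun x => P (u x)) (𝓝 0) (𝓝 0) := by
      have h1 : ContinuousAt P (u 0) :=
        hPc.continuousAt (Ici_mem_nhds (by rw [hu0]; exact hα))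
      have := h1.tendsto.comp huc.continuousAt.tendsto
      rwa [hu0, hPα] at this
    rw [ContinuousAt, hv0]
    refine squeeze_zero_norm (fun x => ?_) hPu
    have : 0 ≤ P (u x) := Real.sqrt_nonneg _
    simp only [hv, Real.norm_eq_abs]
    split_ifs <;> simp [abs_of_nonneg this]
  -- At the maximum P has a vanishing radicand and the chain rule fails; the derivatives come from
  -- their continuous limits on both sides.
  have hzero : HasDerivAt u (v 0 / √(1 + v 0 ^ 2)) 0 ∧
      HasDerivAt v (-(lam * g (u 0) - mu)) 0 := by
    constructor
    · refine hasDerivAt_of_eventually_hasDerivAt (h := fun x => v x / √(1 + v x ^ 2))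
        huc.continuousAt ?_ (hne.mono fun x hx => hx.1)
      exact hvc.div (continuousAt_const.add (hvc.pow 2)).sqrt (by positivity)
    · refine hasDerivAt_of_eventually_hasDerivAt (h := fun x => -(lam * g (u x) - mu))
        hvc ?_ (hne.mono fun x hx => hx.2)
      have : ContinuousAt (fun x => g (u x)) 0 :=
        (hg.continuousAt (by rw [hu0]; exact hα)).comp huc.continuousAt
      exact ((continuousAt_const.mul this).sub continuousAt_const).neg
  have hall : ∀ x ∈ Ioo (-L) L, HasDerivAt u (v x / √(1 + v x ^ 2)) x ∧
      HasDerivAt v (-(lam * g (u x) - mu)) x := by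
    intro x hx
    rcases lt_trichotomy x 0 with h0 | rfl | h0
    · exact hneg x ⟨hx.1, h0⟩
    · exact hzero
    · exact hpos x ⟨h0, hx.2⟩
  have hsol : IsPositiveSolution g L lam mu u :=
    hg.isPositiveSolution_of_system huc (fun x hx => (hall x hx).1) (fun x hx => (hall x hx).2)
      (by simp [hu, abs_of_pos hL, hU0]) (by simp [hu, abs_of_pos hL, hU0]) hupos
  refine ⟨u, hsol, ?_⟩
  rw [hsol.supNorm_eq (x₀ := 0) ⟨by linarith, hL.le⟩, hu0]
  intro x _
  exact hUm.monotone (by simp)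

theorem mem_bifurcationCurve_iff (hg : IsGeneralizedLogistic g σ) {L lam mu α : ℝ} (hL : 0 < L)
    (hlam : 0 < lam) : (mu, α) ∈ bifurcationCurve g L lam ↔ OnCurve g σ L lam mu α := by
  constructor
  · rintro ⟨hmu, u, hu, rfl : α = supNorm L u⟩
    exact hu.onCurve hg hL hlam hmu
  · intro h
    obtain ⟨u, hu, hα⟩ := hg.exists_isPositiveSolution h
    exact ⟨h.mu_pos, u, hu, hα.symm⟩

/-! ### The level curve of the time map -/

theorem isReversedSubsetShaped_of_onCurve (hg : IsGeneralizedLogistic g σ) {L lam : ℝ}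
    (hL : 0 < L) (hlam : 0 < lam) {I : Set ℝ} {m : ℝ → ℝ}
    (hI : ∀ mu α, OnCurve g σ L lam mu α → α ∈ I) (hm : ∀ α ∈ I, OnCurve g σ L lam (m α) α)
    (hturn : ∃ a ∈ interior I, StrictMonoOn m (I ∩ Iic a) ∧ StrictAntiOn m (I ∩ Ici a)) :
    IsReversedSubsetShaped (bifurcationCurve g L lam) I m := by
  refine ⟨?_, hg.continuousOn_of_onCurve hm, hturn⟩
  ext ⟨mu, α⟩
  rw [hg.mem_bifurcationCurve_iff hL hlam]
  constructor
  · intro h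
    exact ⟨α, hI mu α h, Prod.ext (hg.onCurve_unique (hm α (hI mu α h)) h) rfl⟩
  · rintro ⟨β, hβ, heq⟩
    obtain ⟨rfl, rfl⟩ := Prod.mk.inj heq
    exact hm β hβ

/-- Near its upper end the level curve stays below any of its points. -/
theorem exists_forall_lt_of_tendsto_zero {m : ℝ → ℝ} {x γ : ℝ} (hx : 0 < m x) (hxγ : x < γ)
    (hm : Tendsto m (𝓝[<] γ) (𝓝 0)) : ∃ b ∈ Ioo x γ, ∀ u, b ≤ u → u < γ → m u < m x := by
  obtain ⟨l, hl, hsub⟩ := (mem_nhdsLT_iff_exists_Ioo_subset).1 (hm.eventually_lt_const hx)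
  obtain ⟨b, hb1, hb2⟩ := exists_between (max_lt hxγ hl)
  exact ⟨b, ⟨(le_max_left _ _).trans_lt hb1, hb2⟩,
    fun u hu huγ => hsub ⟨((le_max_right _ _).trans_lt hb1).trans_le hu, huγ⟩⟩

/-- T(0, α) < T(μ, α) = L = T(0, γ), and T(0, ·) is increasing. -/
theorem lt_of_onCurve (hg : IsGeneralizedLogistic g σ) {L lam mu α γ : ℝ} (hγ : γ ∈ Ioo 0 σ)
    (hγL : timeMap g lam 0 γ = L) (h : OnCurve g σ L lam mu α) : α < γ := by
  rw [← hg.timeMap_zero_lt_iff h.adm.lam_pos ⟨h.adm.pos, h.adm.lt⟩ hγ, hγL, ← h.eq]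
  exact hg.timeMap_lt_of_mu_lt h.adm h.mu_pos

theorem bifurcationCurve_eq_empty (hg : IsGeneralizedLogistic g σ) {L lam : ℝ} (hL : 0 < L)
    (hfin : derivZeroPlus g < ⊤) (hlam : 0 < lam) (h : lam ≤ kappa g L) :
    bifurcationCurve g L lam = ∅ := by
  refine eq_empty_iff_forall_notMem.2 fun ⟨mu, α⟩ hmem => ?_
  have hcurve := (hg.mem_bifurcationCurve_iff hL hlam).1 hmem
  have h1 := hg.le_timeMap_zero_of_le_kappa hL hfin hlam h ⟨hcurve.adm.pos, hcurve.adm.lt⟩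
  have h2 := hg.timeMap_lt_of_mu_lt hcurve.adm hcurve.mu_pos
  rw [hcurve.eq] at h2
  exact h2.not_ge h1

/-- The bifurcation curve for `κ < lam ≤ 4κ`. -/
theorem exists_isReversedSubsetShaped_Ioo (hg : IsGeneralizedLogistic g σ) {c L lam γ : ℝ}
    (hc : IsCStar g σ c) (hL : 0 < L) (hfin : derivZeroPlus g < ⊤) (hlam : 0 < lam)
    (h4 : lam ≤ 4 * kappa g L) (hγ : γ ∈ Ioo 0 σ) (hγL : timeMap g lam 0 γ = L) :
    ∃ m : ℝ → ℝ, IsReversedSubsetShaped (bifurcationCurve g L lam) (Ioo 0 γ) m ∧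
      Tendsto (fun α => (m α, α)) (𝓝[>] 0) (𝓝 ((0 : ℝ), (0 : ℝ))) ∧
      Tendsto (fun α => (m α, α)) (𝓝[<] γ) (𝓝 ((0 : ℝ), γ)) := by
  have hex : ∀ α, ∃ mu, α ∈ Ioo 0 γ → OnCurve g σ L lam mu α := by
    intro α
    by_cases hα : α ∈ Ioo 0 γ
    · have hασ : α ∈ Ioo 0 σ := ⟨hα.1, hα.2.trans hγ.2⟩
      obtain ⟨mu, hmu⟩ := (hg.exists_onCurve_iff hc hlam hασ (L := L)).2
        ⟨hγL ▸ (hg.timeMap_zero_lt_iff hlam hασ hγ).2 hα.2, by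
          rcases le_or_gt c α with hcα | hcα
          · exact Or.inl hcα
          · exact Or.inr (hg.le_edgeTimeMap_of_le_kappa hc hL hfin hlam h4 ⟨hα.1, hcα⟩)⟩
      exact ⟨mu, fun _ => hmu⟩
    · exact ⟨0, fun h => absurd h hα⟩
  choose m hm using hex
  -- Squeezed by 0 < m(α) ≤ λG(α)/α, whose right side tends to λg(0) = 0.
  have hm0 : Tendsto m (𝓝[>] 0) (𝓝 0) := by
    have hlim : Tendsto (fun α => lam * (primitive g α / α)) (𝓝[>] 0) (𝓝 0) := by
      simpa using hg.tendsto_mean_zero.const_mul lam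
    refine tendsto_of_tendsto_of_tendsto_of_le_of_le' tendsto_const_nhds hlim ?_ ?_
    · filter_upwards [Ioo_mem_nhdsGT hγ.1] with α hα using (hm α hα).mu_pos.le
    · filter_upwards [Ioo_mem_nhdsGT hγ.1] with α hα
      rw [← mul_div_assoc, le_div_iff₀ hα.1]
      exact (hm α hα).adm.mu_mul_le
  have hmγ : Tendsto m (𝓝[<] γ) (𝓝 0) := by
    refine hg.tendsto_of_onCurve hlam hγ hγL ?_
    filter_upwards [Ioo_mem_nhdsLT hγ.1] with α hα using hm α hα
  refine ⟨m, hg.isReversedSubsetShaped_of_onCurve hL hlam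
    (fun mu α h => ⟨h.adm.pos, hg.lt_of_onCurve hγ hγL h⟩) hm ?_,
    hm0.prodMk_nhds (tendsto_id.mono_left nhdsWithin_le_nhds),
    hmγ.prodMk_nhds (tendsto_id.mono_left nhdsWithin_le_nhds)⟩
  -- Any interior height works: m is positive there and tends to 0 at both ends.
  obtain ⟨x, hx⟩ := exists_between hγ.1
  have hmx := (hm x hx).mu_pos
  obtain ⟨b, hb, hbm⟩ := exists_forall_lt_of_tendsto_zero hmx hx.2 hmγ
  obtain ⟨r, hr, hsub⟩ := (mem_nhdsGT_iff_exists_Ioo_subset).1 (hm0.eventually_lt_const hmx)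
  obtain ⟨a, ha0, ha⟩ := exists_between (lt_min hx.1 hr)
  have hax := ha.trans_le (min_le_left _ _)
  have har := ha.trans_le (min_le_right _ _)
  refine exists_unimodal (hg.continuousOn_of_onCurve hm)
    (fun u hu v hv w hw h1 h2 => hg.onCurve_min_lt (hm u hu) (hm v hv) (hm w hw) h1 h2)
    hax hb.1 (Icc_subset_Ioo ha0 hb.2) ?_
  rintro u hu (h | h)
  · exact hsub ⟨hu.1, h.trans_lt har⟩
  · exact hbm u h hu.2

/-- The bifurcation curve for `lam > 4κ`. -/
theorem exists_isReversedSubsetShaped_Ico (hg : IsGeneralizedLogistic g σ) {c L lam γ θ : ℝ}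
    (hc : IsCStar g σ c) (hL : 0 < L) (hlam : 0 < lam) (hγ : γ ∈ Ioo 0 σ)
    (hγL : timeMap g lam 0 γ = L) (hθ : θ ∈ Ioo 0 c) (hθL : edgeTimeMap g lam θ = L) :
    ∃ m : ℝ → ℝ, IsReversedSubsetShaped (bifurcationCurve g L lam) (Ico θ γ) m ∧
      m θ = lam * (primitive g θ / θ) ∧
      Tendsto (fun α => (m α, α)) (𝓝[<] γ) (𝓝 ((0 : ℝ), γ)) := by
  have hcσ := hc.mem.2
  have hθc : OnCurve g σ L lam (lam * (primitive g θ / θ)) θ :=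
    ⟨mul_pos hlam (hg.mean_pos ⟨hθ.1, (hθ.2.trans hcσ).le⟩), hg.isAdmissible_edge hc hlam hθ, hθL⟩
  have hθγ : θ < γ := hg.lt_of_onCurve hγ hγL hθc
  have hex : ∀ α, ∃ mu, α ∈ Ico θ γ → OnCurve g σ L lam mu α := by
    intro α
    by_cases hα : α ∈ Ico θ γ
    · have hασ : α ∈ Ioo 0 σ := ⟨hθ.1.trans_le hα.1, hα.2.trans hγ.2⟩
      obtain ⟨mu, hmu⟩ := (hg.exists_onCurve_iff hc hlam hασ (L := L)).2
        ⟨hγL ▸ (hg.timeMap_zero_lt_iff hlam hασ hγ).2 hα.2, by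
          rcases le_or_gt c α with hcα | hcα
          · exact Or.inl hcα
          · refine Or.inr (hθL ▸ not_lt.1 fun h => ?_)
            exact ((hg.edgeTimeMap_lt_iff hc hlam ⟨hασ.1, hcα⟩ hθ).1 h).not_ge hα.1⟩
      exact ⟨mu, fun _ => hmu⟩
    · exact ⟨0, fun h => absurd h hα⟩
  choose m hm using hex
  have hmθ : m θ = lam * (primitive g θ / θ) := hg.onCurve_unique (hm θ ⟨le_rfl, hθγ⟩) hθc
  have hmγ : Tendsto m (𝓝[<] γ) (𝓝 0) := by
    refine hg.tendsto_of_onCurve hlam hγ hγL ?_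
    filter_upwards [Ioo_mem_nhdsLT hθγ] with α hα using hm α ⟨hα.1.le, hα.2⟩
  have hdom : ∀ mu α, OnCurve g σ L lam mu α → α ∈ Ico θ γ := by
    intro mu α h
    refine ⟨not_lt.1 fun hlt => ?_, hg.lt_of_onCurve hγ hγL h⟩
    rcases ((hg.exists_onCurve_iff hc hlam ⟨h.adm.pos, h.adm.lt⟩).1 ⟨mu, h⟩).2 with hcα | hle
    · linarith [hθ.2]
    · rw [← hθL] at hle
      exact hle.not_gt (hg.edgeTimeMap_lt hc hlam h.adm.pos hlt hθ.2)
  refine ⟨m, hg.isReversedSubsetShaped_of_onCurve hL hlam hdom hm ?_, hmθ,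
    hmγ.prodMk_nhds (tendsto_id.mono_left nhdsWithin_le_nhds)⟩
  -- Since T(μ̄, x) < L, the curve at x has m(x) > μ̄ = m(θ). The left end θ belongs to the
  -- interval, so this excludes a maximum there.
  obtain ⟨x, hx, hxc, hlt⟩ := hg.exists_timeMap_lt_edge hc hlam hθ hθγ
  have hmx := hm x ⟨hx.1.le, hx.2⟩
  obtain ⟨b, hb, hbm⟩ := exists_forall_lt_of_tendsto_zero hmx.mu_pos hx.2 hmγ
  refine exists_unimodal (hg.continuousOn_of_onCurve hm)
    (fun u hu v hv w hw h1 h2 => hg.onCurve_min_lt (hm u hu) (hm v hv) (hm w hw) h1 h2)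
    hx.1 hb.1 (fun u hu => ⟨hu.1, hu.2.trans_lt hb.2⟩) ?_
  rintro u hu (h | h)
  · rw [le_antisymm h hu.1, hmθ,
      ← hg.timeMap_lt_iff (hg.isAdmissible_edge_of_le hc hlam hθ.1 hx.1.le hxc) hmx.adm, hmx.eq,
      ← hθL]
    exact hlt
  · exact hbm u h hu.2

/-! ### The starting point of the curve -/

/-- The function λg - μ is strictly concave on [0, σ], equals -μ at both ends and is positive at t:
one zero on each side of t, and concavity fixes the signs elsewhere. -/
theorem exists_isZeroPair (hg : IsGeneralizedLogistic g σ) {mu lam t : ℝ} (hlam : 0 < lam)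
    (hmu : 0 < mu) (ht : t ∈ Ioo 0 σ) (hf : mu < lam * g t) :
    ∃ z b, IsZeroPair g σ mu lam z b ∧ t ∈ Ioo z b := by
  have hcont : ContinuousOn (fun u => lam * g u - mu) (Icc 0 σ) :=
    (continuousOn_const.mul hg.continuousOn_Icc).sub continuousOn_const
  have hconc : StrictConcaveOn ℝ (Icc 0 σ) fun u => lam * g u - mu := by
    refine ⟨convex_Icc _ _, fun x hx y hy hxy a b ha hb hab => ?_⟩
    have := mul_lt_mul_of_pos_left (hg.strictConcaveOn.2 hx hy hxy ha hb hab) hlam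
    simp only [smul_eq_mul] at this ⊢
    have : a * mu + b * mu = mu := by rw [← add_mul, hab, one_mul]
    linarith
  have hq : ∀ u v w, 0 ≤ u → u < v → v < w → w ≤ σ → 0 ≤ lam * g u - mu → 0 ≤ lam * g w - mu →
      0 < lam * g v - mu := by
    intro u v w h0 huv hvw hw hfu hfw
    have hmem : v ∈ openSegment ℝ u w := by
      rw [openSegment_eq_Ioo (huv.trans hvw)]; exact ⟨huv, hvw⟩
    exact (le_min hfu hfw).trans_lt (hconc.lt_on_openSegment ⟨h0, by linarith⟩
      ⟨by linarith, hw⟩ (huv.trans hvw).ne hmem)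
  obtain ⟨z, hz, hz0⟩ := intermediate_value_Ioo ht.1.le
    (hcont.mono (Icc_subset_Icc_right ht.2.le)) (show (0 : ℝ) ∈ Ioo _ _ from
      ⟨by simp [hg.map_zero, hmu], by linarith⟩)
  obtain ⟨b, hb, hb0⟩ := intermediate_value_Ioo' ht.2.le
    (hcont.mono (Icc_subset_Icc_left ht.1.le)) (show (0 : ℝ) ∈ Ioo _ _ from
      ⟨by simp [hg.map_sigma, hmu], by linarith⟩)
  simp only at hz0 hb0
  refine ⟨z, b, ⟨⟨hz.1, hz.2.trans ht.2⟩, ⟨ht.1.trans hb.1, hb.2⟩, hz.2.trans hb.1, hz0, hb0,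
    fun u hu => ?_, fun u hu => ?_, fun u hu => ?_⟩, hz.2, hb.1⟩
  · by_contra hcon
    exact (hq u z t hu.1.le hu.2 hz.2 ht.2.le (not_lt.1 hcon) (by linarith)).ne' hz0
  · exact hq z u b hz.1.le hu.1 hu.2 hb.2.le hz0.ge hb0.ge
  · by_contra hcon
    exact (hq t b u ht.1.le hb.1 hu.1 hu.2.le (by linarith) (not_lt.1 hcon)).ne' hb0

/-- Zeros t of λG(t) - μt have the same mean as θ. Positivity of λg - μ at t says that the mean is
below g(t), which forces t < c*, where the mean is injective. -/
theorem isTheta_edge (hg : IsGeneralizedLogistic g σ) {c lam θ : ℝ} (hc : IsCStar g σ c)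
    (hlam : 0 < lam) (hθ : θ ∈ Ioo 0 c) :
    IsTheta g σ (lam * (primitive g θ / θ)) lam θ ∧
      ∀ t, IsTheta g σ (lam * (primitive g θ / θ)) lam t → t = θ := by
  have hθσ : θ ∈ Ioo 0 σ := ⟨hθ.1, hθ.2.trans hc.mem.2⟩
  have hmu := mul_pos hlam (hg.mean_pos ⟨hθσ.1, hθσ.2.le⟩)
  constructor
  · obtain ⟨z, b, hzb, hmem⟩ := hg.exists_isZeroPair hlam hmu hθσ
      (mul_lt_mul_of_pos_left (hc.mean_lt hg hθ) hlam)
    refine ⟨z, b, hzb, hmem, ?_⟩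
    have := hθ.1.ne'
    field_simp
    ring
  · rintro t ⟨z, b, hzb, hmem, heq⟩
    have ht0 : 0 < t := hzb.left_mem.1.trans hmem.1
    have hmean : primitive g t / t = primitive g θ / θ := by
      have h1 : lam * (primitive g t - primitive g θ / θ * t) = 0 := by rw [← heq]; ring
      rw [div_eq_iff ht0.ne']
      linarith [(mul_eq_zero.1 h1).resolve_left hlam.ne']
    have hlt : primitive g t / t < g t := by
      rw [hmean]
      exact lt_of_mul_lt_mul_left (by linarith [hzb.pos_mid t hmem]) hlam.le
    have htc := hc.lt_of_mean_lt hg (hmem.2.trans hzb.right_mem.2) hlt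
    exact (hc.strictMonoOn_mean hg).injOn ⟨ht0, htc.le⟩ ⟨hθ.1, hθ.2.le⟩ hmean

theorem continuousOn_edgeTimeMap_lam (hg : IsGeneralizedLogistic g σ) {c α : ℝ}
    (hc : IsCStar g σ c) (hα : α ∈ Ioo 0 c) :
    ContinuousOn (fun lam => edgeTimeMap g lam α) (Ioi 0) :=
  hg.continuousOn_timeMap_comp continuousOn_id (continuousOn_id.mul continuousOn_const)
    continuousOn_const fun _ hlam => hg.isAdmissible_edge hc hlam hα

/-- As λ → 0 the deficit is at most λG(α) → 0 and the time diverges. This covers the case κ = 0,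
where λ approaches 0. -/
theorem exists_forall_lt_edgeTimeMap (hg : IsGeneralizedLogistic g σ) {c α : ℝ}
    (hc : IsCStar g σ c) (hα : α ∈ Ioo 0 c) {K : ℝ} (hK : 0 < K) :
    ∀ᶠ lam in 𝓝[>] (0 : ℝ), K < edgeTimeMap g lam α := by
  have hασ : α ∈ Ioo 0 σ := ⟨hα.1, hα.2.trans hc.mem.2⟩
  have hG := hg.primitive_pos ⟨hασ.1, hασ.2.le⟩
  have hlim : Tendsto (fun lam => lam * (2 * primitive g α / α ^ 2) * (K + 1) ^ 2) (𝓝[>] 0)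
      (𝓝 0) := by
    have : Continuous fun lam : ℝ => lam * (2 * primitive g α / α ^ 2) * (K + 1) ^ 2 := by fun_prop
    simpa using (this.tendsto 0).mono_left nhdsWithin_le_nhds
  filter_upwards [self_mem_nhdsWithin, hlim.eventually_lt_const one_pos] with lam hlam hlt
  have hlam : 0 < lam := hlam
  have h1 := hg.le_timeMap_of_gap_le (hg.isAdmissible_edge hc hlam hα)
    (B := lam * (2 * primitive g α / α ^ 2)) (k := fun _ => 1) (I := 1)
    (by have := hα.1; positivity) (fun _ _ => one_pos) (by simp) (by simp) (fun s hs => by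
      have hs' : α * s ∈ Ioc 0 σ := by
        refine ⟨mul_pos hα.1 hs.1, ?_⟩
        nlinarith [hs.2, hα.1, hασ.2]
      have hαne := hα.1.ne'
      have e : α ^ 2 * (lam * (2 * primitive g α / α ^ 2) * 1) / 2 = lam * primitive g α := by
        field_simp
      have h2 : primitive g α / α * (α - α * s) = primitive g α * (1 - s) := by field_simp
      rw [e, gap, mul_assoc lam, h2, ← mul_sub]
      refine mul_le_mul_of_nonneg_left ?_ hlam.le
      have h3 := hg.primitive_pos hs'
      have h4 := mul_nonneg hG.le (sub_nonneg.2 hs.2.le)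
      linarith)
  have h2 := le_div_sqrt zero_le_one (y := lam * (2 * primitive g α / α ^ 2)) (L := K + 1)
    (by have := hα.1; positivity) (by linarith) (by rw [one_pow]; exact hlt.le)
  rw [edgeTimeMap]
  linarith

/-- The lower bound for the deficit is linear in λ, so T exceeds α by at most O(λ^(-1/2)). -/
theorem eventually_edgeTimeMap_lt (hg : IsGeneralizedLogistic g σ) {c α L : ℝ}
    (hc : IsCStar g σ c) (hα : α ∈ Ioo 0 c) (hL : α < L) :
    ∀ᶠ lam in atTop, edgeTimeMap g lam α < L := by
  set d := g α - primitive g α / α with hd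
  have hd0 : 0 < d := sub_pos.2 (hc.mean_lt hg hα)
  have hα0 := hα.1
  have hL' : 0 < L - α := sub_pos.2 hL
  have hlim : Tendsto (fun lam => lam * (2 * d / α * (L - α) ^ 2)) atTop atTop :=
    tendsto_id.atTop_mul_const (by positivity)
  filter_upwards [eventually_gt_atTop 0, hlim.eventually_gt_atTop (Real.pi ^ 2)] with lam hlam hlt
  have hadm := hg.isAdmissible_edge hc hlam hα
  have h1 := hg.timeMap_le_of_le_gap hadm (B := lam * (2 * d / α)) (k := fun s => s * (1 - s))
    (by positivity) (fun s hs => mul_pos hs.1 (sub_pos.2 hs.2)) intervalIntegrable_arcsine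
    integral_arcsine (fun s hs => by
      refine le_trans (le_of_eq ?_) (hg.le_gap hadm ⟨hs.1.le, hs.2.le⟩)
      rw [← mul_sub, ← hd]
      field_simp)
  have h2 := div_sqrt_lt Real.pi_pos.le (y := lam * (2 * d / α)) (L := L - α) (by positivity) hL'
    (by rw [mul_assoc]; exact hlt)
  rw [edgeTimeMap]
  linarith

end IsGeneralizedLogistic

/-! ### Dependence of the starting point on λ -/

/-- The starting height as a function of `lam`. -/
structure IsEdgeRoot (g : ℝ → ℝ) (c L : ℝ) (θ : ℝ → ℝ) : Prop where
  mem : ∀ lam, 4 * kappa g L < lam → θ lam ∈ Ioo 0 c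
  eq : ∀ lam, 4 * kappa g L < lam → edgeTimeMap g lam (θ lam) = L

namespace IsEdgeRoot

variable {g : ℝ → ℝ} {σ c L : ℝ} {θ : ℝ → ℝ}

theorem lt_iff (hθ : IsEdgeRoot g c L θ) (hg : IsGeneralizedLogistic g σ) (hc : IsCStar g σ c)
    {lam α : ℝ} (hlam : 4 * kappa g L < lam) (hα : α ∈ Ioo 0 c) :
    α < θ lam ↔ edgeTimeMap g lam α < L := by
  have h0 : 0 < lam := by linarith [hg.kappa_nonneg L]
  rw [← hg.edgeTimeMap_lt_iff hc h0 hα (hθ.mem lam hlam), hθ.eq lam hlam]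

theorem gt_iff (hθ : IsEdgeRoot g c L θ) (hg : IsGeneralizedLogistic g σ) (hc : IsCStar g σ c)
    {lam α : ℝ} (hlam : 4 * kappa g L < lam) (hα : α ∈ Ioo 0 c) :
    θ lam < α ↔ L < edgeTimeMap g lam α := by
  have h0 : 0 < lam := by linarith [hg.kappa_nonneg L]
  rw [← hg.edgeTimeMap_lt_iff hc h0 (hθ.mem lam hlam) hα, hθ.eq lam hlam]

theorem strictMonoOn (hθ : IsEdgeRoot g c L θ) (hg : IsGeneralizedLogistic g σ)
    (hc : IsCStar g σ c) : StrictMonoOn θ (Ioi (4 * kappa g L)) := by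
  intro lam₁ h1 lam₂ h2 h12
  have h0 : 0 < lam₁ := (by linarith [hg.kappa_nonneg L] : 0 ≤ 4 * kappa g L).trans_lt h1
  rw [hθ.lt_iff hg hc h2 (hθ.mem _ h1)]
  exact (hg.edgeTimeMap_lt_of_lam_lt hc h0 h12 (hθ.mem _ h1)).trans_eq (hθ.eq _ h1)

theorem continuousOn (hθ : IsEdgeRoot g c L θ) (hg : IsGeneralizedLogistic g σ)
    (hc : IsCStar g σ c) : ContinuousOn θ (Ioi (4 * kappa g L)) := by
  intro lam₀ h₀
  have h0 : 0 < lam₀ := (by linarith [hg.kappa_nonneg L] : 0 ≤ 4 * kappa g L).trans_lt h₀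
  have hmem := hθ.mem lam₀ h₀
  have hcont : ∀ α ∈ Ioo 0 c, Tendsto (fun lam => edgeTimeMap g lam α)
      (𝓝[Ioi (4 * kappa g L)] lam₀) (𝓝 (edgeTimeMap g lam₀ α)) := fun α hα =>
    ((hg.continuousOn_edgeTimeMap_lam hc hα).continuousAt (Ioi_mem_nhds h0)).tendsto.mono_left
      nhdsWithin_le_nhds
  refine tendsto_order.2 ⟨fun a ha => ?_, fun a ha => ?_⟩
  · obtain ⟨α, hα, hαθ⟩ := exists_between (max_lt ha hmem.1)
    have hαc : α ∈ Ioo 0 c := ⟨(le_max_right _ _).trans_lt hα, hαθ.trans hmem.2⟩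
    filter_upwards [self_mem_nhdsWithin,
      (hcont α hαc).eventually_lt_const ((hθ.lt_iff hg hc h₀ hαc).1 hαθ)] with lam hlam hlt
    exact ((le_max_left _ _).trans_lt hα).trans ((hθ.lt_iff hg hc hlam hαc).2 hlt)
  · obtain ⟨α, hαθ, hα⟩ := exists_between (lt_min ha hmem.2)
    have hαc : α ∈ Ioo 0 c := ⟨hmem.1.trans hαθ, hα.trans_le (min_le_right _ _)⟩
    filter_upwards [self_mem_nhdsWithin,
      (hcont α hαc).eventually_const_lt ((hθ.gt_iff hg hc h₀ hαc).1 hαθ)] with lam hlam hlt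
    exact ((hθ.gt_iff hg hc hlam hαc).2 hlt).trans (hα.trans_le (min_le_left _ _))

/-- At each fixed height α the edge time exceeds L for λ close to 4κ, which puts θ below α.
Convergence within positive numbers is kept for composing with the limit of the mean at 0⁺. -/
theorem tendsto_nhdsGT (hθ : IsEdgeRoot g c L θ) (hg : IsGeneralizedLogistic g σ)
    (hc : IsCStar g σ c) (hL : 0 < L) :
    Tendsto θ (𝓝[>] (4 * kappa g L)) (𝓝[>] 0) := by
  refine tendsto_nhdsWithin_iff.2 ⟨tendsto_order.2 ⟨fun a ha => ?_, fun a ha => ?_⟩, ?_⟩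
  · filter_upwards [self_mem_nhdsWithin] with lam hlam using ha.trans (hθ.mem lam hlam).1
  · obtain ⟨α, hα0, hα⟩ := exists_between (lt_min ha hc.mem.1)
    have hαc : α ∈ Ioo 0 c := ⟨hα0, hα.trans_le (min_le_right _ _)⟩
    have hev : ∀ᶠ lam in 𝓝[>] (4 * kappa g L), L < edgeTimeMap g lam α := by
      rcases (hg.kappa_nonneg L).eq_or_lt with h0 | h0
      · rw [← h0, mul_zero]
        exact hg.exists_forall_lt_edgeTimeMap hc hαc hL
      · have hfin : derivZeroPlus g < ⊤ := by
          refine lt_top_iff_ne_top.2 fun h => h0.ne' ?_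
          rw [kappa, if_pos h]
        have h4 : 0 < 4 * kappa g L := by linarith
        -- At λ = 4κ the edge time is at least L at α/2, hence strictly larger at α.
        have h1 : L < edgeTimeMap g (4 * kappa g L) α :=
          (hg.le_edgeTimeMap_of_le_kappa hc hL hfin h4 le_rfl
            ⟨half_pos hα0, (half_lt_self hα0).trans hαc.2⟩).trans_lt
            (hg.edgeTimeMap_lt hc h4 (half_pos hα0) (half_lt_self hα0) hαc.2)
        exact nhdsWithin_le_nhds (((hg.continuousOn_edgeTimeMap_lam hc hαc).continuousAt
          (Ioi_mem_nhds h4)).eventually_const_lt h1)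
    filter_upwards [self_mem_nhdsWithin, hev] with lam hlam hlt
    exact ((hθ.gt_iff hg hc hlam hαc).2 hlt).trans (hα.trans_le (min_le_left _ _))
  · filter_upwards [self_mem_nhdsWithin] with lam hlam using (hθ.mem lam hlam).1

/-- The root lies below c*, and below L because no solution height exceeds its time (speed less than
1). Conversely, at any α < min(c*, L) the edge time falls below L for large λ. -/
theorem tendsto_atTop (hθ : IsEdgeRoot g c L θ) (hg : IsGeneralizedLogistic g σ)
    (hc : IsCStar g σ c) (hL : 0 < L) : Tendsto θ atTop (𝓝 (min c L)) := by
  refine tendsto_order.2 ⟨fun a ha => ?_, fun a ha => ?_⟩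
  · obtain ⟨α, hα, hαm⟩ := exists_between (max_lt ha (lt_min hc.mem.1 hL))
    have hαc : α ∈ Ioo 0 c :=
      ⟨(le_max_right _ _).trans_lt hα, hαm.trans_le (min_le_left _ _)⟩
    filter_upwards [eventually_gt_atTop (4 * kappa g L),
      hg.eventually_edgeTimeMap_lt hc hαc (hαm.trans_le (min_le_right _ _))] with lam hlam hlt
    exact ((le_max_left _ _).trans_lt hα).trans ((hθ.lt_iff hg hc hlam hαc).2 hlt)
  · filter_upwards [eventually_gt_atTop (4 * kappa g L)] with lam hlam
    have h0 : 0 < lam := by linarith [hg.kappa_nonneg L]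
    refine (le_min (hθ.mem lam hlam).2.le ?_).trans_lt ha
    exact (hg.le_timeMap (hg.isAdmissible_edge hc h0 (hθ.mem lam hlam))).trans_eq (hθ.eq lam hlam)

theorem strictMonoOn_mu (hθ : IsEdgeRoot g c L θ) (hg : IsGeneralizedLogistic g σ)
    (hc : IsCStar g σ c) :
    StrictMonoOn (fun lam => lam * (primitive g (θ lam) / θ lam)) (Ioi (4 * kappa g L)) := by
  intro lam₁ h1 lam₂ h2 h12
  have h0 : 0 < lam₁ := (by linarith [hg.kappa_nonneg L] : 0 ≤ 4 * kappa g L).trans_lt h1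
  have m1 := hθ.mem _ h1
  have m2 := hθ.mem _ h2
  exact mul_lt_mul'' h12 (hc.strictMonoOn_mean hg ⟨m1.1, m1.2.le⟩ ⟨m2.1, m2.2.le⟩
    (hθ.strictMonoOn hg hc h1 h2 h12)) h0.le
    (hg.mean_pos ⟨m1.1, (m1.2.trans hc.mem.2).le⟩).le

theorem continuousOn_mu (hθ : IsEdgeRoot g c L θ) (hg : IsGeneralizedLogistic g σ)
    (hc : IsCStar g σ c) :
    ContinuousOn (fun lam => lam * (primitive g (θ lam) / θ lam)) (Ioi (4 * kappa g L)) :=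
  continuousOn_id.mul (hg.continuousOn_mean.comp (hθ.continuousOn hg hc)
    fun lam hlam => (hθ.mem lam hlam).1)

theorem tendsto_mu_nhdsGT (hθ : IsEdgeRoot g c L θ) (hg : IsGeneralizedLogistic g σ)
    (hc : IsCStar g σ c) (hL : 0 < L) :
    Tendsto (fun lam => lam * (primitive g (θ lam) / θ lam)) (𝓝[>] (4 * kappa g L)) (𝓝 0) := by
  have h1 := hg.tendsto_mean_zero.comp (hθ.tendsto_nhdsGT hg hc hL)
  have h2 : Tendsto (fun lam : ℝ => lam) (𝓝[>] (4 * kappa g L)) (𝓝 (4 * kappa g L)) :=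
    tendsto_id.mono_left nhdsWithin_le_nhds
  simpa using h2.mul h1

/-- The mean at θ increases with λ, so μ̄ grows at least linearly. -/
theorem tendsto_mu_atTop (hθ : IsEdgeRoot g c L θ) (hg : IsGeneralizedLogistic g σ)
    (hc : IsCStar g σ c) :
    Tendsto (fun lam => lam * (primitive g (θ lam) / θ lam)) atTop atTop := by
  obtain ⟨lam₁, h1⟩ := exists_gt (4 * kappa g L)
  have m1 := hθ.mem _ h1
  refine tendsto_atTop_mono' _ ?_ (tendsto_id.atTop_mul_const
    (hg.mean_pos ⟨m1.1, (m1.2.trans hc.mem.2).le⟩))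
  filter_upwards [eventually_gt_atTop lam₁] with lam hlam
  have h2 := h1.trans hlam
  have m2 := hθ.mem _ h2
  have h0 : 0 ≤ lam := by linarith [hg.kappa_nonneg L]
  exact mul_le_mul_of_nonneg_left (hc.strictMonoOn_mean hg ⟨m1.1, m1.2.le⟩ ⟨m2.1, m2.2.le⟩
    (hθ.strictMonoOn hg hc h1 h2 hlam)).le h0

end IsEdgeRoot

end MinkowskiLogistic

/-! ### The main theorem -/

theorem theorem2p2 (g : ℝ → ℝ) (σ L : ℝ)
    (hg : MinkowskiLogistic.IsGeneralizedLogistic g σ) (hL : 0 < L) :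
    ∃ (cStar : ℝ) (γ : ℝ → ℝ),
      -- the numbers `c*` and `γ_lam` are well defined
      (MinkowskiLogistic.IsCStar g σ cStar ∧
        ∀ c : ℝ, MinkowskiLogistic.IsCStar g σ c → c = cStar) ∧
      (∀ lam : ℝ, MinkowskiLogistic.kappa g L < lam →
        MinkowskiLogistic.IsGamma g σ L lam (γ lam) ∧
          ∀ c : ℝ, MinkowskiLogistic.IsGamma g σ L lam c → c = γ lam) ∧
      -- (i) `g'(0⁺)` is finite
      (MinkowskiLogistic.derivZeroPlus g < ⊤ →
        (∀ lam : ℝ, 0 < lam → lam ≤ MinkowskiLogistic.kappa g L →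
          MinkowskiLogistic.bifurcationCurve g L lam = ∅) ∧
        (∀ lam : ℝ, MinkowskiLogistic.kappa g L < lam →
          lam ≤ 4 * MinkowskiLogistic.kappa g L →
          ∃ m : ℝ → ℝ,
            MinkowskiLogistic.IsReversedSubsetShaped
              (MinkowskiLogistic.bifurcationCurve g L lam) (Ioo 0 (γ lam)) m ∧
            Tendsto (fun α => (m α, α)) (𝓝[>] 0) (𝓝 ((0 : ℝ), (0 : ℝ))) ∧
            Tendsto (fun α => (m α, α)) (𝓝[<] (γ lam)) (𝓝 ((0 : ℝ), γ lam)))) ∧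
      -- (ii) `lam > 4κ`, with `g'(0⁺)` finite or infinite
      (∃ muBar theta : ℝ → ℝ,
        (∀ lam : ℝ, 4 * MinkowskiLogistic.kappa g L < lam →
          muBar lam ∈ Ioo 0 (g cStar * lam) ∧
          (MinkowskiLogistic.IsTheta g σ (muBar lam) lam (theta lam) ∧
            ∀ t : ℝ, MinkowskiLogistic.IsTheta g σ (muBar lam) lam t → t = theta lam) ∧
          ∃ m : ℝ → ℝ,
            MinkowskiLogistic.IsReversedSubsetShaped
              (MinkowskiLogistic.bifurcationCurve g L lam) (Ico (theta lam) (γ lam)) m ∧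
            m (theta lam) = muBar lam ∧
            Tendsto (fun α => (m α, α)) (𝓝[<] (γ lam)) (𝓝 ((0 : ℝ), γ lam))) ∧
        StrictMonoOn muBar (Ioi (4 * MinkowskiLogistic.kappa g L)) ∧
        ContinuousOn muBar (Ioi (4 * MinkowskiLogistic.kappa g L)) ∧
        StrictMonoOn theta (Ioi (4 * MinkowskiLogistic.kappa g L)) ∧
        ContinuousOn theta (Ioi (4 * MinkowskiLogistic.kappa g L)) ∧
        Tendsto (fun lam => (muBar lam, theta lam))
          (𝓝[>] (4 * MinkowskiLogistic.kappa g L)) (𝓝 ((0 : ℝ), (0 : ℝ))) ∧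
        Tendsto muBar atTop atTop ∧
        Tendsto theta atTop (𝓝 (min cStar L))) := by
  obtain ⟨c, hc⟩ := hg.exists_isCStar
  have hκ := hg.kappa_nonneg L
  -- The guarded form makes γ a total function of λ, with a dummy value 0 where no root is claimed;
  -- likewise for θ below.
  have hexγ : ∀ lam, ∃ γ, MinkowskiLogistic.kappa g L < lam →
      γ ∈ Ioo 0 σ ∧ MinkowskiLogistic.timeMap g lam 0 γ = L := by
    intro lam
    by_cases h : MinkowskiLogistic.kappa g L < lam
    · obtain ⟨γ, hγ⟩ := hg.exists_timeMap_zero_eq hL h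
      exact ⟨γ, fun _ => hγ⟩
    · exact ⟨0, fun h' => absurd h' h⟩
  choose γ hγ using hexγ
  have hexθ : ∀ lam, ∃ θ, 4 * MinkowskiLogistic.kappa g L < lam →
      θ ∈ Ioo 0 c ∧ MinkowskiLogistic.edgeTimeMap g lam θ = L := by
    intro lam
    by_cases h : 4 * MinkowskiLogistic.kappa g L < lam
    · obtain ⟨θ, hθ⟩ := hg.exists_edgeTimeMap_eq hc hL h
      exact ⟨θ, fun _ => hθ⟩
    · exact ⟨0, fun h' => absurd h' h⟩
  choose θ hθ using hexθ
  have hroot : MinkowskiLogistic.IsEdgeRoot g c L θ :=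
    ⟨fun lam h => (hθ lam h).1, fun lam h => (hθ lam h).2⟩
  refine ⟨c, γ, ⟨hc, fun c' h' => hc.unique h'⟩, fun lam h => ⟨⟨(hγ lam h).1, ?_⟩, ?_⟩,
    fun hfin => ⟨fun lam h0 h => hg.bifurcationCurve_eq_empty hL hfin h0 h, fun lam h h4 =>
      hg.exists_isReversedSubsetShaped_Ioo hc hL hfin (hκ.trans_lt h) h4 (hγ lam h).1 (hγ lam h).2⟩,
    fun lam => lam * (MinkowskiLogistic.primitive g (θ lam) / θ lam), θ, fun lam h => ?_,
    hroot.strictMonoOn_mu hg hc, hroot.continuousOn_mu hg hc, hroot.strictMonoOn hg hc,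
    hroot.continuousOn hg hc, (hroot.tendsto_mu_nhdsGT hg hc hL).prodMk_nhds
      ((hroot.tendsto_nhdsGT hg hc hL).mono_right nhdsWithin_le_nhds),
    hroot.tendsto_mu_atTop hg hc, hroot.tendsto_atTop hg hc hL⟩
  · rw [MinkowskiLogistic.timeMapZero_eq]
    exact (hγ lam h).2
  · rintro γ' ⟨hmem, heq⟩
    rw [MinkowskiLogistic.timeMapZero_eq, ← (hγ lam h).2] at heq
    have hlam := hκ.trans_lt h
    rcases lt_trichotomy γ' (γ lam) with hlt | rfl | hlt
    · exact absurd heq ((hg.timeMap_zero_lt_iff hlam hmem (hγ lam h).1).2 hlt).ne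
    · rfl
    · exact absurd heq ((hg.timeMap_zero_lt_iff hlam (hγ lam h).1 hmem).2 hlt).ne'
  · have hκlam : MinkowskiLogistic.kappa g L < lam := by linarith
    have hlam : 0 < lam := hκ.trans_lt hκlam
    obtain ⟨hθc, hθL⟩ := hθ lam h
    refine ⟨⟨mul_pos hlam (hg.mean_pos ⟨hθc.1, (hθc.2.trans hc.mem.2).le⟩), ?_⟩,
      hg.isTheta_edge hc hlam hθc,
      hg.exists_isReversedSubsetShaped_Ico hc hL hlam (hγ lam hκlam).1 (hγ lam hκlam).2 hθc hθL⟩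
    -- The bound μ̄ < λg(c*) = λG(c*)/c* is strict monotonicity of the mean up to c*.
    rw [← hc.value, mul_comm _ lam]
    exact mul_lt_mul_of_pos_left
      (hc.strictMonoOn_mean hg ⟨hθc.1, hθc.2.le⟩ ⟨hc.mem.1, le_rfl⟩ hθc.2) hlam
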